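/- Let $p \equiv l \equiv 1 \pmod 8$ be primes with $(p/l) = -1$, let $k = pl$, and let $E/\mathbb{Q}$ be the elliptic curve $y^2 = x(x^2-k^2)$, with the $2$-isogeny $\phi : E \to \widehat{E}$ with kernel $\{O,(0,0)\}$, where $\widehat{E} : y^2 = x(x^2+4k^2)$. For $b_1 \in \mathbb{Q}^\times$ let $\mathcal{T}^{(\phi)}(b_1)$ be the torsor $$N^2 = b_1 M^4 + b_2 e^4, \qquad b_1 b_2 = 4k^2,$$ where a point over a field always means a point $(N,M,e) \neq (0,0,0)$. Let $S^{(\phi)}(E/\mathbb{Q}) \subseteq \mathbb{Q}^\times/\mathbb{Q}^{\times 2}$ be the group of classes of all $b_1$ such that $\mathcal{T}^{(\phi)}(b_1)$ has a point over $\mathbb{R}$ and over $\mathbb{Q}_q$ for all primes $q$, let $W(E/\mathbb{Q}) \subseteq S^{(\phi)}(E/\mathbb{Q})$ be the subgroup of classes of all $b_1$ such that $\mathcal{T}^{(\phi)}(b_1)$ has a rational point, and define $Ш(E/\mathbb{Q})[\phi]$ by the exact sequence $$0 \to W(E/\mathbb{Q}) \to S^{(\phi)}(E/\mathbb{Q})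 \to Ш(E/\mathbb{Q})[\phi] \to 0.$$ Write $\langle 2, pl\rangle$ for the subgroup of $\mathbb{Q}^\times/\mathbb{Q}^{\times 2}$ generated by the classes of $2$ and $pl$. For a prime $q \equiv 1 \pmod 8$, the number $-4$ is a quartic residue modulo $q$; let $(-4/q)_8 = 1$ if $-4$ is an eighth power modulo $q$, and $(-4/q)_8 = -1$ otherwise. Suppose that $(-4/p)_8\,(-4/l)_8 = -1$. Then: (a) none of the torsors $\mathcal{T}^{(\phi)}(2)$, $\mathcal{T}^{(\phi)}(pl)$, $\mathcal{T}^{(\phi)}(2pl)$ has a rational point; (b) $Ш(E/\mathbb{Q})[\phi] = \langle 2, pl\rangle$; that is, $S^{(\phi)}(E/\mathbb{Q}) = \langle 2, pl\rangle$, $W(E/\mathbb{Q}) = 1$, and the projection $S^{(\phi)}(E/\mathbb{Q}) \to Ш(E/\mathbb{Q})[\phi]$ is an isomorphism; (c) $\#Ш(E/\mathbb{Q})[2] = 4$, where $Ш(E/\mathbb{Q})$ is the Tate-Shafarevich group of $E$, i.e. the kernel of $H^1(\mathbb{Q},E) \to H^1(\mathbb{R},E) \times \prod_q H^1(\mathbb{Q}_q,E)$.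 -/

import Mathlib

noncomputable section

namespace CongruentDescent

/-! ### The quartic torsors -/

/-- The torsor `N ^ 2 = b₁ M ^ 4 + b₂ e ^ 4` has a non-trivial point (that is, a point
`(N, M, e) ≠ (0, 0, 0)`) over the field `F`. -/
def TorsorHasPoint {F : Type*} [Field F] (b₁ b₂ : F) : Prop :=
  ∃ N M e : F, ¬ (N = 0 ∧ M = 0 ∧ e = 0) ∧ N ^ 2 = b₁ * M ^ 4 + b₂ * e ^ 4

theorem TorsorHasPoint.mul_sq {F : Type*} [Field F] {B d t : F} (hd : d ≠ 0) (ht : t ≠ 0)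
    (h : TorsorHasPoint d (B / d)) : TorsorHasPoint (d * t ^ 2) (B / (d * t ^ 2)) := by
  obtain ⟨N, M, e, h0, h⟩ := h
  refine ⟨t * N, M, t * e, ?_, ?_⟩
  · simpa [ht] using h0
  · rw [mul_pow, h]; field_simp

theorem torsorHasPoint_of_eq_sq {F : Type*} [Field F] {d t : F} (b : F) (h : d = t ^ 2) :
    TorsorHasPoint d b :=
  ⟨t, 1, 0, by simp, by simp [h]⟩

/-- A point of the torsor of `d`, where `d` is not a square, gives a point of
`y ^ 2 = x ^ 3 + B x` whose `x`-coordinate lies in the square class of `d`. -/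
theorem TorsorHasPoint.exists_point {F : Type*} [Field F] {B d : F} (hd : d ≠ 0) (hB : B ≠ 0)
    (h : TorsorHasPoint d (B / d)) (hs : ∀ t, d ≠ t ^ 2) :
    (∃ s : F, s ≠ 0 ∧ B = d * s ^ 2) ∨
      ∃ s y : F, s ≠ 0 ∧ y ^ 2 = (d * s ^ 2) ^ 3 + B * (d * s ^ 2) := by
  obtain ⟨N, M, e, h0, h⟩ := h
  by_cases he : e = 0
  · subst he
    by_cases hM : M = 0
    · subst hM
      simp at h
      exact absurd ⟨h, rfl, rfl⟩ h0
    · exact absurd (by field_simp; linear_combination -h) (hs (N / M ^ 2))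
  · by_cases hM : M = 0
    · subst hM
      refine .inl ⟨N / (d * e ^ 2) * d, ?_, ?_⟩
      · intro hN
        have hN : N = 0 := by simpa [he, hd] using hN
        subst hN
        have : B / d * e ^ 4 = 0 := by linear_combination -h
        simp [hB, hd, he] at this
      · have : d * N ^ 2 = B * e ^ 4 := by rw [h]; field_simp; ring
        field_simp
        linear_combination -this
    · refine .inr ⟨M / e, d * M * N / e ^ 3, div_ne_zero hM he, ?_⟩
      have : d * N ^ 2 = d ^ 2 * M ^ 4 + B * e ^ 4 := by rw [h]; field_simp
      field_simp
      linear_combination this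

theorem torsorHasPoint_of_point {F : Type*} [Field F] {B d s y : F} (hd : d ≠ 0) (hs : s ≠ 0)
    (h : y ^ 2 = (d * s ^ 2) ^ 3 + B * (d * s ^ 2)) : TorsorHasPoint d (B / d) := by
  refine ⟨y / (d * s), s, 1, by simp, ?_⟩
  field_simp
  linear_combination h

theorem torsorHasPoint_of_eq_mul_sq {F : Type*} [Field F] {B d s : F} (hd : d ≠ 0)
    (h : B = d * s ^ 2) : TorsorHasPoint d (B / d) :=
  ⟨s, 0, 1, by simp, by rw [h]; field_simp; ring⟩

theorem torsorHasPoint_of_translate {F : Type*} [Field F] {B d₁ d₂ s t y : F} (h₁ : d₁ ≠ 0)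
    (h₂ : d₂ ≠ 0) (hs : s ≠ 0) (ht : t ≠ 0) (e₁ : B = d₁ * s ^ 2)
    (e₂ : y ^ 2 = (d₂ * t ^ 2) ^ 3 + B * (d₂ * t ^ 2)) :
    TorsorHasPoint (d₁ * d₂) (B / (d₁ * d₂)) := by
  refine torsorHasPoint_of_point (s := s / (d₂ * t)) (y := B * y / (d₂ * t ^ 2) ^ 2)
    (mul_ne_zero h₁ h₂) (div_ne_zero hs (mul_ne_zero h₂ ht)) ?_
  have e : d₁ * d₂ * (s / (d₂ * t)) ^ 2 = B / (d₂ * t ^ 2) := by rw [e₁]; field_simp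
  rw [e, div_pow, mul_pow, e₂]
  field_simp
  ring

/-- Products of classes whose torsors have points again have this property. -/
theorem TorsorHasPoint.mul {F : Type*} [Field F] {B d₁ d₂ : F} (h₁ : d₁ ≠ 0) (h₂ : d₂ ≠ 0)
    (H₁ : TorsorHasPoint d₁ (B / d₁)) (H₂ : TorsorHasPoint d₂ (B / d₂)) :
    TorsorHasPoint (d₁ * d₂) (B / (d₁ * d₂)) := by
  by_cases hB : B = 0
  · exact ⟨0, 0, 1, by simp, by simp [hB]⟩
  by_cases hs₁ : ∃ t, d₁ = t ^ 2
  · obtain ⟨t, rfl⟩ := hs₁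
    rw [mul_comm]
    exact H₂.mul_sq h₂ (by simpa using h₁)
  by_cases hs₂ : ∃ t, d₂ = t ^ 2
  · obtain ⟨t, rfl⟩ := hs₂
    exact H₁.mul_sq h₁ (by simpa using h₂)
  push Not at hs₁ hs₂
  have h₁₂ := mul_ne_zero h₁ h₂
  obtain ⟨s, hs, e₁⟩ | ⟨s, y₁, hs, e₁⟩ := H₁.exists_point h₁ hB hs₁
  · obtain ⟨t, ht, e₂⟩ | ⟨t, y₂, ht, e₂⟩ := H₂.exists_point h₂ hB hs₂
    · refine torsorHasPoint_of_eq_sq (t := d₂ * t / s) _ ?_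
      field_simp
      linear_combination e₂ - e₁
    · exact torsorHasPoint_of_translate h₁ h₂ hs ht e₁ e₂
  · obtain ⟨t, ht, e₂⟩ | ⟨t, y₂, ht, e₂⟩ := H₂.exists_point h₂ hB hs₂
    · rw [mul_comm]
      exact torsorHasPoint_of_translate h₂ h₁ ht hs e₂ e₁
    · have hst := mul_ne_zero hs ht
      obtain ⟨x₁, hx₁⟩ : ∃ x, x = d₁ * s ^ 2 := ⟨_, rfl⟩
      obtain ⟨x₂, hx₂⟩ : ∃ x, x = d₂ * t ^ 2 := ⟨_, rfl⟩
      have hx : x₁ * x₂ = d₁ * d₂ * (s * t) ^ 2 := by rw [hx₁, hx₂]; ring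
      have hx0 : x₁ * x₂ ≠ 0 := by rw [hx]; exact mul_ne_zero h₁₂ (pow_ne_zero _ hst)
      rw [← hx₁] at e₁
      rw [← hx₂] at e₂
      by_cases hxx : x₁ = x₂
      · refine torsorHasPoint_of_eq_sq (t := x₁ / (s * t)) _ ?_
        field_simp
        linear_combination -x₁ * hxx - hx
      have hxx' := sub_ne_zero.mpr hxx
      by_cases hc : y₁ * x₂ = y₂ * x₁
      · refine torsorHasPoint_of_eq_mul_sq (s := s * t) h₁₂ ?_
        rw [← hx]
        have : x₁ * x₂ * (x₁ - x₂) * (B - x₁ * x₂) = 0 := by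
          linear_combination
            x₂ ^ 2 * e₁ - x₁ ^ 2 * e₂ - (y₁ * x₂ + y₂ * x₁) * hc
        have := (mul_eq_zero.mp this).resolve_left (mul_ne_zero hx0 hxx')
        linear_combination this
      obtain ⟨m, hm⟩ : ∃ m, m * (x₁ - x₂) = y₁ - y₂ := ⟨(y₁ - y₂) / (x₁ - x₂), by field_simp⟩
      obtain ⟨c, hcc⟩ : ∃ c, c = y₁ - m * x₁ := ⟨_, rfl⟩
      have hc0 : c ≠ 0 := by
        rintro rfl
        exact hc (by linear_combination (x₁ - x₂) * hcc - x₁ * hm)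
      have hy₁ : y₁ = m * x₁ + c := by rw [hcc]; ring
      have hy₂ : y₂ = m * x₂ + c := by rw [hcc]; linear_combination hm
      subst hy₁ hy₂
      obtain ⟨x₃, hx₃⟩ : ∃ x, x = m ^ 2 - x₁ - x₂ := ⟨_, rfl⟩
      have hB' : B = 2 * m * c + m ^ 2 * (x₁ + x₂) - (x₁ ^ 2 + x₁ * x₂ + x₂ ^ 2) := by
        apply mul_right_cancel₀ hxx'
        linear_combination e₂ - e₁
      have hprod : x₁ * x₂ * x₃ = c ^ 2 := by
        rw [hB'] at e₁
        rw [hx₃]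
        linear_combination -e₁
      have hd : d₁ * d₂ * (c / (x₁ * x₂) * (s * t)) ^ 2 = x₃ := by
        apply mul_left_cancel₀ hx0
        rw [hprod, mul_pow, mul_left_comm (d₁ * d₂), ← hx, div_pow, div_mul_eq_mul_div, mul_comm (x₁ * x₂)]
        have := pow_ne_zero 2 hx0
        rw [div_mul_eq_mul_div, div_eq_iff this]
        ring
      refine torsorHasPoint_of_point (s := c / (x₁ * x₂) * (s * t)) (y := m * x₃ + c) h₁₂
        (mul_ne_zero (div_ne_zero hc0 hx0) hst) ?_
      rw [hd]
      rw [hB']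
      rw [hx₃] at hprod ⊢
      linear_combination -hprod

/-- The group of all `d ∈ Fˣ` such that the torsor `N ^ 2 = d M ^ 4 + (B / d) e ^ 4` has a
non-trivial point over `F`. -/
def torsorSubgroup (F : Type*) [Field F] (B : F) : Subgroup Fˣ where
  carrier := {d | TorsorHasPoint (d : F) (B / d)}
  one_mem' := torsorHasPoint_of_eq_sq (t := 1) _ (by simp)
  mul_mem' {a b} ha hb := by
    simpa using TorsorHasPoint.mul a.ne_zero b.ne_zero ha hb
  inv_mem' {a} ha := by
    have h := TorsorHasPoint.mul_sq a.ne_zero (inv_ne_zero a.ne_zero) ha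
    have e : (a : F) * (a : F)⁻¹ ^ 2 = ((a⁻¹ : Fˣ) : F) := by
      rw [Units.val_inv_eq_inv_val]; have := a.ne_zero; field_simp
    rw [e] at h
    exact h

/-- The group `ℚˣ / ℚˣ²` of square classes. -/
abbrev SquareClass : Type := ℚˣ ⧸ (powMonoidHom 2 : ℚˣ →* ℚˣ).range

/-- The square class of a rational number different from `0`. -/
def squareClass (x : ℚ) (hx : x ≠ 0) : SquareClass := QuotientGroup.mk (Units.mk0 x hx)

/-- The group `W` of the classes `b₁ ℚˣ²` such that the torsor
`N ^ 2 = b₁ M ^ 4 + b₂ e ^ 4`, `b₁ b₂ = B`, has a non-trivial rational point. -/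
def solvableGroup (B : ℚ) : Subgroup SquareClass :=
  (torsorSubgroup ℚ B).map (QuotientGroup.mk' _)

/-- The Selmer group of the classes `b₁ ℚˣ²` such that the torsor
`N ^ 2 = b₁ M ^ 4 + b₂ e ^ 4`, `b₁ b₂ = B`, has a non-trivial point over `ℝ` and over all
fields `ℚ_p`. -/
def selmerGroup (B : ℚ) : Subgroup SquareClass :=
  ((torsorSubgroup ℝ (B : ℝ)).comap (Units.map (algebraMap ℚ ℝ : ℚ →* ℝ)) ⊓
    ⨅ (q : ℕ) (_ : Fact q.Prime),
      (torsorSubgroup ℚ_[q] (B : ℚ_[q])).comap (Units.map (algebraMap ℚ ℚ_[q] : ℚ →* ℚ_[q]))).map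
    (QuotientGroup.mk' _)

/-- The number `b₁ b₂` for the torsors `𝒯^(φ)(b₁)` of `E_k : y ^ 2 = x (x ^ 2 - k ^ 2)`. -/
def phiProduct (k : ℤ) : ℚ := if Even k then (k : ℚ) ^ 2 / 4 else 4 * (k : ℚ) ^ 2

/-- The torsor `𝒯^(φ)(b₁)` of `E_k` has a non-trivial rational point. -/
def PhiTorsorSolvable (k : ℤ) (b₁ : ℚ) : Prop :=
  TorsorHasPoint b₁ (phiProduct k / b₁)

/-- The Selmer group `S^(φ)(E_k / ℚ)`. -/
def selmerPhi (k : ℤ) : Subgroup SquareClass := selmerGroup (phiProduct k)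

/-- The group `W(E_k / ℚ)`, the classes `b₁ ℚˣ²` whose torsor `𝒯^(φ)(b₁)` has a rational
point. -/
def solvablePhi (k : ℤ) : Subgroup SquareClass := solvableGroup (phiProduct k)

/-- `Ш(E_k / ℚ)[φ]`, by the exact sequence `0 → W → S^(φ) → Ш[φ] → 0`. -/
abbrev ShaPhi (k : ℤ) : Type :=
  selmerPhi k ⧸ (solvablePhi k).subgroupOf (selmerPhi k)

/-- The projection `S^(φ)(E_k / ℚ) → Ш(E_k / ℚ)[φ]`. -/
def selmerToSha (k : ℤ) : selmerPhi k →* ShaPhi k := QuotientGroup.mk' _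

/-! ### The rational octic residue symbol -/

open scoped Classical in
/-- The rational octic residue symbol `(a / p)₈` for a quartic residue `a` of a prime
`p ≡ 1 mod 8` : it is `1` if `a` is an eighth power modulo `p`, and `-1` if not. (The value is
`0` if `a` is divisible by `p` or no quartic residue.) -/
def octicSymbol (a : ℤ) (p : ℕ) : ℤ :=
  if (a : ZMod p) = 0 then 0
  else if ∃ x : ZMod p, x ^ 8 = (a : ZMod p) then 1
  else if ∃ x : ZMod p, x ^ 4 = (a : ZMod p) then -1
  else 0

/-! ### The Tate-Shafarevich group -/

/-- Decidability of equality, which the group law on points of a curve asks for. -/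
instance decidableEqAlgClosure (F : Type) [Field F] : DecidableEq (AlgebraicClosure F) :=
  Classical.decEq _

/-- The absolute Galois group of `K`; it carries the Krull topology. -/
abbrev AbsGal (K : Type) [Field K] : Type := AlgebraicClosure K ≃ₐ[K] AlgebraicClosure K

/-- The group `W(F̄)` of points of a curve `W` over `K`, for a field `F` containing `K`. -/
abbrev GeomPoint {K : Type} [Field K] (W : WeierstrassCurve K) (F : Type) [Field F]
    [Algebra K F] : Type :=
  (W.toAffine.baseChange (AlgebraicClosure F)).Point

/-- The action of the absolute Galois group of `F` on `W(F̄)`. -/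
def galAct {K : Type} [Field K] (W : WeierstrassCurve K) {F : Type} [Field F] [Algebra K F]
    (τ : AbsGal F) : GeomPoint W F →+ GeomPoint W F :=
  WeierstrassCurve.Affine.Point.map (W' := W.toAffine) (S := F) τ.toAlgHom

/-- The map `W(K̄) → W(F̄)` induced by an embedding of algebraic closures. -/
def embPoint {K : Type} [Field K] (W : WeierstrassCurve K) {F : Type} [Field F] [Algebra K F]
    (ι : AlgebraicClosure K →ₐ[K] AlgebraicClosure F) : GeomPoint W K →+ GeomPoint W F :=
  WeierstrassCurve.Affine.Point.map (W' := W.toAffine) (S := K) ι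

/-- Continuous 1-cocycles (crossed homomorphisms) of the absolute Galois group of `K` with
values in the discrete module `W(K̄)`. -/
def cocycles {K : Type} [Field K] (W : WeierstrassCurve K) :
    AddSubgroup (AbsGal K → GeomPoint W K) where
  carrier := {c | IsLocallyConstant c ∧ ∀ σ τ : AbsGal K, c (σ * τ) = c σ + galAct W σ (c τ)}
  zero_mem' := ⟨IsLocallyConstant.const 0, by simp⟩
  add_mem' {a b} ha hb := ⟨ha.1.add hb.1, fun σ τ => by
    simp only [Pi.add_apply, ha.2, hb.2, map_add]; abel⟩
  neg_mem' {a} ha := ⟨ha.1.neg, fun σ τ => by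
    simp only [Pi.neg_apply, ha.2, map_neg]; abel⟩

/-- The 1-coboundaries `σ ↦ σ P - P`. -/
def coboundaries {K : Type} [Field K] (W : WeierstrassCurve K) :
    AddSubgroup (AbsGal K → GeomPoint W K) where
  carrier := {c | ∃ P : GeomPoint W K, ∀ σ : AbsGal K, c σ = galAct W σ P - P}
  zero_mem' := ⟨0, by simp⟩
  add_mem' := by
    rintro a b ⟨P, hP⟩ ⟨Q, hQ⟩
    exact ⟨P + Q, fun σ => by simp only [Pi.add_apply, hP, hQ, map_add]; abel⟩
  neg_mem' := by
    rintro a ⟨P, hP⟩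
    exact ⟨-P, fun σ => by simp only [Pi.neg_apply, hP, map_neg]; abel⟩

/-- The Galois cohomology group `H¹(K, W)`. -/
abbrev H1 {K : Type} [Field K] (W : WeierstrassCurve K) : Type :=
  cocycles W ⧸ (coboundaries W).addSubgroupOf (cocycles W)

/-- The cochains over `K` whose restriction to an extension field `F` is a coboundary: for every
embedding `ι : K̄ → F̄` there is a point `P` over `F̄` such that `ι (c σ) = τ P - P` for all
`τ ∈ Gal(F̄ / F)`, where `σ ∈ Gal(K̄ / K)` is the restriction of `τ` along `ι`. (For a cocycle
this does not depend on `ι`.) -/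
def locallyTrivial {K : Type} [Field K] (W : WeierstrassCurve K) (F : Type) [Field F]
    [Algebra K F] : AddSubgroup (AbsGal K → GeomPoint W K) where
  carrier := {c | ∀ ι : AlgebraicClosure K →ₐ[K] AlgebraicClosure F, ∃ P : GeomPoint W F,
    ∀ (τ : AbsGal F) (σ : AbsGal K), (∀ x, ι (σ x) = τ (ι x)) →
      embPoint W ι (c σ) = galAct W τ P - P}
  zero_mem' ι := ⟨0, by simp⟩
  add_mem' {a b} ha hb ι := by
    obtain ⟨P, hP⟩ := ha ι
    obtain ⟨Q, hQ⟩ := hb ι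
    exact ⟨P + Q, fun τ σ h => by
      simp only [Pi.add_apply, map_add, hP τ σ h, hQ τ σ h]; abel⟩
  neg_mem' {a} ha ι := by
    obtain ⟨P, hP⟩ := ha ι
    exact ⟨-P, fun τ σ h => by simp only [Pi.neg_apply, map_neg, hP τ σ h]; abel⟩

/-- The Tate-Shafarevich group `Ш(W / ℚ)`: the classes in `H¹(ℚ, W)` that become trivial over
`ℝ` and over all fields `ℚ_q`. -/
def sha (W : WeierstrassCurve ℚ) : AddSubgroup (H1 W) :=
  ((locallyTrivial W ℝ ⊓ ⨅ (q : ℕ) (_ : Fact q.Prime), locallyTrivial W ℚ_[q]).addSubgroupOf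
    (cocycles W)).map (QuotientAddGroup.mk' _)

/-- The `n`-torsion subgroup `Ш(W / ℚ)[n]` of the Tate-Shafarevich group. -/
def shaTorsion (W : WeierstrassCurve ℚ) (n : ℤ) : AddSubgroup (sha W) :=
  AddSubgroup.torsionBy (sha W) n

/-- The curve `E_k : y ^ 2 = x (x ^ 2 - k ^ 2)`. -/
def congruentCurve (k : ℤ) : WeierstrassCurve ℚ where
  a₁ := 0
  a₂ := 0
  a₃ := 0
  a₄ := -(k : ℚ) ^ 2
  a₆ := 0

end CongruentDescent

end

/-! The proof is a descent by the isogeny φ, carried from the torsors to the cocycles that define Ш.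
Write k = pl.

Local part. A locally soluble class is positive (real place) and has even valuation away from 2, p,
l, so it is a product of some of 2, p, l. The torsor of a unit r at q ∈ {p, l} reads N² = r(M⁴ + (b
e²/r)²) with v(b) = 1; apart from the cases M = 0 or e = 0, the bracket is M⁴(1 + t²) with v(t) odd.
It is a nonzero square in every case, so solubility forces r to be a square modulo q. Since p and l
are nonresidues of each other, this excludes p, l, 2p, 2l, while 2 and pl are soluble everywhere by
explicit points. The same argument for the dual torsors (product -k²) leaves only ±1, ±k.

Global part. Modulo a prime q ≡ 1 mod 8 the octic symbol of -4 is the quadratic symbol of 1 + i and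
also of 1 + √2. For the torsors of 2 and pl, a primitive integral solution yields a factorization gh
= pl in which the cofactor of each prime r | pl has quadratic symbol (-4/r)₈ modulo r. If {g, h} =
{p, l}, the two octic symbols multiply to (l/p)(p/l) = 1; if {g, h} = {1, pl}, both are 1
(`false_of_factor_pair`). Either way their product is not -1. For 2pl a solution gives a² + b² = pl
n², the octic symbols multiply to the Jacobi symbol (a/pl), and reciprocity together with pl n² ≡ b²
mod a makes it 1. Hence W is trivial.

Ш[2]. Let c represent a class killed by 2. Halving a point makes c take values in the 2-torsion,
which is rational. Pairing with (0,0) gives a quadratic character, hence a class a, and local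
triviality of c makes the dual torsor of a locally soluble. So a is one of ±1, ±k up to squares, and
each of these comes from halving a rational 2-torsion point. Subtracting the corresponding
coboundary leaves a cocycle with values in {O, (0,0)}, that is, a Kummer cocycle σ ↦ σ√d/√d. Such a
cocycle is locally trivial exactly when the torsor of d is locally soluble, and if it is a
coboundary the torsor has a rational point. As W is trivial, the four classes 1, 2, pl, 2pl give
exactly the elements of Ш[2] (`card_shaTorsion_two`). -/

namespace CongruentDescent

/-! ### The octic symbol of `-4` as a quadratic symbol -/

section Octic

variable {p : ℕ} [Fact p.Prime]

theorem two_ne_zero_of_mod_eight (hp : p % 8 = 1) : (2 : ZMod p) ≠ 0 := by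
  intro h
  have h2 : ((2 : ℕ) : ZMod p) = 0 := by exact_mod_cast h
  rw [ZMod.natCast_eq_zero_iff] at h2
  have := (Nat.prime_dvd_prime_iff_eq Fact.out Nat.prime_two).mp h2
  omega

theorem exists_sq_eq_neg_one_of_mod_eight (hp : p % 8 = 1) : ∃ i : ZMod p, i ^ 2 = -1 := by
  have : IsSquare (-1 : ZMod p) := ZMod.exists_sq_eq_neg_one_iff.mpr (by omega)
  obtain ⟨i, hi⟩ := this
  exact ⟨i, by rw [hi]; ring⟩

theorem exists_sq_eq_two_of_mod_eight (hp : p % 8 = 1) : ∃ w : ZMod p, w ^ 2 = 2 := by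
  have : IsSquare (2 : ZMod p) :=
    (ZMod.exists_sq_eq_two_iff (by rintro rfl; omega)).mpr (.inl hp)
  obtain ⟨i, hi⟩ := this
  exact ⟨i, by rw [hi]; ring⟩

/-- Since -4 = (1 + i)⁴, an equation x⁸ = -4 says that x² is 1 + i times a fourth root of unity.
These roots of unity are powers of i, and i itself is the square of (1 + i)/√2, so x exists exactly
when 1 + i is a square. -/
theorem octicSymbol_eq_quadraticChar_one_add_I (hp : p % 8 = 1) {i : ZMod p} (hi : i ^ 2 = -1) :
    octicSymbol (-4) p = quadraticChar (ZMod p) (1 + i) := by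
  have h2 := two_ne_zero_of_mod_eight hp
  obtain ⟨w, hw⟩ := exists_sq_eq_two_of_mod_eight hp
  have hw0 : w ≠ 0 := by rintro rfl; apply h2; rw [← hw]; ring
  have h1i : 1 + i ≠ 0 := by
    intro h
    apply h2
    linear_combination (1 - i) * h + hi
  have h4 : ((-4 : ℤ) : ZMod p) = (1 + i) ^ 4 := by
    push_cast
    linear_combination (-(i ^ 2 + 4 * i + 5)) * hi
  have h40 : ((-4 : ℤ) : ZMod p) ≠ 0 := by rw [h4]; exact pow_ne_zero _ h1i
  have hz : ((1 + i) / w) ^ 2 = i := by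
    field_simp
    linear_combination hi - i * hw
  set z := (1 + i) / w
  unfold octicSymbol
  rw [if_neg h40]
  by_cases hs : IsSquare (1 + i)
  · rw [(quadraticChar_one_iff_isSquare h1i).mpr hs, if_pos]
    obtain ⟨s, hs⟩ := hs
    exact ⟨s, by rw [h4, hs]; ring⟩
  · rw [quadraticChar_neg_one_iff_not_isSquare.mpr hs, if_neg, if_pos ⟨_, h4.symm⟩]
    rintro ⟨x, hx⟩
    apply hs
    rw [h4] at hx
    have h : (x ^ 2 - (1 + i)) * (x ^ 2 + (1 + i)) *
        ((x ^ 2 - i * (1 + i)) * (x ^ 2 + i * (1 + i))) = 0 := by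
      linear_combination hx + (1 + i) ^ 2 * ((1 + i) ^ 2 - x ^ 4) * hi
    rcases mul_eq_zero.mp h with h | h <;> rcases mul_eq_zero.mp h with h | h
    · exact ⟨x, by linear_combination -h⟩
    · exact ⟨i * x, by linear_combination h - x ^ 2 * hi⟩
    · exact ⟨x / z, by rw [div_mul_div_comm, ← pow_two z, hz,
        eq_div_iff (by rintro rfl; simp at hi)]; linear_combination -h⟩
    · exact ⟨i * x / z, by rw [div_mul_div_comm, ← pow_two z, hz,
        eq_div_iff (by rintro rfl; simp at hi)]; linear_combination h - x ^ 2 * hi⟩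

/-- The product (1 + i)(1 + √2) is the square of 1 + (1 + i)/√2, so both factors have the same
quadratic character. -/
theorem octicSymbol_eq_quadraticChar_one_add_sqrt_two (hp : p % 8 = 1) {w : ZMod p}
    (hw : w ^ 2 = 2) : octicSymbol (-4) p = quadraticChar (ZMod p) (1 + w) := by
  obtain ⟨i, hi⟩ := exists_sq_eq_neg_one_of_mod_eight hp
  have h2 := two_ne_zero_of_mod_eight hp
  have hw0 : w ≠ 0 := by rintro rfl; apply h2; rw [← hw]; ring
  have h1i : 1 + i ≠ 0 := by
    intro h
    apply h2
    linear_combination (1 - i) * h + hi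
  have h1w : 1 + w ≠ 0 := by
    intro h
    have : (1 : ZMod p) = 0 := by linear_combination (w - 1) * h - hw
    exact one_ne_zero this
  have key : (1 + i) * (1 + w) = (1 + (1 + i) / w) ^ 2 := by
    field_simp
    linear_combination -hi + ((1 + i) * (1 + w) - 1) * hw
  rw [octicSymbol_eq_quadraticChar_one_add_I hp hi]
  have h1 : quadraticChar (ZMod p) (1 + i) * quadraticChar (ZMod p) (1 + w) = 1 := by
    rw [← map_mul, key, quadraticChar_sq_one']
    intro h
    rw [h] at key
    exact mul_ne_zero h1i h1w (by rw [key]; ring)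
  have h3 := quadraticChar_sq_one h1w
  linear_combination quadraticChar (ZMod p) (1 + w) * h1 - quadraticChar (ZMod p) (1 + i) * h3

theorem quadraticChar_neg_of_mod_eight (hp : p % 8 = 1) (a : ZMod p) :
    quadraticChar (ZMod p) (-a) = quadraticChar (ZMod p) a := by
  obtain ⟨i, hi⟩ := exists_sq_eq_neg_one_of_mod_eight hp
  have : -a = i ^ 2 * a := by rw [hi]; ring
  rw [this, map_mul, quadraticChar_sq_one', one_mul]
  rintro rfl
  simp at hi

theorem quadraticChar_two_of_mod_eight (hp : p % 8 = 1) :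
    quadraticChar (ZMod p) 2 = 1 := by
  obtain ⟨w, hw⟩ := exists_sq_eq_two_of_mod_eight hp
  have h2 := two_ne_zero_of_mod_eight hp
  rw [← hw, quadraticChar_sq_one']
  rintro rfl
  apply h2; rw [← hw]; ring

theorem quadraticChar_mul_sq {a b : ZMod p} (hb : b ≠ 0) :
    quadraticChar (ZMod p) (a * b ^ 2) = quadraticChar (ZMod p) a := by
  rw [map_mul, quadraticChar_sq_one' hb, mul_one]

end Octic

/-! ### Insolubility over ℚ of the torsors of 2, pl and 2pl -/

/-- The four ways of distributing `p` and `l` are excluded by the octic condition. -/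
theorem false_of_factor_pair {p l : ℕ} [Fact p.Prime] [Fact l.Prime]
    (h₁ : legendreSym p l = -1) (h₂ : legendreSym l p = -1)
    (h8 : octicSymbol (-4) p * octicSymbol (-4) l = -1) {g h : ℕ} (hgh : g * h = p * l)
    (H : ∀ r : ℕ, ∀ _ : Fact r.Prime, r = p ∨ r = l →
      (r ∣ g → quadraticChar (ZMod r) (h : ZMod r) = octicSymbol (-4) r) ∧
      (r ∣ h → quadraticChar (ZMod r) (g : ZMod r) = octicSymbol (-4) r)) : False := by
  have hp : p.Prime := Fact.out
  have hl : l.Prime := Fact.out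
  simp only [legendreSym, Int.cast_natCast] at h₁ h₂
  have Hp := H p inferInstance (.inl rfl)
  have Hl := H l inferInstance (.inr rfl)
  have key : ∀ a b : ℕ, a * b = p * l → p ∣ a → (a = p ∧ b = l) ∨ (a = p * l ∧ b = 1) := by
    rintro _ b hab ⟨c, rfl⟩
    have hcb : c * b = l := Nat.eq_of_mul_eq_mul_left hp.pos (by rw [← hab]; ring)
    rcases (Nat.dvd_prime hl).mp ⟨b, hcb.symm⟩ with rfl | rfl
    · left; simp at hcb; simp [hcb]
    · right
      refine ⟨rfl, Nat.eq_of_mul_eq_mul_left hl.pos (by rw [hcb]; ring)⟩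
  -- If p and l lie in different factors, the two octic symbols are (l/p) and (p/l), both -1. If one
  -- factor is 1, both octic symbols are the character of 1.
  rcases (hp.dvd_mul (m := g) (n := h)).mp ⟨l, hgh⟩ with hd | hd
  · obtain ⟨rfl, rfl⟩ | ⟨rfl, rfl⟩ := key g h hgh hd
    · rw [← Hp.1 dvd_rfl, ← Hl.2 dvd_rfl, h₁, h₂] at h8
      norm_num at h8
    · rw [← Hp.1 hd, ← Hl.1 (dvd_mul_left _ _)] at h8
      simp at h8
  · obtain ⟨rfl, rfl⟩ | ⟨rfl, rfl⟩ := key h g (by rw [mul_comm, hgh]) hd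
    · rw [← Hp.2 dvd_rfl, ← Hl.1 dvd_rfl, h₁, h₂] at h8
      norm_num at h8
    · rw [← Hp.2 hd, ← Hl.2 (dvd_mul_left _ _)] at h8
      simp at h8

/-- A rational point of a torsor gives a point with coprime integral coordinates. -/
theorem TorsorHasPoint.exists_int {b₁ b₂ : ℤ} (h : TorsorHasPoint (b₁ : ℚ) (b₂ : ℚ)) :
    ∃ N m e : ℤ, IsCoprime m e ∧ N ^ 2 = b₁ * m ^ 4 + b₂ * e ^ 4 := by
  obtain ⟨N, M, e, h0, h⟩ := h
  have hMe : ¬ (M = 0 ∧ e = 0) := by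
    rintro ⟨rfl, rfl⟩
    exact h0 ⟨by simpa using h, rfl, rfl⟩
  have hM : (M.num : ℚ) = M * M.den := by rw [Rat.mul_den_eq_num]
  have he : (e.num : ℚ) = e * e.den := by rw [Rat.mul_den_eq_num]
  have hMd : (M.den : ℚ) ≠ 0 := by exact_mod_cast M.den_ne_zero
  have hed : (e.den : ℚ) ≠ 0 := by exact_mod_cast e.den_ne_zero
  set m₀ : ℤ := M.num * e.den with hm₀
  set e₀ : ℤ := e.num * M.den with he₀
  have hd : Int.gcd m₀ e₀ ≠ 0 := by
    rw [Ne, Int.gcd_eq_zero_iff]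
    simpa [hm₀, he₀] using hMe
  obtain ⟨m, e', hc, hm, he'⟩ := Int.exists_gcd_one (Nat.pos_of_ne_zero hd)
  have hd' : (Int.gcd m₀ e₀ : ℚ) ≠ 0 := by exact_mod_cast hd
  set d := Int.gcd m₀ e₀
  have hm' : (m : ℚ) * d = M * (M.den * e.den) := by
    rw [show (m : ℚ) * d = (m₀ : ℚ) by rw [hm]; push_cast; ring, hm₀]
    push_cast; rw [hM]; ring
  have he'' : (e' : ℚ) * d = e * (M.den * e.den) := by
    rw [show (e' : ℚ) * d = (e₀ : ℚ) by rw [he']; push_cast; ring, he₀]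
    push_cast; rw [he]; ring
  set D : ℚ := M.den * e.den
  have key : IsSquare ((b₁ * m ^ 4 + b₂ * e' ^ 4 : ℤ) : ℚ) := by
    refine ⟨N * D ^ 2 / d ^ 2, ?_⟩
    push_cast
    field_simp
    rw [show (b₁ * m ^ 4 + b₂ * e' ^ 4) * (d : ℚ) ^ 4 = b₁ * (m * d) ^ 4 + b₂ * (e' * d) ^ 4 by ring,
      hm', he'', h]
    ring
  rw [Rat.isSquare_intCast_iff] at key
  obtain ⟨n, hn⟩ := key
  exact ⟨n, m, e', Int.isCoprime_iff_gcd_eq_one.mpr hc, by rw [hn]; ring⟩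

theorem intCast_ne_zero_of_isCoprime {r : ℕ} [Fact r.Prime] {a b : ℤ} (h : IsCoprime a b)
    (ha : (a : ZMod r) = 0) : (b : ZMod r) ≠ 0 := by
  intro hb
  obtain ⟨u, v, huv⟩ := h
  have := congrArg (Int.cast : ℤ → ZMod r) huv
  simp [ha, hb] at this

/-- In a coprime Pythagorean triple `A ^ 2 + B ^ 2 = n ^ 2` with `A` odd, the primes dividing
`A ^ 2 - B ^ 2` determine the quadratic character of `B`. -/
theorem quadraticChar_of_pythagorean {r : ℕ} [Fact r.Prime] (hr : r % 8 = 1) {A B n : ℤ}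
    (hAB : IsCoprime A B) (hA : Odd A) (hn : 0 ≤ n) (h : A ^ 2 + B ^ 2 = n ^ 2)
    (hd : (A : ZMod r) ^ 2 = (B : ZMod r) ^ 2) :
    quadraticChar (ZMod r) (B : ZMod r) = octicSymbol (-4) r := by
  obtain ⟨w, hw⟩ := exists_sq_eq_two_of_mod_eight hr
  have hB0 : (B : ZMod r) ≠ 0 := by
    intro hB
    refine intCast_ne_zero_of_isCoprime hAB.symm hB ?_
    rw [hB] at hd
    simpa using hd
  have hcop : IsCoprime (n + B) (n - B) := by
    have hoddn : IsCoprime (n + B) 2 := by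
      have : Odd ((n + B) * (n - B)) := by
        rw [show (n + B) * (n - B) = A ^ 2 by linear_combination -h]
        exact hA.pow
      exact Int.isCoprime_two_right.mpr (Int.odd_mul.mp this).1
    have h1 : IsCoprime (n + B) (2 * B) := by
      refine hoddn.mul_right ?_
      have hnB : IsCoprime (n ^ 2) B := by
        rw [← h]
        have := (hAB.pow_left (m := 2)).add_mul_left_left B
        rwa [← pow_two] at this
      have := (IsCoprime.pow_left_iff (by norm_num : 0 < 2)).mp hnB
      have := this.add_mul_left_left 1
      rwa [mul_one] at this
    have := h1.neg_right.add_mul_left_right 1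
    rwa [show -(2 * B) + (n + B) * 1 = n - B by ring] at this
  -- The coprime factors n ± B have product A², so n + B is a square up to sign; n ≥ |B| settles the
  -- sign.
  obtain ⟨s, hs⟩ := Int.sq_of_isCoprime hcop (c := A) (by linear_combination -h)
  have hs' : n + B = s ^ 2 := by
    rcases hs with hs | hs
    · exact hs
    · have hle : |B| ≤ n := abs_le_of_sq_le_sq (by nlinarith [sq_nonneg A]) hn
      have := (abs_le.mp hle).1
      have : s = 0 := by nlinarith [sq_nonneg s]
      rw [hs, this]; ring
  have hsm : (n : ZMod r) + B = (s : ZMod r) ^ 2 := by exact_mod_cast congrArg (Int.cast : ℤ → ZMod r) hs'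
  have hm : (A : ZMod r) ^ 2 + (B : ZMod r) ^ 2 = (n : ZMod r) ^ 2 := by
    exact_mod_cast congrArg (Int.cast : ℤ → ZMod r) h
  -- Modulo r the relation A² = B² gives n² = 2B², so n = wB for a root w of 2, and the square n + B
  -- becomes (1 + w)B.
  have key : ∀ w : ZMod r, w ^ 2 = 2 → (n : ZMod r) = w * B →
      quadraticChar (ZMod r) (B : ZMod r) = octicSymbol (-4) r := by
    intro w hw hnw
    rw [octicSymbol_eq_quadraticChar_one_add_sqrt_two hr hw]
    have h1w : 1 + w ≠ 0 := by
      intro h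
      have : (1 : ZMod r) = 0 := by linear_combination (w - 1) * h - hw
      exact one_ne_zero this
    have e : (1 + w) * (B : ZMod r) = (s : ZMod r) ^ 2 := by rw [← hsm, hnw]; ring
    have h1 : quadraticChar (ZMod r) (1 + w) * quadraticChar (ZMod r) (B : ZMod r) = 1 := by
      rw [← map_mul, e, quadraticChar_sq_one']
      intro h
      rw [h] at e
      exact mul_ne_zero h1w hB0 (by rw [e]; ring)
    have h3 := quadraticChar_sq_one h1w
    linear_combination quadraticChar (ZMod r) (1 + w) * h1 - quadraticChar (ZMod r) (B : ZMod r) * h3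
  have : ((n : ZMod r) - w * B) * (n + w * B) = 0 := by
    linear_combination -hm + hd - (B : ZMod r) ^ 2 * hw
  rcases mul_eq_zero.mp this with h | h
  · exact key w hw (by linear_combination h)
  · exact key (-w) (by rw [neg_sq, hw]) (by linear_combination h)

theorem quadraticChar_eq_of_sq_eq {r : ℕ} [Fact r.Prime] (hr : r % 8 = 1) {a b : ZMod r}
    (h : a ^ 2 = b ^ 2) : quadraticChar (ZMod r) a = quadraticChar (ZMod r) b := by
  rcases sq_eq_sq_iff_eq_or_eq_neg.mp h with rfl | rfl
  · rfl
  · exact quadraticChar_neg_of_mod_eight hr b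

theorem mul_mod_eight {p l : ℕ} (hp : p % 8 = 1) (hl : l % 8 = 1) : (p * l) % 8 = 1 := by
  rw [Nat.mul_mod, hp, hl]

section

variable {p l : ℕ} [Fact p.Prime] [Fact l.Prime]

theorem coprime_of_legendreSym (h₂ : legendreSym l p = -1) : p.Coprime l := by
  refine (Nat.coprime_primes Fact.out Fact.out).mpr ?_
  rintro rfl
  have : legendreSym p (p : ℤ) = 0 := (legendreSym.eq_zero_iff p _).mpr (by simp)
  omega

theorem squarefree_mul_of_legendreSym (h₂ : legendreSym l p = -1) : Squarefree (p * l) :=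
  (Nat.squarefree_mul (coprime_of_legendreSym h₂)).mpr
    ⟨(Fact.out : p.Prime).squarefree, (Fact.out : l.Prime).squarefree⟩

theorem legendreSym_symm_of_mod_eight (hp : p % 8 = 1) (hl : l % 8 = 1)
    (h₂ : legendreSym l p = -1) : legendreSym p l = -1 := by
  rw [← h₂]
  exact legendreSym.quadratic_reciprocity_one_mod_four (by omega) (by rintro rfl; omega)

theorem quadraticChar_eq_of_two_mul {r : ℕ} [Fact r.Prime] (hr : r % 8 = 1) {h e B : ZMod r}
    (he : h * e ^ 2 = 2 * B) (hB : B ≠ 0) :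
    quadraticChar (ZMod r) h = quadraticChar (ZMod r) B := by
  have he0 : e ≠ 0 := by
    rintro rfl
    have : 2 * B = 0 := by rw [← he]; ring
    exact mul_ne_zero (two_ne_zero_of_mod_eight hr) hB this
  rw [← quadraticChar_mul_sq he0, he, map_mul, quadraticChar_two_of_mod_eight hr, one_mul]

/-- Dividing out the gcd g of M with pl = gH leaves 2c² = (g m²)² + (H e²)². With g m² = A + B and H
e² = A - B this is the primitive Pythagorean equation A² + B² = c². A prime r | g gives A ≡ -B and H
e² ≡ 2A modulo r, so H has the character of A, which `quadraticChar_of_pythagorean` identifies; r |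
H is symmetric. -/
theorem not_exists_torsor_two (hp : p % 8 = 1) (hl : l % 8 = 1)
    (h₂ : legendreSym l p = -1) (h8 : octicSymbol (-4) p * octicSymbol (-4) l = -1)
    {N M e : ℤ} (hc : IsCoprime M e) (h : N ^ 2 = 2 * M ^ 4 + 2 * (p * l : ℤ) ^ 2 * e ^ 4) :
    False := by
  have hk8 := mul_mod_eight hp hl
  have hsq := squarefree_mul_of_legendreSym h₂
  set k := p * l with hk
  have hk0 : k ≠ 0 := by rintro h; omega
  obtain ⟨n, rfl⟩ : (2 : ℤ) ∣ N := by
    apply Int.prime_two.dvd_of_dvd_pow (n := 2)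
    exact ⟨M ^ 4 + (p * l : ℤ) ^ 2 * e ^ 4, by rw [h]; ring⟩
  have h : 2 * n ^ 2 = M ^ 4 + (k : ℤ) ^ 2 * e ^ 4 := by rw [hk]; push_cast; linarith
  have hkodd : Odd (k : ℤ) := by
    rw [Int.odd_iff]; omega
  have hMe : Odd M ∧ Odd e := by
    have hev : Even (M ^ 4 + (k : ℤ) ^ 2 * e ^ 4) := ⟨n ^ 2, by rw [← h]; ring⟩
    have h1 : ¬ (Even M ∧ Even e) := by
      rintro ⟨h1, h2⟩
      have := hc.isUnit_of_dvd' h1.two_dvd h2.two_dvd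
      norm_num [Int.isUnit_iff] at this
    simp only [Int.even_add, Int.even_mul, Int.even_pow, ← Int.not_even_iff_odd] at *
    tauto
  obtain ⟨hM, he⟩ := hMe
  set g := Int.gcd M k with hg
  have hg0 : 0 < g := Int.gcd_pos_of_ne_zero_right _ (by exact_mod_cast hk0)
  obtain ⟨m, H, hmh, hM', hH⟩ := Int.exists_gcd_one hg0
  rw [← hg] at hM' hH
  have hg0' : (g : ℤ) ≠ 0 := by exact_mod_cast hg0.ne'
  have hHpos : 0 < H := by
    have : (0 : ℤ) < k := by exact_mod_cast Nat.pos_of_ne_zero hk0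
    have hgp : (0 : ℤ) < g := by exact_mod_cast hg0
    exact pos_of_mul_pos_left (hH ▸ this) hgp.le
  lift H to ℕ using hHpos.le
  have hkHg : k = H * g := by exact_mod_cast hH
  have hsq' := hkHg ▸ hsq
  have hHg : Nat.Coprime H g := (Nat.squarefree_mul_iff.mp hsq').1
  have hgodd : Odd (g : ℤ) := by
    rw [hH] at hkodd
    exact (Int.odd_mul.mp hkodd).2
  have hHodd : Odd (H : ℤ) := by
    rw [hH] at hkodd
    exact (Int.odd_mul.mp hkodd).1
  obtain ⟨c, rfl⟩ : (g : ℤ) ∣ n := by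
    have h2 : (g : ℤ) ^ 2 ∣ 2 * n ^ 2 := by
      rw [h, hM', hH]
      exact ⟨(g : ℤ) ^ 2 * m ^ 4 + H ^ 2 * e ^ 4, by ring⟩
    have h3 : IsCoprime ((g : ℤ) ^ 2) 2 := (Int.isCoprime_two_right.mpr hgodd).pow_left
    exact (Int.pow_dvd_pow_iff (by norm_num)).mp (h3.dvd_of_dvd_mul_left h2)
  have h : 2 * c ^ 2 = (g * m ^ 2) ^ 2 + (H * e ^ 2) ^ 2 := by
    apply mul_left_cancel₀ (pow_ne_zero 2 hg0')
    rw [hM', hH] at h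
    linear_combination h
  have hco : IsCoprime ((g : ℤ) * m ^ 2) (H * e ^ 2) := by
    have hce : IsCoprime ((m : ℤ) * g) e := hM' ▸ hc
    have h1 : IsCoprime (g : ℤ) H := (Nat.isCoprime_iff_coprime.mpr hHg).symm
    have h2 : IsCoprime m (H : ℤ) := Int.isCoprime_iff_gcd_eq_one.mpr hmh
    exact ((h1.mul_left h2.pow_left).mul_right
      ((hce.of_mul_left_right.mul_left hce.of_mul_left_left.pow_left).pow_right))
  have hmodd : Odd m := by
    rw [hM'] at hM
    exact (Int.odd_mul.mp hM).1
  obtain ⟨A, hA⟩ : (2 : ℤ) ∣ g * m ^ 2 + H * e ^ 2 :=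
    ((hgodd.mul hmodd.pow).add_odd (hHodd.mul he.pow)).two_dvd
  obtain ⟨B, hB⟩ : (2 : ℤ) ∣ g * m ^ 2 - H * e ^ 2 :=
    ((hgodd.mul hmodd.pow).sub_odd (hHodd.mul he.pow)).two_dvd
  have e1 : (g : ℤ) * m ^ 2 = A + B := by linarith
  have e2 : (H : ℤ) * e ^ 2 = A - B := by linarith
  have hAB : IsCoprime A B := by
    rw [e1, e2] at hco
    obtain ⟨u, v, huv⟩ := hco
    exact ⟨u + v, u - v, by linear_combination huv⟩
  have habs : A ^ 2 + B ^ 2 = |c| ^ 2 := by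
    rw [sq_abs]
    rw [e1, e2] at h
    linarith
  have hpar : Odd A ∨ Odd B := by
    have := hgodd.mul (hmodd.pow (n := 2))
    rw [e1, Int.odd_add] at this
    by_cases hAo : Odd A
    · exact .inl hAo
    · right
      rw [← Int.not_even_iff_odd]
      tauto
  -- Which of the legs A, B is odd is not known, so the Pythagorean lemma is applied in either
  -- order; A² = B² modulo r makes the outcome the same for both legs.
  have key : ∀ r : ℕ, ∀ _ : Fact r.Prime, r % 8 = 1 → (A : ZMod r) ^ 2 = (B : ZMod r) ^ 2 →
      quadraticChar (ZMod r) (A : ZMod r) = octicSymbol (-4) r ∧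
      quadraticChar (ZMod r) (B : ZMod r) = octicSymbol (-4) r := by
    intro r _ hr hd
    have e := quadraticChar_eq_of_sq_eq hr hd
    rcases hpar with ho | ho
    · have := quadraticChar_of_pythagorean hr hAB ho (abs_nonneg c) habs hd
      exact ⟨e.trans this, this⟩
    · have := quadraticChar_of_pythagorean hr hAB.symm ho (abs_nonneg c)
        (by rw [← habs]; ring) hd.symm
      exact ⟨this, e.symm.trans this⟩
  have hABr : ∀ r : ℕ, ∀ _ : Fact r.Prime, (A : ZMod r) ^ 2 = (B : ZMod r) ^ 2 →
      (A : ZMod r) ≠ 0 := by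
    intro r _ hr hA0
    refine intCast_ne_zero_of_isCoprime hAB hA0 ?_
    rw [hA0] at hr
    simpa using hr.symm
  refine false_of_factor_pair (legendreSym_symm_of_mod_eight hp hl h₂) h₂ h8
    (g := g) (h := H) (by rw [mul_comm, ← hkHg]) ?_
  intro r _ hr
  have hr8 : r % 8 = 1 := by rcases hr with rfl | rfl <;> assumption
  have e1' : (g : ZMod r) * (m : ZMod r) ^ 2 = A + B := by
    exact_mod_cast congrArg (Int.cast : ℤ → ZMod r) e1
  have e2' : (H : ZMod r) * (e : ZMod r) ^ 2 = A - B := by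
    exact_mod_cast congrArg (Int.cast : ℤ → ZMod r) e2
  constructor
  · intro hd
    have hg0 : (g : ZMod r) = 0 := (ZMod.natCast_eq_zero_iff _ _).mpr hd
    rw [hg0, zero_mul] at e1'
    have hs : (A : ZMod r) ^ 2 = (B : ZMod r) ^ 2 := by linear_combination -(A - B : ZMod r) * e1'
    rw [← (key r _ hr8 hs).1]
    exact quadraticChar_eq_of_two_mul hr8 (by rw [e2']; linear_combination e1') (hABr r _ hs)
  · intro hd
    have hg0 : (H : ZMod r) = 0 := (ZMod.natCast_eq_zero_iff _ _).mpr hd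
    rw [hg0, zero_mul] at e2'
    have hs : (A : ZMod r) ^ 2 = (B : ZMod r) ^ 2 := by linear_combination -(A + B : ZMod r) * e2'
    rw [← (key r _ hr8 hs).1]
    exact quadraticChar_eq_of_two_mul hr8 (by rw [e1']; linear_combination e2') (hABr r _ hs)

end

theorem phiProduct_mul {p l : ℕ} (hp : p % 8 = 1) (hl : l % 8 = 1) :
    phiProduct (p * l : ℤ) = 4 * (p * l : ℚ) ^ 2 := by
  have hk8 := mul_mod_eight hp hl
  have : ¬ Even (p * l : ℤ) := by
    rw [Int.not_even_iff_odd, Int.odd_iff]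
    have : ((p * l : ℕ) : ℤ) = p * l := by push_cast; ring
    rw [← this]; omega
  rw [phiProduct, if_neg this]
  push_cast; ring

section

variable {p l : ℕ} [Fact p.Prime] [Fact l.Prime]

/-- Sophie Germain's identity factors m⁴ + 4e⁴ as UV with U, V = m² ± 2me + 2e². These are coprime
for odd m, so U and V are squares times complementary divisors g, g' of pl. -/
theorem not_exists_mul_sq_eq_add_four_mul (hp : p % 8 = 1) (hl : l % 8 = 1)
    (h₂ : legendreSym l p = -1) (h8 : octicSymbol (-4) p * octicSymbol (-4) l = -1)
    {n m e : ℤ} (hc : IsCoprime m e) (hm : Odd m)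
    (h : ((p * l : ℕ) : ℤ) * n ^ 2 = m ^ 4 + 4 * e ^ 4) : False := by
  have hk8 := mul_mod_eight hp hl
  have hk0 : p * l ≠ 0 := by rintro h; omega
  obtain ⟨U, hU⟩ : ∃ U, U = m ^ 2 + 2 * m * e + 2 * e ^ 2 := ⟨_, rfl⟩
  obtain ⟨V, hV⟩ : ∃ V, V = m ^ 2 - 2 * m * e + 2 * e ^ 2 := ⟨_, rfl⟩
  have hm0 : m ≠ 0 := by rintro rfl; simp at hm
  have hmsq : 0 < m ^ 2 := by positivity
  have hUV : U * V = (p * l : ℕ) * n ^ 2 := by rw [h, hU, hV]; ring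
  have hU0 : 0 < U := by rw [hU]; nlinarith [sq_nonneg (m + 2 * e)]
  have hV0 : 0 < V := by rw [hV]; nlinarith [sq_nonneg (m - 2 * e)]
  have hUodd : Odd U := by
    rw [hU, show m ^ 2 + 2 * m * e + 2 * e ^ 2 = m ^ 2 + 2 * (m * e + e ^ 2) by ring]
    exact hm.pow.add_even (even_two_mul _)
  have hcop : IsCoprime U V := by
    have hU2 : IsCoprime U 2 := Int.isCoprime_two_right.mpr hUodd
    have hUm : IsCoprime U m := by
      have : IsCoprime (2 * e ^ 2) m :=
        (Int.isCoprime_two_left.mpr hm).mul_left hc.symm.pow_left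
      have := this.add_mul_left_left (m + 2 * e)
      rwa [show 2 * e ^ 2 + m * (m + 2 * e) = U by rw [hU]; ring] at this
    have hUe : IsCoprime U e := by
      have : IsCoprime (m ^ 2) e := hc.pow_left
      have := this.add_mul_left_left (2 * m + 2 * e)
      rwa [show m ^ 2 + e * (2 * m + 2 * e) = U by rw [hU]; ring] at this
    have h4 : IsCoprime U (-(2 * (2 * (m * e)))) :=
      (hU2.mul_right (hU2.mul_right (hUm.mul_right hUe))).neg_right
    have := h4.add_mul_left_right 1
    rwa [show -(2 * (2 * (m * e))) + U * 1 = V by rw [hU, hV]; ring] at this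
  lift U to ℕ using hU0.le
  lift V to ℕ using hV0.le
  have hcop' : Nat.Coprime U V := Nat.isCoprime_iff_coprime.mp hcop
  have hUVn : U * V = (p * l) * n.natAbs ^ 2 := by
    zify
    rw [hUV, sq_abs]; push_cast; ring
  have hgh : Nat.gcd (p * l) U * Nat.gcd (p * l) V = p * l := by
    rw [← Nat.Coprime.gcd_mul _ hcop', hUVn]
    exact Nat.gcd_eq_left (dvd_mul_right _ _)
  obtain ⟨u, hu⟩ := Nat.gcd_dvd_right (p * l) U
  obtain ⟨v, hv⟩ := Nat.gcd_dvd_right (p * l) V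
  set g := Nat.gcd (p * l) U
  set g' := Nat.gcd (p * l) V
  have huv : u * v = n.natAbs ^ 2 := by
    apply Nat.eq_of_mul_eq_mul_left (Nat.pos_of_ne_zero hk0)
    rw [← hUVn, hu, hv, ← hgh]; ring
  have huvc : Nat.Coprime u v :=
    (hcop'.coprime_dvd_left ⟨g, by rw [mul_comm]; exact hu⟩).coprime_dvd_right
      ⟨g', by rw [mul_comm]; exact hv⟩
  obtain ⟨a, ha⟩ := exists_eq_pow_of_mul_eq_pow (Nat.isUnit_iff.mpr huvc) huv
  obtain ⟨b, hb⟩ := exists_eq_pow_of_mul_eq_pow (Nat.isUnit_iff.mpr huvc.symm)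
    (by rw [mul_comm]; exact huv)
  rw [ha] at hu
  rw [hb] at hv
  have E1 : (g : ℤ) * a ^ 2 = m ^ 2 + 2 * m * e + 2 * e ^ 2 := by
    rw [← hU]; exact_mod_cast hu.symm
  have E2 : (g' : ℤ) * b ^ 2 = m ^ 2 - 2 * m * e + 2 * e ^ 2 := by
    rw [← hV]; exact_mod_cast hv.symm
  have aux : ∀ (r : ℕ) [Fact r.Prime], r % 8 = 1 → ∀ (m e a b c d : ℤ), IsCoprime m e →
      a * c ^ 2 = m ^ 2 + 2 * m * e + 2 * e ^ 2 → b * d ^ 2 = m ^ 2 - 2 * m * e + 2 * e ^ 2 →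
      (a : ZMod r) = 0 → quadraticChar (ZMod r) (b : ZMod r) = octicSymbol (-4) r := by
    clear * -
    intro r _ hr m e a b c d hc h1 h2 ha
    have h1 : (a : ZMod r) * c ^ 2 = m ^ 2 + 2 * m * e + 2 * e ^ 2 := by
      exact_mod_cast congrArg (Int.cast : ℤ → ZMod r) h1
    have h2 : (b : ZMod r) * d ^ 2 = m ^ 2 - 2 * m * e + 2 * e ^ 2 := by
      exact_mod_cast congrArg (Int.cast : ℤ → ZMod r) h2
    rw [ha, zero_mul] at h1
    have he : (e : ZMod r) ≠ 0 := by
      intro he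
      refine intCast_ne_zero_of_isCoprime hc.symm he ?_
      rw [he] at h1
      simpa using h1.symm
    have h20 := two_ne_zero_of_mod_eight hr
    -- If r divides (m + e)² + e², then (m + e)/e is a root of -1. The sign is chosen so that the
    -- other factor, congruent to -4me, equals (1 + i)(2e)².
    have hi : (-((m + e : ZMod r) / e)) ^ 2 = -1 := by
      field_simp
      linear_combination -h1
    rw [octicSymbol_eq_quadraticChar_one_add_I hr hi]
    have key : (b : ZMod r) * d ^ 2 = (1 + -((m + e : ZMod r) / e)) * (2 * e) ^ 2 := by
      rw [h2]
      field_simp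
      linear_combination -h1
    have hd : (d : ZMod r) ≠ 0 := by
      intro hd
      rw [hd] at key
      have h3 : 1 + -((m + e : ZMod r) / e) = 0 := by
        simpa [h20, he] using key.symm
      rw [show -((m + e : ZMod r) / e) = -1 by linear_combination h3] at hi
      apply h20
      linear_combination hi
    rw [← quadraticChar_mul_sq hd, key, quadraticChar_mul_sq (mul_ne_zero h20 he)]
  refine false_of_factor_pair (legendreSym_symm_of_mod_eight hp hl h₂) h₂ h8 hgh ?_
  intro r _ hr
  have hr8 : r % 8 = 1 := by rcases hr with rfl | rfl <;> assumption
  constructor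
  · intro hd
    have := aux r hr8 m e g g' a b hc E1 E2 (by exact_mod_cast (ZMod.natCast_eq_zero_iff _ _).mpr hd)
    exact_mod_cast this
  · intro hd
    -- Replacing e by -e exchanges U and V.
    have := aux r hr8 m (-e) g' g b a hc.neg_right (by rw [E2]; ring) (by rw [E1]; ring)
      (by exact_mod_cast (ZMod.natCast_eq_zero_iff _ _).mpr hd)
    exact_mod_cast this

/-- Squarefreeness of pl lets one divide N by pl, which gives pl n² = M⁴ + 4e⁴. If M is even,
dividing by 4 gives an equation of the same shape with the roles of e and M/2 exchanged, so the odd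
case suffices. -/
theorem not_exists_torsor_mul (hp : p % 8 = 1) (hl : l % 8 = 1)
    (h₂ : legendreSym l p = -1) (h8 : octicSymbol (-4) p * octicSymbol (-4) l = -1)
    {N M e : ℤ} (hc : IsCoprime M e)
    (h : N ^ 2 = (p * l : ℤ) * M ^ 4 + 4 * (p * l : ℤ) * e ^ 4) : False := by
  have hk8 := mul_mod_eight hp hl
  have hsq := squarefree_mul_of_legendreSym h₂
  have hk0 : ((p * l : ℕ) : ℤ) ≠ 0 := by
    rintro h
    have : p * l = 0 := by exact_mod_cast h
    omega
  obtain ⟨n, rfl⟩ : ((p * l : ℕ) : ℤ) ∣ N := by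
    have : Squarefree ((p * l : ℕ) : ℤ) := Int.squarefree_natCast.mpr hsq
    refine (this.dvd_pow_iff_dvd (by norm_num : 2 ≠ 0)).mp ⟨M ^ 4 + 4 * e ^ 4, ?_⟩
    rw [h]; push_cast; ring
  have h : ((p * l : ℕ) : ℤ) * n ^ 2 = M ^ 4 + 4 * e ^ 4 := by
    apply mul_left_cancel₀ hk0
    rw [← Nat.cast_mul] at h
    linear_combination h
  rcases Int.even_or_odd M with hM | hM
  · obtain ⟨M', rfl⟩ := hM.two_dvd
    have he : Odd e := by
      rw [← Int.not_even_iff_odd]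
      intro he
      have := hc.isUnit_of_dvd' hM.two_dvd he.two_dvd
      norm_num [Int.isUnit_iff] at this
    have hkodd : Odd ((p * l : ℕ) : ℤ) := by
      rw [Int.odd_iff]; omega
    have hn : Even n := by
      have : Even (((p * l : ℕ) : ℤ) * n ^ 2) := ⟨8 * M' ^ 4 + 2 * e ^ 4, by rw [h]; ring⟩
      rw [Int.even_mul, Int.even_pow] at this
      rw [← Int.not_even_iff_odd] at hkodd
      tauto
    obtain ⟨n', rfl⟩ := hn.two_dvd
    refine not_exists_mul_sq_eq_add_four_mul hp hl h₂ h8 (m := e) (e := M') (n := n')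
      hc.of_mul_left_right.symm he ?_
    linarith
  · exact not_exists_mul_sq_eq_add_four_mul hp hl h₂ h8 hc hM h

/-- Here 2pl n² = M⁴ + e⁴, and a, b = (M² ± e²)/2 satisfy a² + b² = pl n². Modulo r | pl the
quotient b/a is a root i of -1 and (1 + i)a = M², so (a/r) is the octic symbol. No distribution of
the primes is needed: the Jacobi symbol (a/pl) is inverted by reciprocity. -/
theorem not_exists_torsor_two_mul (hp : p % 8 = 1) (hl : l % 8 = 1)
    (h₂ : legendreSym l p = -1) (h8 : octicSymbol (-4) p * octicSymbol (-4) l = -1)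
    {N M e : ℤ} (hc : IsCoprime M e)
    (h : N ^ 2 = 2 * (p * l : ℤ) * M ^ 4 + 2 * (p * l : ℤ) * e ^ 4) : False := by
  have hk8 := mul_mod_eight hp hl
  have hsq := squarefree_mul_of_legendreSym h₂
  have hpl : ((p * l : ℕ) : ℤ) = (p * l : ℤ) := by push_cast; ring
  rw [← hpl] at h
  obtain ⟨k, hk⟩ : ∃ k, k = p * l := ⟨_, rfl⟩
  rw [← hk] at h hsq hk8
  have hk0 : (2 * (k : ℤ)) ≠ 0 := by omega
  have hsq2 : Squarefree (2 * (k : ℤ)) := by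
    have : Squarefree (2 * k) := (Nat.squarefree_mul ((Nat.coprime_two_left).mpr
      (Nat.odd_iff.mpr (by omega)))).mpr ⟨Nat.prime_two.squarefree, hsq⟩
    exact_mod_cast Int.squarefree_natCast.mpr this
  obtain ⟨n, rfl⟩ : 2 * (k : ℤ) ∣ N :=
    (hsq2.dvd_pow_iff_dvd (by norm_num : 2 ≠ 0)).mp ⟨M ^ 4 + e ^ 4, by rw [h]; ring⟩
  have h : 2 * k * n ^ 2 = M ^ 4 + e ^ 4 := by
    apply mul_left_cancel₀ hk0
    linear_combination h
  have hMe : Odd M ∧ Odd e := by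
    have hev : Even (M ^ 4 + e ^ 4) := ⟨k * n ^ 2, by rw [← h]; ring⟩
    have h1 : ¬ (Even M ∧ Even e) := by
      rintro ⟨h1, h2⟩
      have := hc.isUnit_of_dvd' h1.two_dvd h2.two_dvd
      norm_num [Int.isUnit_iff] at this
    simp only [Int.even_add, Int.even_pow, ← Int.not_even_iff_odd] at *
    tauto
  obtain ⟨hM, he⟩ := hMe
  obtain ⟨a, ha⟩ : (2 : ℤ) ∣ M ^ 2 + e ^ 2 := (hM.pow.add_odd he.pow).two_dvd
  have hM2 : M ^ 2 = a + (a - e ^ 2) := by linarith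
  obtain ⟨b, hb⟩ : ∃ b, b = a - e ^ 2 := ⟨_, rfl⟩
  rw [← hb] at hM2
  have he2 : e ^ 2 = a - b := by linarith
  have hab : a ^ 2 + b ^ 2 = k * n ^ 2 := by
    have h' : 2 * k * n ^ 2 = (M ^ 2) ^ 2 + (e ^ 2) ^ 2 := by rw [h]; ring
    rw [hM2, he2] at h'
    linarith
  have hcop : IsCoprime a b := by
    have : IsCoprime (M ^ 2) (e ^ 2) := hc.pow
    rw [hM2, he2] at this
    obtain ⟨u, v, huv⟩ := this
    exact ⟨u + v, u - v, by linear_combination huv⟩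
  have ha0 : 0 < a := by
    have : 0 < M ^ 2 := by
      have : M ≠ 0 := by rintro rfl; simp at hM
      positivity
    nlinarith [sq_nonneg e]
  have haodd : Odd a := by
    have h1 := Int.sq_mod_four_eq_one_of_odd hM
    have h2 := Int.sq_mod_four_eq_one_of_odd he
    rw [Int.odd_iff]; omega
  lift a to ℕ using ha0.le
  have haodd' : Odd a := by exact_mod_cast haodd
  have aux : ∀ r : ℕ, ∀ _ : Fact r.Prime, r ∣ k → r % 8 = 1 →
      jacobiSym a r = octicSymbol (-4) r := by
    intro r _ hrk hr
    rw [← jacobiSym.legendreSym.to_jacobiSym]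
    have hk0 : (k : ZMod r) = 0 := (ZMod.natCast_eq_zero_iff _ _).mpr hrk
    have h1 : (a : ZMod r) ^ 2 + (b : ZMod r) ^ 2 = 0 := by
      have := congrArg (Int.cast : ℤ → ZMod r) hab
      push_cast at this
      rw [this, hk0, zero_mul]
    have h2 : (M : ZMod r) ^ 2 = a + b := by
      exact_mod_cast congrArg (Int.cast : ℤ → ZMod r) hM2
    have h20 := two_ne_zero_of_mod_eight hr
    have ha0 : (a : ZMod r) ≠ 0 := by
      intro h0
      refine intCast_ne_zero_of_isCoprime (r := r) hcop (by exact_mod_cast h0) ?_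
      rw [h0] at h1
      simpa using h1
    have hi : ((b : ZMod r) / a) ^ 2 = -1 := by
      field_simp
      linear_combination h1
    rw [octicSymbol_eq_quadraticChar_one_add_I hr hi]
    have key : (1 + (b : ZMod r) / a) * a = (M : ZMod r) ^ 2 := by
      rw [h2]; field_simp
    have h1i : 1 + (b : ZMod r) / a ≠ 0 := by
      intro h
      rw [show (b : ZMod r) / a = -1 by linear_combination h] at hi
      apply h20
      linear_combination hi
    have h1 : quadraticChar (ZMod r) (1 + (b : ZMod r) / a) * quadraticChar (ZMod r) (a : ZMod r) =
        1 := by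
      rw [← map_mul, key, quadraticChar_sq_one']
      intro h
      rw [h] at key
      exact mul_ne_zero h1i ha0 (by rw [key]; ring)
    have h3 := quadraticChar_sq_one h1i
    simp only [legendreSym, Int.cast_natCast]
    linear_combination quadraticChar (ZMod r) (1 + (b : ZMod r) / a) * h1 -
      quadraticChar (ZMod r) (a : ZMod r) * h3
  have hJ : jacobiSym a k = -1 := by
    rw [hk, jacobiSym.mul_right' _ (Fact.out : p.Prime).ne_zero (Fact.out : l.Prime).ne_zero,
      aux p inferInstance (hk ▸ dvd_mul_right _ _) hp, aux l inferInstance (hk ▸ dvd_mul_left _ _) hl, h8]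
  rw [jacobiSym.quadratic_reciprocity_one_mod_four' haodd' (by omega)] at hJ
  have hbJ : jacobiSym (b ^ 2) a = 1 :=
    jacobiSym.sq_one' (Int.isCoprime_iff_gcd_eq_one.mp hcop.symm)
  -- Modulo a, the number pl n² is the square b², and b is prime to a.
  have hkn : jacobiSym (k * n ^ 2) a = 1 := by
    rw [← hbJ]
    apply jacobiSym.mod_left'
    rw [← hab, pow_two (a : ℤ), Int.add_emod, Int.mul_emod_right]
    simp
  rw [jacobiSym.mul_left, hJ, jacobiSym.pow_left] at hkn
  nlinarith [sq_nonneg (jacobiSym n a)]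

theorem not_phiTorsorSolvable (hp : p % 8 = 1) (hl : l % 8 = 1)
    (h₂ : legendreSym l p = -1) (h8 : octicSymbol (-4) p * octicSymbol (-4) l = -1) :
    ¬ PhiTorsorSolvable (p * l : ℤ) 2 ∧ ¬ PhiTorsorSolvable (p * l : ℤ) (p * l : ℚ) ∧
      ¬ PhiTorsorSolvable (p * l : ℤ) (2 * (p * l) : ℚ) := by
  have hp0 : (p : ℚ) ≠ 0 := by exact_mod_cast (Fact.out : p.Prime).ne_zero
  have hl0 : (l : ℚ) ≠ 0 := by exact_mod_cast (Fact.out : l.Prime).ne_zero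
  simp only [PhiTorsorSolvable, phiProduct_mul hp hl]
  refine ⟨fun h => ?_, fun h => ?_, fun h => ?_⟩
  · have h : TorsorHasPoint ((2 : ℤ) : ℚ) ((2 * (p * l) ^ 2 : ℤ) : ℚ) := by
      convert h using 1
      · norm_num
      · push_cast; ring
    obtain ⟨N, m, e, hc, h⟩ := h.exists_int
    exact not_exists_torsor_two hp hl h₂ h8 hc h
  · have h : TorsorHasPoint ((p * l : ℤ) : ℚ) ((4 * (p * l) : ℤ) : ℚ) := by
      convert h using 1
      · push_cast; ring
      · push_cast; field_simp
    obtain ⟨N, m, e, hc, h⟩ := h.exists_int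
    exact not_exists_torsor_mul hp hl h₂ h8 hc h
  · have h : TorsorHasPoint ((2 * (p * l) : ℤ) : ℚ) ((2 * (p * l) : ℤ) : ℚ) := by
      convert h using 1
      · push_cast; ring
      · push_cast; field_simp; norm_num
    obtain ⟨N, m, e, hc, h⟩ := h.exists_int
    exact not_exists_torsor_two_mul hp hl h₂ h8 hc h

end

/-! ### Squares and torsors over the `q`-adic numbers -/

section Local

variable {q : ℕ} [Fact q.Prime]

/-- Hensel's lemma for X² - (1 + x) at X = 1, where the derivative is 2. Keeping the bound |2|²
covers q = 2 as well. -/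
theorem isSquare_one_add_of_norm_lt {x : ℚ_[q]} (hx : ‖x‖ < ‖(2 : ℚ_[q])‖ ^ 2) :
    IsSquare (1 + x) := by
  have h2 : ‖(2 : ℚ_[q])‖ ≤ 1 := by exact_mod_cast Padic.norm_int_le_one (p := q) 2
  have hx1 : ‖x‖ ≤ 1 := hx.le.trans (pow_le_one₀ (norm_nonneg _) h2)
  let y : ℤ_[q] := ⟨x, hx1⟩
  let F : Polynomial ℤ_[q] := Polynomial.X ^ 2 - Polynomial.C (1 + y)
  have hF : F.aeval (1 : ℤ_[q]) = -y := by simp [F]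
  have hF' : F.derivative.aeval (1 : ℤ_[q]) = 2 := by simp [F]; norm_num
  obtain ⟨z, hz, -⟩ := hensels_lemma (F := F) (a := 1) (by
    rw [hF, hF', norm_neg]
    exact hx)
  refine ⟨(z : ℚ_[q]), ?_⟩
  have hz : z ^ 2 = 1 + y := by
    simp only [F, map_sub, map_pow, Polynomial.aeval_X, Polynomial.aeval_C] at hz
    exact sub_eq_zero.mp hz
  have := congrArg (fun t : ℤ_[q] => (t : ℚ_[q])) hz
  simp only [PadicInt.coe_pow, PadicInt.coe_add, PadicInt.coe_one] at this
  rw [← pow_two, this]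

theorem norm_two_of_ne_two (hq : q ≠ 2) : ‖(2 : ℚ_[q])‖ = 1 := by
  have : ‖((2 : ℕ) : ℚ_[q])‖ = 1 := by
    rw [Padic.norm_natCast_eq_one_iff]
    exact (Nat.coprime_primes Fact.out Nat.prime_two).mpr hq
  exact_mod_cast this

theorem isSquare_one_add_of_norm_lt_one (hq : q ≠ 2) {x : ℚ_[q]} (hx : ‖x‖ < 1) :
    IsSquare (1 + x) :=
  isSquare_one_add_of_norm_lt (by rwa [norm_two_of_ne_two hq, one_pow])

theorem isSquare_intCast_of_eq_sq (hq : q ≠ 2) {a : ℤ} {b : ZMod q} (hb : b ≠ 0)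
    (h : (a : ZMod q) = b ^ 2) : IsSquare (a : ℚ_[q]) := by
  obtain ⟨b, rfl⟩ := ZMod.intCast_surjective b
  have hbn : ‖(b : ℚ_[q])‖ = 1 := by
    refine le_antisymm (Padic.norm_int_le_one b) (not_lt.mp fun hlt => hb ?_)
    exact (ZMod.intCast_zmod_eq_zero_iff_dvd _ _).mpr (Padic.norm_intCast_lt_one_iff.mp hlt)
  have hb0 : (b : ℚ_[q]) ≠ 0 := by
    intro h0; rw [h0] at hbn; simp at hbn
  have hd : ‖(((a - b ^ 2 : ℤ)) : ℚ_[q])‖ < 1 := by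
    rw [Padic.norm_intCast_lt_one_iff, ← ZMod.intCast_zmod_eq_zero_iff_dvd]
    push_cast
    rw [h, sub_self]
  have key : IsSquare (1 + ((a - b ^ 2 : ℤ) : ℚ_[q]) / (b : ℚ_[q]) ^ 2) :=
    isSquare_one_add_of_norm_lt_one hq (by rw [norm_div, norm_pow, hbn]; simpa using hd)
  obtain ⟨s, hs⟩ := key
  refine ⟨b * s, ?_⟩
  have : (a : ℚ_[q]) = b ^ 2 * (1 + ((a - b ^ 2 : ℤ) : ℚ_[q]) / (b : ℚ_[q]) ^ 2) := by
    push_cast; field_simp; ring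
  rw [this, hs]; ring

theorem isSquare_intCast_of_isSquare (hq : q ≠ 2) {a : ℤ} (ha : (a : ZMod q) ≠ 0)
    (h : IsSquare (a : ZMod q)) : IsSquare (a : ℚ_[q]) := by
  obtain ⟨b, hb⟩ := h
  refine isSquare_intCast_of_eq_sq hq (b := b) ?_ (by rw [hb]; ring)
  rintro rfl
  exact ha (by rw [hb]; ring)

theorem isSquare_of_isSquare_intCast {a : ℤ} (h : IsSquare (a : ℚ_[q])) :
    IsSquare (a : ZMod q) := by
  obtain ⟨s, hs⟩ := h
  have hs1 : ‖s‖ ≤ 1 := by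
    have h1 := Padic.norm_int_le_one (p := q) a
    rw [hs, norm_mul] at h1
    nlinarith [norm_nonneg s]
  let t : ℤ_[q] := ⟨s, hs1⟩
  have ht : ((a : ℤ) : ℤ_[q]) = t * t := by
    apply Subtype.ext
    simpa using hs
  exact ⟨PadicInt.toZMod t, by rw [← map_mul, ← ht, map_intCast]⟩

/-- Of two units and their product, at least one is a square. -/
theorem isSquare_or_isSquare_or_isSquare_mul (hq : q ≠ 2) {a b : ℤ} (ha : (a : ZMod q) ≠ 0)
    (hb : (b : ZMod q) ≠ 0) :
    IsSquare (a : ℚ_[q]) ∨ IsSquare (b : ℚ_[q]) ∨ IsSquare ((a * b : ℤ) : ℚ_[q]) := by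
  by_cases h1 : IsSquare (a : ZMod q)
  · exact .inl (isSquare_intCast_of_isSquare hq ha h1)
  by_cases h2 : IsSquare (b : ZMod q)
  · exact .inr (.inl (isSquare_intCast_of_isSquare hq hb h2))
  refine .inr (.inr (isSquare_intCast_of_isSquare hq (by push_cast; exact mul_ne_zero ha hb) ?_))
  rw [← quadraticChar_neg_one_iff_not_isSquare] at h1 h2
  push_cast
  rw [← quadraticChar_one_iff_isSquare (mul_ne_zero ha hb), map_mul, h1, h2]
  norm_num

theorem isSquare_intCast_two_adic {a : ℤ} (ha : a % 8 = 1) : IsSquare (a : ℚ_[2]) := by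
  have h : (a : ℚ_[2]) = 1 + ((a - 1 : ℤ) : ℚ_[2]) := by push_cast; ring
  rw [h]
  apply isSquare_one_add_of_norm_lt
  have h1 : ‖((a - 1 : ℤ) : ℚ_[2])‖ ≤ ((2 : ℕ) : ℝ) ^ (-(3 : ℕ) : ℤ) := by
    rw [Padic.norm_int_le_pow_iff_dvd]
    norm_num
    omega
  have h2 : ‖(2 : ℚ_[2])‖ = (2 : ℝ)⁻¹ := by exact_mod_cast Padic.norm_p (p := 2)
  rw [h2]
  refine h1.trans_lt ?_
  norm_num

theorem valuation_eq_of_norm_eq {x y : ℚ_[q]} (hx : x ≠ 0) (hy : y ≠ 0) (h : ‖x‖ = ‖y‖) :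
    x.valuation = y.valuation := by
  rw [Padic.norm_eq_zpow_neg_valuation hx, Padic.norm_eq_zpow_neg_valuation hy] at h
  have hq : (1 : ℝ) < q := by exact_mod_cast (Fact.out : q.Prime).one_lt
  have := zpow_right_injective₀ (by linarith) hq.ne' h
  linarith

theorem valuation_add_mem {x y : ℚ_[q]} (hx : x ≠ 0) (hy : y ≠ 0)
    (h : x.valuation ≠ y.valuation) : x + y ≠ 0 ∧
      ((x + y).valuation = x.valuation ∨ (x + y).valuation = y.valuation) := by
  have hn : ‖x‖ ≠ ‖y‖ := fun h' => h (valuation_eq_of_norm_eq hx hy h')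
  have hm := Padic.add_eq_max_of_ne hn
  have h0 : x + y ≠ 0 := by
    intro h0
    rw [h0, norm_zero] at hm
    have := (le_max_left ‖x‖ ‖y‖)
    rw [← hm] at this
    exact hx (norm_le_zero_iff.mp this)
  refine ⟨h0, ?_⟩
  rcases max_choice ‖x‖ ‖y‖ with h' | h' <;> rw [h'] at hm
  · exact .inl (valuation_eq_of_norm_eq h0 hx hm)
  · exact .inr (valuation_eq_of_norm_eq h0 hy hm)

/-- In aN² = a²M⁴ + Be⁴ the two terms on the right have valuations 2v(a) + 4v(M) and 4v(e). If these
agree, v(a) is even at once; if not, v(aN²) is one of them, hence even. Zero coordinates need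
separate treatment. -/
theorem TorsorHasPoint.even_valuation {a B : ℚ_[q]} (ha : a ≠ 0) (hB : B ≠ 0)
    (hB0 : B.valuation = 0) (h : TorsorHasPoint a (B / a)) : Even a.valuation := by
  obtain ⟨N, M, e, h0, h⟩ := h
  have h : a * N ^ 2 = a ^ 2 * M ^ 4 + B * e ^ 4 := by rw [h]; field_simp
  have v1 : N ≠ 0 → (a * N ^ 2).valuation = a.valuation + 2 * N.valuation := fun hN => by
    rw [Padic.valuation_mul ha (pow_ne_zero _ hN), Padic.valuation_pow]; push_cast; ring
  have v2 : M ≠ 0 → (a ^ 2 * M ^ 4).valuation = 2 * a.valuation + 4 * M.valuation := fun hM => by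
    rw [Padic.valuation_mul (pow_ne_zero _ ha) (pow_ne_zero _ hM), Padic.valuation_pow,
      Padic.valuation_pow]; push_cast; ring
  have v3 : e ≠ 0 → (B * e ^ 4).valuation = 4 * e.valuation := fun he => by
    rw [Padic.valuation_mul hB (pow_ne_zero _ he), Padic.valuation_pow, hB0]; push_cast; ring
  have key : N ≠ 0 → (a * N ^ 2).valuation = 2 * a.valuation + 4 * M.valuation ∨
      (a * N ^ 2).valuation = 4 * e.valuation → Even a.valuation := by
    intro hN hv
    rw [v1 hN] at hv
    rw [Int.even_iff]; omega
  have hN0 : a * N ^ 2 ≠ 0 → N ≠ 0 := by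
    rintro h rfl
    simp at h
  by_cases hM : M = 0
  · subst hM
    have he : e ≠ 0 := by
      rintro rfl
      exact h0 ⟨by simpa [ha] using h, rfl, rfl⟩
    have h' : a * N ^ 2 = B * e ^ 4 := by rw [h]; ring
    have hN := hN0 (by rw [h']; exact mul_ne_zero hB (pow_ne_zero _ he))
    exact key hN (.inr (by rw [h', v3 he]))
  by_cases he : e = 0
  · subst he
    have h' : a * N ^ 2 = a ^ 2 * M ^ 4 := by rw [h]; ring
    have hN := hN0 (by rw [h']; exact mul_ne_zero (pow_ne_zero _ ha) (pow_ne_zero _ hM))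
    exact key hN (.inl (by rw [h', v2 hM]))
  have hx := mul_ne_zero (pow_ne_zero 2 ha) (pow_ne_zero 4 hM)
  have hy := mul_ne_zero hB (pow_ne_zero 4 he)
  by_cases hv : (a ^ 2 * M ^ 4).valuation = (B * e ^ 4).valuation
  · rw [v2 hM, v3 he] at hv
    rw [Int.even_iff]; omega
  · obtain ⟨hs, hs'⟩ := valuation_add_mem hx hy hv
    rw [← h, v2 hM, v3 he] at hs'
    rw [← h] at hs
    exact key (hN0 hs) hs'

/-- If `b / a` has odd valuation, the torsor of `a` with `B = b ^ 2` is soluble only for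
squares `a`. -/
theorem TorsorHasPoint.isSquare (hq : q ≠ 2) {a b : ℚ_[q]} (ha : a ≠ 0) (hb : b ≠ 0)
    (hab : Odd (b / a).valuation) (h : TorsorHasPoint a (b ^ 2 / a)) : IsSquare a := by
  obtain ⟨N, M, e, h0, h⟩ := h
  have h : N ^ 2 = a * (M ^ 4 + (b / a * e ^ 2) ^ 2) := by rw [h]; field_simp
  by_cases hM : M = 0
  · subst hM
    have he : e ≠ 0 := by
      rintro rfl
      exact h0 ⟨by simpa using h, rfl, rfl⟩
    refine ⟨N / (b / a * e ^ 2), ?_⟩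
    rw [div_mul_div_comm, ← pow_two, h]
    field_simp
    ring
  obtain ⟨t, ht⟩ : ∃ t, t = b / a * e ^ 2 / M ^ 2 := ⟨_, rfl⟩
  have h' : N ^ 2 = a * (1 + t ^ 2) * (M ^ 2) ^ 2 := by
    rw [h, ht]; field_simp
  -- For e ≠ 0 the valuation of t is odd, so either t or 1/t is small, and 1 + t² or 1 + t⁻² is a
  -- square close to 1.
  have hsq : IsSquare (1 + t ^ 2) ∧ 1 + t ^ 2 ≠ 0 := by
    by_cases he : e = 0
    · simp [ht, he]
    have ht0 : t ≠ 0 := by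
      rw [ht]
      exact div_ne_zero (mul_ne_zero (div_ne_zero hb ha) (pow_ne_zero _ he)) (pow_ne_zero _ hM)
    have hv : t.valuation ≠ 0 := by
      have h1 : t * M ^ 2 = b / a * e ^ 2 := by rw [ht]; field_simp
      have h2 := congrArg Padic.valuation h1
      rw [Padic.valuation_mul ht0 (pow_ne_zero _ hM), Padic.valuation_mul (div_ne_zero hb ha)
        (pow_ne_zero _ he), Padic.valuation_pow, Padic.valuation_pow] at h2
      push_cast at h2
      rw [Int.odd_iff] at hab
      omega
    have hn : ‖t‖ ≠ 1 := by
      intro hn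
      apply hv
      rw [← Padic.valuation_one (p := q)]
      exact valuation_eq_of_norm_eq ht0 one_ne_zero (by rw [hn, norm_one])
    constructor
    · rcases lt_or_gt_of_ne hn with hlt | hgt
      · exact isSquare_one_add_of_norm_lt_one hq
          (by rw [norm_pow]; exact pow_lt_one₀ (norm_nonneg _) hlt two_ne_zero)
      · have : IsSquare (1 + t⁻¹ ^ 2) := isSquare_one_add_of_norm_lt_one hq
          (by rw [norm_pow, norm_inv]
              exact pow_lt_one₀ (by positivity) (inv_lt_one_of_one_lt₀ hgt) two_ne_zero)
        obtain ⟨s, hs⟩ := this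
        refine ⟨t * s, ?_⟩
        rw [show t * s * (t * s) = t ^ 2 * (s * s) by ring, ← hs]
        field_simp
        ring
    · exact (valuation_add_mem one_ne_zero (pow_ne_zero 2 ht0) (by
        rw [Padic.valuation_one, Padic.valuation_pow]; push_cast; omega)).1
  obtain ⟨⟨s, hs⟩, hs0⟩ := hsq
  rw [hs] at h' hs0
  have hs0' : s ≠ 0 := by rintro rfl; simp at hs0
  refine ⟨N / (s * M ^ 2), ?_⟩
  rw [div_mul_div_comm, ← pow_two, h']
  field_simp

end Local

/-- A positive rational number all of whose valuations are even is a square. -/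
theorem isSquare_of_even_padicValRat {a : ℚ} (ha : 0 < a)
    (h : ∀ q : ℕ, Fact q.Prime → Even (padicValRat q a)) : IsSquare a := by
  obtain ⟨n, hn⟩ : ∃ n : ℕ, (n : ℚ) = a * (a.den : ℚ) ^ 2 := by
    refine ⟨a.num.toNat * a.den, ?_⟩
    have h1 : ((a.num.toNat : ℤ) : ℚ) = a.num := by
      rw [Int.toNat_of_nonneg (Rat.num_nonneg.mpr ha.le)]
    push_cast at h1 ⊢
    rw [h1, ← Rat.mul_den_eq_num]; ring
  have hd : (a.den : ℚ) ≠ 0 := by exact_mod_cast a.den_ne_zero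
  have hn0 : n ≠ 0 := by
    rintro rfl
    have : a * (a.den : ℚ) ^ 2 ≠ 0 := mul_ne_zero ha.ne' (pow_ne_zero _ hd)
    exact this (by rw [← hn]; simp)
  obtain ⟨c, b, hcb, hc⟩ := Nat.sq_mul_squarefree n
  have hc0 : c ≠ 0 := by rintro rfl; simp at hcb; omega
  have hb0 : b ≠ 0 := by rintro rfl; simp at hcb; omega
  have hc1 : c = 1 := by
    by_contra hc1
    obtain ⟨q, hq, hqc⟩ := Nat.exists_prime_and_dvd hc1
    have : Fact q.Prime := ⟨hq⟩
    have hvc : padicValNat q c = 1 := by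
      rw [← Nat.factorization_def c hq]
      exact Nat.factorization_eq_one_of_squarefree hc hq hqc
    have hv : (padicValNat q n : ℤ) = padicValRat q a + 2 * padicValNat q a.den := by
      rw [← padicValRat.of_nat, hn, padicValRat.mul ha.ne' (pow_ne_zero _ hd),
        padicValRat.pow, padicValRat.of_nat]
      push_cast; ring
    have hv' : padicValNat q n = 2 * padicValNat q b + 1 := by
      rw [← hcb, padicValNat.mul (pow_ne_zero _ hb0) hc0, padicValNat.pow, hvc]
    have := h q inferInstance
    rw [hv'] at hv
    rw [Int.even_iff] at this
    omega
  rw [hc1, mul_one] at hcb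
  refine ⟨b / a.den, ?_⟩
  rw [div_mul_div_comm, eq_div_iff (mul_ne_zero hd hd), ← pow_two, ← hn, ← hcb]
  push_cast; ring

/-! ### The Selmer groups of both isogenies -/

/-- The rational numbers whose torsors are soluble over an extension field of `ℚ`. -/
noncomputable def solubleOver (F : Type*) [Field F] [Algebra ℚ F] (B : ℚ) : Subgroup ℚˣ :=
  (torsorSubgroup F (algebraMap ℚ F B)).comap (Units.map (algebraMap ℚ F : ℚ →* F))

theorem mem_solubleOver {F : Type*} [Field F] [Algebra ℚ F] {B : ℚ} {d : ℚˣ} :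
    d ∈ solubleOver F B ↔
      TorsorHasPoint (algebraMap ℚ F d) (algebraMap ℚ F B / algebraMap ℚ F d) := Iff.rfl

theorem mem_solubleOver_of_isSquare {F : Type*} [Field F] [Algebra ℚ F] {B : ℚ} {d : ℚˣ}
    (h : IsSquare (algebraMap ℚ F d)) : d ∈ solubleOver F B := by
  obtain ⟨t, ht⟩ := h
  exact torsorHasPoint_of_eq_sq (t := t) _ (ht.trans (pow_two t).symm)

theorem sq_mem_solubleOver {F : Type*} [Field F] [Algebra ℚ F] {B : ℚ} (d : ℚˣ) :
    d ^ 2 ∈ solubleOver F B :=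
  mem_solubleOver_of_isSquare ⟨algebraMap ℚ F d, by rw [← map_mul, pow_two, Units.val_mul]⟩

theorem solubleOver_rat_le (F : Type*) [Field F] [Algebra ℚ F] (B : ℚ) :
    solubleOver ℚ B ≤ solubleOver F B := by
  rintro d ⟨N, M, e, h0, h⟩
  refine ⟨algebraMap ℚ F N, algebraMap ℚ F M, algebraMap ℚ F e, ?_, ?_⟩
  · simpa only [map_eq_zero] using h0
  · have h : N ^ 2 = d * M ^ 4 + B / d * e ^ 4 := h
    have := congrArg (algebraMap ℚ F) h
    simp only [map_add, map_mul, map_pow, map_div₀] at this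
    exact this

/-- The rational numbers whose torsors are soluble over `ℝ` and all `ℚ_q`. -/
noncomputable def everywhereSoluble (B : ℚ) : Subgroup ℚˣ :=
  solubleOver ℝ B ⊓ ⨅ (q : ℕ) (_ : Fact q.Prime), solubleOver ℚ_[q] B

theorem mem_everywhereSoluble {B : ℚ} {d : ℚˣ} : d ∈ everywhereSoluble B ↔
    d ∈ solubleOver ℝ B ∧ ∀ (q : ℕ) (_ : Fact q.Prime), d ∈ solubleOver ℚ_[q] B := by
  simp [everywhereSoluble, Subgroup.mem_inf, Subgroup.mem_iInf]

theorem selmerGroup_eq_map (B : ℚ) :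
    selmerGroup B = (everywhereSoluble B).map (QuotientGroup.mk' _) := by
  simp only [selmerGroup, everywhereSoluble, solubleOver, eq_ratCast]

theorem even_padicValRat_of_mem {q : ℕ} [Fact q.Prime] {B : ℚ} (hB : B ≠ 0)
    (hB0 : padicValRat q B = 0) {d : ℚˣ} (h : d ∈ solubleOver ℚ_[q] B) :
    Even (padicValRat q d) := by
  have h : TorsorHasPoint (algebraMap ℚ ℚ_[q] d) (algebraMap ℚ ℚ_[q] B / algebraMap ℚ ℚ_[q] d) := h
  rw [eq_ratCast, eq_ratCast] at h
  rw [← Padic.valuation_ratCast]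
  exact h.even_valuation (by exact_mod_cast d.ne_zero) (by exact_mod_cast hB)
    (by rw [Padic.valuation_ratCast, hB0])

/-- If `r` is no quadratic residue modulo `q ≡ 1 mod 8` and `B` is `q ^ 2` times a square unit up
to sign, then the torsor of `r` is not soluble over `ℚ_q`. -/
theorem notMem_solubleOver {q : ℕ} [Fact q.Prime] (hq : q % 8 = 1) {r : ℤ}
    (hr : legendreSym q r = -1) {B b : ℚ} (hB : B = b ^ 2 ∨ B = -b ^ 2)
    (hb : padicValRat q b = 1) {d : ℚˣ} (hd : (d : ℚ) = r) : d ∉ solubleOver ℚ_[q] B := by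
  intro h
  have h : TorsorHasPoint (algebraMap ℚ ℚ_[q] d) (algebraMap ℚ ℚ_[q] B / algebraMap ℚ ℚ_[q] d) := h
  rw [eq_ratCast, eq_ratCast, hd] at h
  have hq2 : q ≠ 2 := by rintro rfl; omega
  have hrq : (r : ZMod q) ≠ 0 := by
    intro h0
    rw [(legendreSym.eq_zero_iff q r).mpr h0] at hr
    omega
  have hb0 : b ≠ 0 := by rintro rfl; simp at hb
  have hb0' : (b : ℚ_[q]) ≠ 0 := by exact_mod_cast hb0
  have hr0 : ((r : ℚ) : ℚ_[q]) ≠ 0 := by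
    intro h0
    have : r = 0 := by exact_mod_cast h0
    rw [this] at hrq
    simp at hrq
  have hrv : padicValRat q (r : ℚ) = 0 := by
    rw [padicValRat.of_int, padicValInt.eq_zero_of_not_dvd]
    · rfl
    · rwa [← ZMod.intCast_zmod_eq_zero_iff_dvd]
  -- Since q ≡ 1 mod 8, -1 is a square in ℚ_q. Both signs of B thus reduce to B = c², which lets one
  -- argument serve φ and its dual.
  obtain ⟨c, hc0, hcB, hcv⟩ : ∃ c : ℚ_[q], c ≠ 0 ∧ (B : ℚ_[q]) = c ^ 2 ∧ c.valuation = 1 := by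
    rcases hB with rfl | rfl
    · exact ⟨b, hb0', by push_cast; ring, by rw [Padic.valuation_ratCast, hb]⟩
    · have hneg : IsSquare ((-1 : ℤ) : ℚ_[q]) := by
        refine isSquare_intCast_of_isSquare hq2 (by simp) ?_
        push_cast
        exact ZMod.exists_sq_eq_neg_one_iff.mpr (by omega)
      obtain ⟨i, hi⟩ := hneg
      push_cast at hi
      have hi0 : i ≠ 0 := by rintro rfl; simp at hi
      refine ⟨i * b, mul_ne_zero hi0 hb0', ?_, ?_⟩
      · push_cast
        linear_combination (b : ℚ_[q]) ^ 2 * hi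
      · have hiv : i.valuation = 0 := by
          have h1 := congrArg Padic.valuation hi
          rw [Padic.valuation_mul hi0 hi0, show (-1 : ℚ_[q]) = ((-1 : ℤ) : ℚ_[q]) by simp,
            Padic.valuation_intCast] at h1
          have : padicValInt q (-1) = 0 := by simp [padicValInt]
          rw [this] at h1
          push_cast at h1
          omega
        rw [Padic.valuation_mul hi0 hb0', hiv, Padic.valuation_ratCast, hb]; rfl
  rw [hcB] at h
  have := h.isSquare hq2 hr0 hc0 (by
    rw [div_eq_mul_inv, Padic.valuation_mul hc0 (inv_ne_zero hr0), Padic.valuation_inv, hcv,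
      Padic.valuation_ratCast, hrv]
    norm_num)
  have := isSquare_of_isSquare_intCast (a := r) (q := q) (by exact_mod_cast this)
  rw [legendreSym.eq_neg_one_iff] at hr
  exact hr this

section

variable {p l : ℕ} [Fact p.Prime] [Fact l.Prime]

/-- A prime as a unit of `ℚ`. -/
noncomputable def primeUnit (p : ℕ) [Fact p.Prime] : ℚˣ :=
  Units.mk0 (p : ℚ) (Nat.cast_ne_zero.mpr (Fact.out : p.Prime).ne_zero)

@[simp]
theorem val_primeUnit (p : ℕ) [Fact p.Prime] : ((primeUnit p : ℚˣ) : ℚ) = p := rfl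

theorem padicValRat_primeUnit_self : padicValRat p ((primeUnit p : ℚˣ) : ℚ) = 1 := by
  rw [val_primeUnit, padicValRat.of_nat, padicValNat_self]; rfl

theorem padicValRat_primeUnit_of_ne {q : ℕ} [Fact q.Prime] (h : q ≠ p) :
    padicValRat q ((primeUnit p : ℚˣ) : ℚ) = 0 := by
  rw [val_primeUnit, padicValRat.of_nat, padicValNat_primes h]; rfl

theorem padicValRat_units_mul {q : ℕ} [Fact q.Prime] (u v : ℚˣ) :
    padicValRat q ((u * v : ℚˣ) : ℚ) = padicValRat q (u : ℚ) + padicValRat q (v : ℚ) := by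
  rw [Units.val_mul, padicValRat.mul u.ne_zero v.ne_zero]

theorem padicValRat_units_pow {q : ℕ} [Fact q.Prime] (u : ℚˣ) (n : ℕ) :
    padicValRat q ((u ^ n : ℚˣ) : ℚ) = n * padicValRat q (u : ℚ) := by
  rw [Units.val_pow_eq_pow_val, padicValRat.pow]

/-- A positive rational number with even valuations outside a list of primes is, up to squares,
a product of these primes. -/
theorem exists_mul_sq_of_even_outside (s : List ℕ) (hs : ∀ r ∈ s, r.Prime) :
    ∀ u : ℚˣ, 0 < (u : ℚ) →
      (∀ q : ℕ, Fact q.Prime → q ∉ s → Even (padicValRat q (u : ℚ))) →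
      ∃ (t : List ℕ) (r v : ℚˣ), t.Sublist s ∧ (r : ℚ) = t.prod ∧ u = r * v ^ 2 := by
  induction s with
  | nil =>
    intro u hu h
    obtain ⟨v, hv⟩ := isSquare_of_even_padicValRat hu (fun q hq => h q hq (by simp))
    have hv0 : v ≠ 0 := by rintro rfl; simp at hv
    exact ⟨[], 1, Units.mk0 v hv0, List.Sublist.refl _, by simp,
      Units.ext (by simp [hv, pow_two])⟩
  | cons r s ih =>
    intro u hu h
    have hr : Fact r.Prime := ⟨hs r (by simp)⟩
    have hs' : ∀ r ∈ s, r.Prime := fun q hq => hs q (by simp [hq])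
    by_cases hru : Even (padicValRat r (u : ℚ))
    · obtain ⟨t, w, v, ht, hw, hv⟩ := ih hs' u hu (fun q hq hqs => by
        by_cases hqr : q = r
        · subst hqr; exact hru
        · exact h q hq (by simp [hqr, hqs]))
      exact ⟨t, w, v, ht.cons _, hw, hv⟩
    -- An odd valuation at r is made even by multiplying u by r; afterwards r joins the list and v
    -- is divided by r.
    · obtain ⟨t, w, v, ht, hw, hv⟩ := ih hs' (u * primeUnit r)
        (by rw [Units.val_mul, val_primeUnit]; exact mul_pos hu (by exact_mod_cast hr.out.pos))
        (fun q hq hqs => by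
          rw [padicValRat_units_mul]
          by_cases hqr : q = r
          · subst hqr
            rw [padicValRat_primeUnit_self]
            exact (Int.not_even_iff_odd.mp hru).add_odd odd_one
          · rw [padicValRat_primeUnit_of_ne hqr, add_zero]
            exact h q hq (by simp [hqr, hqs]))
      refine ⟨r :: t, primeUnit r * w, v * (primeUnit r)⁻¹, ht.cons_cons _, ?_, ?_⟩
      · rw [Units.val_mul, val_primeUnit, hw]; simp
      · rw [eq_mul_inv_of_mul_eq hv]
        ext
        simp only [Units.val_mul, Units.val_pow_eq_pow_val, Units.val_inv_eq_inv_val]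
        field_simp

end

/-! ### Explicit points and local solubility for 2 and pl -/

section Solutions

variable {F : Type*} [Field F]

/-- If ±k = s², then 2s⁴ + 2k² = (2k)². If -1 = i² and 2k = s², then N = 0 works, because (1 + i)⁴ =
-4 makes -k² the fourth power of (1 + i)s/2. -/
theorem torsorHasPoint_two_of_isSquare {k : F} (h2 : (2 : F) ≠ 0)
    (h : IsSquare (2 : F) ∨ IsSquare k ∨ IsSquare (-k) ∨
      (IsSquare (-1 : F) ∧ IsSquare (2 * k))) : TorsorHasPoint 2 (4 * k ^ 2 / 2) := by
  have e : 4 * k ^ 2 / 2 = 2 * k ^ 2 := by field_simp; ring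
  rw [e]
  rcases h with ⟨s, hs⟩ | ⟨s, hs⟩ | ⟨s, hs⟩ | ⟨⟨i, hi⟩, s, hs⟩
  · exact torsorHasPoint_of_eq_sq (t := s) _ (by rw [hs]; ring)
  · exact ⟨2 * k, s, 1, by simp, by rw [hs]; ring⟩
  · exact ⟨2 * k, s, 1, by simp, by
      linear_combination 2 * (s ^ 2 - k) * hs⟩
  · refine ⟨0, (1 + i) * s / 2, 1, by simp, ?_⟩
    have h4 : (1 + i) ^ 4 = -4 := by linear_combination (-(i ^ 2 + 4 * i + 5)) * hi
    have : 2 * ((1 + i) * s / 2) ^ 4 = -(2 * k ^ 2) := by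
      rw [div_pow, mul_pow, h4]
      field_simp
      linear_combination 4 * (s ^ 2 + 2 * k) * hs
    rw [this]; ring

theorem torsorHasPoint_of_isSquare_neg_one {k : F} (h : IsSquare (-1 : F)) :
    TorsorHasPoint k (4 * k ^ 2 / k) := by
  obtain ⟨i, hi⟩ := h
  refine ⟨0, 1 + i, 1, by simp, ?_⟩
  have h4 : (1 + i) ^ 4 = -4 := by linear_combination (-(i ^ 2 + 4 * i + 5)) * hi
  by_cases hk : k = 0
  · simp [hk]
  · rw [h4]; field_simp; ring

end Solutions

section

variable {p l : ℕ} [Fact p.Prime] [Fact l.Prime]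

theorem isSquare_neg_one_padic {q : ℕ} [Fact q.Prime] (hq : q % 8 = 1) :
    IsSquare ((-1 : ℤ) : ℚ_[q]) :=
  isSquare_intCast_of_isSquare (by rintro rfl; omega) (by simp)
    (by push_cast; exact ZMod.exists_sq_eq_neg_one_iff.mpr (by omega))

theorem isSquare_two_padic {q : ℕ} [Fact q.Prime] (hq : q % 8 = 1) :
    IsSquare ((2 : ℤ) : ℚ_[q]) := by
  have hq2 : q ≠ 2 := by rintro rfl; omega
  refine isSquare_intCast_of_isSquare hq2 (by exact_mod_cast two_ne_zero_of_mod_eight hq)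
    (by push_cast; exact (ZMod.exists_sq_eq_two_iff hq2).mpr (.inl hq))

theorem intCast_mul_ne_zero {q : ℕ} [Fact q.Prime] (hqp : q ≠ p) (hql : q ≠ l) :
    (((p * l : ℕ) : ℤ) : ZMod q) ≠ 0 := by
  intro h
  rw [Int.cast_natCast, ZMod.natCast_eq_zero_iff, (Fact.out : q.Prime).dvd_mul,
    Nat.prime_dvd_prime_iff_eq Fact.out Fact.out,
    Nat.prime_dvd_prime_iff_eq Fact.out Fact.out] at h
  tauto

/-- At p and l the number 2 is a square, and at 2 the number pl ≡ 1 mod 8 is one. At the other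
primes -1, 2, pl are units, and the pairs (-1, pl) and (2, pl) each contain a square or have a
square product; every combination gives one of the explicit points. -/
theorem two_mem_everywhereSoluble (hp : p % 8 = 1) (hl : l % 8 = 1) :
    Units.mk0 (2 : ℚ) two_ne_zero ∈ everywhereSoluble (4 * (p * l : ℚ) ^ 2) := by
  have hk8 := mul_mod_eight hp hl
  refine mem_everywhereSoluble.mpr ⟨mem_solubleOver_of_isSquare ?_, fun q _ => ?_⟩
  · rw [Units.val_mk0, map_ofNat]
    exact ⟨√2, by norm_num⟩
  · have h2 : (2 : ℚ_[q]) ≠ 0 := two_ne_zero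
    have key : IsSquare (2 : ℚ_[q]) ∨ IsSquare ((p : ℚ_[q]) * l) ∨
        IsSquare (-((p : ℚ_[q]) * l)) ∨
        (IsSquare (-1 : ℚ_[q]) ∧ IsSquare (2 * ((p : ℚ_[q]) * l))) := by
      by_cases hq2 : q = 2
      · subst hq2
        refine .inr (.inl ?_)
        have := isSquare_intCast_two_adic (a := ((p * l : ℕ) : ℤ)) (by omega)
        push_cast at this
        exact this
      by_cases hqp : q = p
      · subst hqp
        exact .inl (by exact_mod_cast isSquare_two_padic hp)
      by_cases hql : q = l
      · subst hql
        exact .inl (by exact_mod_cast isSquare_two_padic hl)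
      have hk := intCast_mul_ne_zero hqp hql
      have h20 : ((2 : ℤ) : ZMod q) ≠ 0 := by
        rw [Ne, ZMod.intCast_zmod_eq_zero_iff_dvd]
        intro h
        exact hq2 ((Nat.prime_dvd_prime_iff_eq Fact.out Nat.prime_two).mp (by exact_mod_cast h))
      have h1 := isSquare_or_isSquare_or_isSquare_mul hq2 (a := -1) (by simp) hk
      have h3 := isSquare_or_isSquare_or_isSquare_mul hq2 h20 hk
      push_cast at h1 h3
      rw [neg_one_mul] at h1
      tauto
    have := torsorHasPoint_two_of_isSquare h2 key
    rw [mem_solubleOver]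
    simpa using this

/-- Where -1 is a square there is a point with N = 0. At an odd q where it is not, every residue is
± a square, so every square modulo q is a fourth power. Writing pl as a sum of two squares modulo q
then gives pl ≡ m⁴ + 4e⁴, and pl(m⁴ + 4e⁴) ≡ (pl)² lifts to a square. -/
theorem mul_mem_everywhereSoluble (hp : p % 8 = 1) (hl : l % 8 = 1) :
    primeUnit p * primeUnit l ∈ everywhereSoluble (4 * (p * l : ℚ) ^ 2) := by
  have hk8 := mul_mod_eight hp hl
  have hp0 : (p : ℚ) ≠ 0 := (primeUnit p).ne_zero
  have hl0 : (l : ℚ) ≠ 0 := (primeUnit l).ne_zero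
  refine mem_everywhereSoluble.mpr ⟨mem_solubleOver_of_isSquare ?_, fun q _ => ?_⟩
  · rw [Units.val_mul, val_primeUnit, val_primeUnit, map_mul, map_natCast, map_natCast]
    exact ⟨√(p * l), by rw [Real.mul_self_sqrt (by positivity)]⟩
  · have hk0 : (p : ℚ_[q]) * l ≠ 0 := by exact_mod_cast mul_ne_zero hp0 hl0
    rw [mem_solubleOver]
    suffices h : TorsorHasPoint ((p : ℚ_[q]) * l) (4 * ((p : ℚ_[q]) * l) ^ 2 / ((p : ℚ_[q]) * l)) by
      simpa using h
    by_cases hi : IsSquare (-1 : ℚ_[q])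
    · exact torsorHasPoint_of_isSquare_neg_one hi
    by_cases hq2 : q = 2
    · subst hq2
      have := isSquare_intCast_two_adic (a := ((p * l : ℕ) : ℤ)) (by omega)
      push_cast at this
      obtain ⟨s, hs⟩ := this
      exact torsorHasPoint_of_eq_sq (t := s) _ (by rw [hs]; ring)
    have hqp : q ≠ p := by
      rintro rfl
      exact hi (by exact_mod_cast isSquare_neg_one_padic hp)
    have hql : q ≠ l := by
      rintro rfl
      exact hi (by exact_mod_cast isSquare_neg_one_padic hl)
    have hk := intCast_mul_ne_zero hqp hql
    have hneg : ¬ IsSquare (-1 : ZMod q) := fun h =>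
      hi (by exact_mod_cast isSquare_intCast_of_isSquare hq2 (a := -1) (by simp) (by simpa using h))
    have h20 : (2 : ZMod q) ≠ 0 := by
      intro h
      have h : ((2 : ℕ) : ZMod q) = 0 := by exact_mod_cast h
      rw [ZMod.natCast_eq_zero_iff] at h
      exact hq2 ((Nat.prime_dvd_prime_iff_eq Fact.out Nat.prime_two).mp h)
    have hpm : ∀ x : ZMod q, ∃ y, x = y ^ 2 ∨ x = -y ^ 2 := by
      intro x
      by_cases hx : IsSquare x
      · obtain ⟨y, hy⟩ := hx
        exact ⟨y, .inl (by rw [hy]; ring)⟩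
      · have hx0 : x ≠ 0 := by rintro rfl; simp at hx
        have : IsSquare (-1 * x) := by
          rw [← quadraticChar_one_iff_isSquare (by simpa using hx0), map_mul,
            quadraticChar_neg_one_iff_not_isSquare.mpr hx,
            quadraticChar_neg_one_iff_not_isSquare.mpr hneg]
          norm_num
        obtain ⟨y, hy⟩ := this
        exact ⟨y, .inr (by linear_combination -hy)⟩
    obtain ⟨a, b, hab⟩ := ZMod.sq_add_sq q (((p * l : ℕ) : ℤ) : ZMod q)
    obtain ⟨m, hm⟩ := hpm a
    obtain ⟨e, he⟩ := hpm (b / 2)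
    have hm : a ^ 2 = m ^ 4 := by rcases hm with rfl | rfl <;> ring
    have he : b ^ 2 = 4 * e ^ 4 := by
      have hb : b = 2 * (b / 2) := by field_simp
      rw [hb]
      rcases he with he | he <;> rw [he] <;> ring
    rw [hm, he] at hab
    obtain ⟨m, rfl⟩ := ZMod.intCast_surjective m
    obtain ⟨e, rfl⟩ := ZMod.intCast_surjective e
    have hsq := isSquare_intCast_of_eq_sq hq2 (a := ((p * l : ℕ) : ℤ) * (m ^ 4 + 4 * e ^ 4)) hk (by
      push_cast at hab ⊢
      rw [hab]; ring)
    obtain ⟨N, hN⟩ := hsq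
    refine ⟨N, m, e, ?_, ?_⟩
    · rintro ⟨-, h1, h2⟩
      have h1 : m = 0 := by exact_mod_cast h1
      have h2 : e = 0 := by exact_mod_cast h2
      subst h1 h2
      exact hk (by rw [← hab]; simp)
    · push_cast at hN
      rw [pow_two, ← hN]
      field_simp

theorem padicValRat_mul_eq_one (h₂ : legendreSym l p = -1) {c : ℚ} (hc : c ≠ 0) (hcp : padicValRat p c = 0)
    (hcl : padicValRat l c = 0) :
    padicValRat p (c * (p * l)) = 1 ∧ padicValRat l (c * (p * l)) = 1 := by
  have hpl : p ≠ l := by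
    rintro rfl
    exact (Fact.out : p.Prime).one_lt.ne' (by simpa using coprime_of_legendreSym h₂)
  have hp0 : (p : ℚ) ≠ 0 := (primeUnit p).ne_zero
  have hl0 : (l : ℚ) ≠ 0 := (primeUnit l).ne_zero
  have a1 := padicValRat_primeUnit_self (p := p)
  have a2 := padicValRat_primeUnit_self (p := l)
  have a3 := padicValRat_primeUnit_of_ne (p := l) (q := p) hpl
  have a4 := padicValRat_primeUnit_of_ne (p := p) (q := l) hpl.symm
  rw [val_primeUnit] at a1 a2 a3 a4
  constructor <;> rw [padicValRat.mul hc (mul_ne_zero hp0 hl0), padicValRat.mul hp0 hl0]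
  · rw [hcp, a1, a3]; rfl
  · rw [hcl, a2, a4]; rfl

theorem legendreSym_of_eq_mul {q : ℕ} [Fact q.Prime] (hq : q % 8 = 1) {r c : ℤ}
    (hc : c = 1 ∨ c = -1 ∨ c = 2) (hr : legendreSym q r = -1) : legendreSym q (c * r) = -1 := by
  rw [legendreSym.mul, hr]
  rcases hc with rfl | rfl | rfl
  · simp
  · have := quadraticChar_neg_of_mod_eight hq 1
    rw [map_one] at this
    simp [legendreSym, this]
  · have := quadraticChar_two_of_mod_eight hq
    simp [legendreSym, this]

/-- The class ap is refuted at l and al at p: -1 and 2 are residues there, so the factor a leaves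
the nonresidue symbol unchanged. -/
theorem notMem_solubleOver_of_eq (hp : p % 8 = 1) (hl : l % 8 = 1) (h₂ : legendreSym l p = -1)
    {B c : ℚ} (hB : B = (c * (p * l)) ^ 2 ∨ B = -(c * (p * l)) ^ 2) (hc : c = 1 ∨ c = 2)
    {u : ℚˣ} {a : ℤ} (ha : a = 1 ∨ a = -1 ∨ a = 2)
    (hu : ∀ (q : ℕ) (_ : Fact q.Prime), u ∈ solubleOver ℚ_[q] B) :
    (u : ℚ) ≠ a * p ∧ (u : ℚ) ≠ a * l := by
  have hc0 : c ≠ 0 := by rcases hc with rfl | rfl <;> norm_num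
  have hcv : ∀ q : ℕ, ∀ _ : Fact q.Prime, q % 8 = 1 → padicValRat q c = 0 := by
    intro q _ hq
    rcases hc with rfl | rfl
    · simp
    · have : Fact (Nat.Prime 2) := ⟨Nat.prime_two⟩
      have := padicValRat_primeUnit_of_ne (p := 2) (q := q) (by rintro rfl; omega)
      simpa using this
  obtain ⟨v1, v2⟩ := padicValRat_mul_eq_one h₂ hc0 (hcv p inferInstance hp) (hcv l inferInstance hl)
  constructor
  · intro h
    exact notMem_solubleOver hl (legendreSym_of_eq_mul hl ha h₂) hB v2 (d := u)
      (by rw [h]; push_cast; ring) (hu l inferInstance)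
  · intro h
    exact notMem_solubleOver hp
      (legendreSym_of_eq_mul hp ha (legendreSym_symm_of_mod_eight hp hl h₂)) hB v1 (d := u)
      (by rw [h]; push_cast; ring) (hu p inferInstance)

theorem mem_of_mul_sq_mem {G : Type*} [CommGroup G] {H : Subgroup G} {a v : G} (hv : v ^ 2 ∈ H)
    (h : a * v ^ 2 ∈ H) : a ∈ H :=
  (Subgroup.mul_mem_cancel_right H hv).mp h

/-- The representatives of the Selmer group of the first isogeny. -/
theorem exists_eq_of_mem_everywhereSoluble (hp : p % 8 = 1) (hl : l % 8 = 1)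
    (h₂ : legendreSym l p = -1) {u : ℚˣ} (hu : u ∈ everywhereSoluble (4 * (p * l : ℚ) ^ 2)) :
    ∃ d v : ℚˣ, ((d : ℚ) = 1 ∨ (d : ℚ) = 2 ∨ (d : ℚ) = p * l ∨ (d : ℚ) = 2 * (p * l)) ∧
      u = d * v ^ 2 := by
  have hp0 : (p : ℚ) ≠ 0 := (primeUnit p).ne_zero
  have hl0 : (l : ℚ) ≠ 0 := (primeUnit l).ne_zero
  obtain ⟨hR, hQ⟩ := mem_everywhereSoluble.mp hu
  -- The product of the two coefficients is positive, so for negative u both are negative and the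
  -- form has no nontrivial real zero.
  have hpos : 0 < (u : ℚ) := by
    rw [mem_solubleOver, eq_ratCast, eq_ratCast] at hR
    obtain ⟨N, M, e, h0, h⟩ := hR
    by_contra hneg
    have hu0 : (u : ℚ) < 0 := lt_of_le_of_ne (not_lt.mp hneg) u.ne_zero
    have hu0' : ((u : ℚ) : ℝ) < 0 := by exact_mod_cast hu0
    have hB : (0 : ℝ) < ((4 * (p * l : ℚ) ^ 2 : ℚ) : ℝ) := by
      have : (0 : ℚ) < 4 * (p * l : ℚ) ^ 2 := by positivity
      exact_mod_cast this
    have h1 : ((u : ℚ) : ℝ) * M ^ 4 ≤ 0 := mul_nonpos_of_nonpos_of_nonneg hu0'.le (by positivity)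
    have h2 : ((4 * (p * l : ℚ) ^ 2 : ℚ) : ℝ) / ((u : ℚ) : ℝ) * e ^ 4 ≤ 0 :=
      mul_nonpos_of_nonpos_of_nonneg (div_neg_of_pos_of_neg hB hu0').le (by positivity)
    have hN : N = 0 := by nlinarith [sq_nonneg N]
    subst hN
    have h1' : ((u : ℚ) : ℝ) * M ^ 4 = 0 := by linarith
    have h2' : ((4 * (p * l : ℚ) ^ 2 : ℚ) : ℝ) / ((u : ℚ) : ℝ) * e ^ 4 = 0 := by linarith
    have hM : M = 0 := by simpa [hu0'.ne] using h1'
    have he : e = 0 := by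
      rcases mul_eq_zero.mp h2' with h | h
      · exact absurd h (div_ne_zero hB.ne' hu0'.ne)
      · simpa using h
    exact h0 ⟨rfl, hM, he⟩
  obtain ⟨t, r, v, ht, hr, huv⟩ := exists_mul_sq_of_even_outside [2, p, l]
    (by simp [Nat.prime_two, (Fact.out : p.Prime), (Fact.out : l.Prime)]) u hpos (by
      intro q _ hq
      simp only [List.mem_cons, List.not_mem_nil, or_false, not_or] at hq
      refine even_padicValRat_of_mem (by positivity) ?_ (hQ q _)
      have : Fact (Nat.Prime 2) := ⟨Nat.prime_two⟩
      have h1 := padicValRat_primeUnit_of_ne (p := 2) hq.1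
      have h2 := padicValRat_primeUnit_of_ne (p := p) hq.2.1
      have h3 := padicValRat_primeUnit_of_ne (p := l) hq.2.2
      rw [val_primeUnit] at h1 h2 h3
      rw [show (4 * (p * l : ℚ) ^ 2) = (((2 : ℕ) : ℚ) * (p * l)) ^ 2 by push_cast; ring,
        padicValRat.pow, padicValRat.mul (by norm_num) (mul_ne_zero hp0 hl0),
        padicValRat.mul hp0 hl0, h1, h2, h3]
      simp)
  have hrQ : ∀ (q : ℕ) (_ : Fact q.Prime), r ∈ solubleOver ℚ_[q] (4 * (p * l : ℚ) ^ 2) :=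
    fun q _ => mem_of_mul_sq_mem (sq_mem_solubleOver v) (huv ▸ hQ q _)
  have hn1 := notMem_solubleOver_of_eq hp hl h₂ (c := 2) (.inl (by ring)) (.inr rfl) (a := 1)
    (by simp) hrQ
  have hn2 := notMem_solubleOver_of_eq hp hl h₂ (c := 2) (.inl (by ring)) (.inr rfl) (a := 2)
    (by simp) hrQ
  refine ⟨r, v, ?_, huv⟩
  rw [← List.mem_sublists] at ht
  have : t = [] ∨ t = [2] ∨ t = [p] ∨ t = [2, p] ∨ t = [l] ∨ t = [2, l] ∨ t = [p, l] ∨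
      t = [2, p, l] := by simpa [List.sublists, List.foldr] using ht
  push_cast at hn1 hn2
  rw [one_mul, one_mul] at hn1
  rcases this with rfl | rfl | rfl | rfl | rfl | rfl | rfl | rfl <;>
    simp only [List.prod_nil, List.prod_cons, mul_one, Nat.cast_one, Nat.cast_ofNat,
      Nat.cast_mul] at hr
  · exact .inl hr
  · exact .inr (.inl hr)
  · exact absurd hr hn1.1
  · exact absurd hr hn2.1
  · exact absurd hr hn1.2
  · exact absurd hr hn2.2
  · exact .inr (.inr (.inl hr))
  · exact .inr (.inr (.inr hr))

/-- The representatives of the Selmer group of the dual isogeny. -/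
theorem exists_eq_of_mem_solubleOver_dual (hp : p % 8 = 1) (hl : l % 8 = 1)
    (h₂ : legendreSym l p = -1) {u : ℚˣ}
    (hQ : ∀ (q : ℕ) (_ : Fact q.Prime), u ∈ solubleOver ℚ_[q] (-(p * l : ℚ) ^ 2)) :
    ∃ d v : ℚˣ, ((d : ℚ) = 1 ∨ (d : ℚ) = -1 ∨ (d : ℚ) = p * l ∨ (d : ℚ) = -(p * l)) ∧
      u = d * v ^ 2 := by
  have hp0 : (p : ℚ) ≠ 0 := (primeUnit p).ne_zero
  have hl0 : (l : ℚ) ≠ 0 := (primeUnit l).ne_zero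
  have hk0 : (p * l : ℚ) ≠ 0 := mul_ne_zero hp0 hl0
  -- Here the product -(pl)² is a 2-adic unit, so the prime 2 does not enter. The sign remains free
  -- and is split off below.
  have hev : ∀ q : ℕ, Fact q.Prime → q ∉ [p, l] → Even (padicValRat q (u : ℚ)) := by
    intro q _ hq
    simp only [List.mem_cons, List.not_mem_nil, or_false, not_or] at hq
    refine even_padicValRat_of_mem (neg_ne_zero.mpr (pow_ne_zero 2 hk0)) ?_ (hQ q _)
    have h2 := padicValRat_primeUnit_of_ne (p := p) hq.1
    have h3 := padicValRat_primeUnit_of_ne (p := l) hq.2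
    rw [val_primeUnit] at h2 h3
    rw [padicValRat.neg, padicValRat.pow, padicValRat.mul hp0 hl0, h2, h3]
    simp
  obtain ⟨s, hs, hpos⟩ : ∃ s : ℤˣ, (s = 1 ∨ s = -1) ∧
      0 < ((Units.map (Int.castRingHom ℚ : ℤ →* ℚ) s * u : ℚˣ) : ℚ) := by
    rcases lt_or_gt_of_ne u.ne_zero with h | h
    · exact ⟨-1, .inr rfl, by simpa using h⟩
    · exact ⟨1, .inl rfl, by simpa using h⟩
  obtain ⟨ε, hε⟩ : ∃ ε, ε = Units.map (Int.castRingHom ℚ : ℤ →* ℚ) s := ⟨_, rfl⟩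
  rw [← hε] at hpos
  have hεv : (ε : ℚ) = 1 ∨ (ε : ℚ) = -1 := by
    rcases hs with rfl | rfl
    · left; rw [hε]; simp
    · right; rw [hε]; simp
  have hεε : ε * ε = 1 := by
    ext
    rcases hεv with h | h <;> simp [h]
  obtain ⟨t, r, v, ht, hr, huv⟩ := exists_mul_sq_of_even_outside [p, l]
    (by simp [(Fact.out : p.Prime), (Fact.out : l.Prime)]) (ε * u) hpos (by
      intro q _ hq
      rw [padicValRat_units_mul]
      have : padicValRat q (ε : ℚ) = 0 := by rcases hεv with h | h <;> simp [h]
      rw [this, zero_add]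
      exact hev q inferInstance hq)
  have huv' : u = ε * r * v ^ 2 := by
    rw [mul_assoc, ← huv, ← mul_assoc, hεε, one_mul]
  have hrQ : ∀ (q : ℕ) (_ : Fact q.Prime), ε * r ∈ solubleOver ℚ_[q] (-(p * l : ℚ) ^ 2) :=
    fun q _ => mem_of_mul_sq_mem (sq_mem_solubleOver v) (huv' ▸ hQ q _)
  have hn1 := notMem_solubleOver_of_eq hp hl h₂ (c := 1) (.inr (by ring)) (.inl rfl) (a := 1)
    (by simp) hrQ
  have hn2 := notMem_solubleOver_of_eq hp hl h₂ (c := 1) (.inr (by ring)) (.inl rfl) (a := -1)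
    (by simp) hrQ
  refine ⟨ε * r, v, ?_, huv'⟩
  rw [← List.mem_sublists] at ht
  have : t = [] ∨ t = [p] ∨ t = [l] ∨ t = [p, l] := by
    simpa [List.sublists, List.foldr] using ht
  rw [Units.val_mul] at hn1 hn2 ⊢
  push_cast at hn1 hn2
  rcases this with rfl | rfl | rfl | rfl <;> rcases hεv with h | h <;>
    simp only [List.prod_nil, List.prod_cons, mul_one, Nat.cast_one, Nat.cast_mul] at hr <;>
    rw [h, hr] at hn1 hn2 ⊢ <;> simp_all

end

/-! ### The groups W and S^(φ) -/

section

variable {p l : ℕ} [Fact p.Prime] [Fact l.Prime]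

theorem exists_eq_sq_of_mem_solubleOver_rat (hp : p % 8 = 1) (hl : l % 8 = 1)
    (h₂ : legendreSym l p = -1) (h8 : octicSymbol (-4) p * octicSymbol (-4) l = -1) {u : ℚˣ}
    (hu : u ∈ solubleOver ℚ (4 * (p * l : ℚ) ^ 2)) : ∃ v : ℚˣ, u = v ^ 2 := by
  have hu' : u ∈ everywhereSoluble (4 * (p * l : ℚ) ^ 2) :=
    mem_everywhereSoluble.mpr ⟨solubleOver_rat_le _ _ hu, fun _ _ => solubleOver_rat_le _ _ hu⟩
  obtain ⟨d, v, hd, rfl⟩ := exists_eq_of_mem_everywhereSoluble hp hl h₂ hu'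
  have hd' := mem_of_mul_sq_mem (sq_mem_solubleOver v) hu
  rw [mem_solubleOver] at hd'
  obtain ⟨n1, n2, n3⟩ := not_phiTorsorSolvable hp hl h₂ h8
  simp only [PhiTorsorSolvable, phiProduct_mul hp hl] at n1 n2 n3
  rcases hd with h | h | h | h
  · exact ⟨v, by rw [Units.val_eq_one.mp h, one_mul]⟩
  all_goals
    exfalso
    rw [h] at hd'
    first
      | exact n1 hd'
      | exact n2 hd'
      | exact n3 hd'

theorem mk_mul_sq (d v : ℚˣ) : (QuotientGroup.mk (d * v ^ 2) : SquareClass) = QuotientGroup.mk d :=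
  (QuotientGroup.eq).mpr ⟨v⁻¹, by simp [powMonoidHom_apply]⟩

theorem solvablePhi_eq_bot (hp : p % 8 = 1) (hl : l % 8 = 1)
    (h₂ : legendreSym l p = -1) (h8 : octicSymbol (-4) p * octicSymbol (-4) l = -1) :
    solvablePhi (p * l : ℤ) = ⊥ := by
  rw [eq_bot_iff]
  rintro _ ⟨u, hu, rfl⟩
  rw [phiProduct_mul hp hl] at hu
  obtain ⟨v, rfl⟩ := exists_eq_sq_of_mem_solubleOver_rat hp hl h₂ h8 (u := u) hu
  rw [Subgroup.mem_bot]
  have := mk_mul_sq 1 v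
  rw [one_mul] at this
  exact this

theorem selmerPhi_eq_closure (hp : p % 8 = 1) (hl : l % 8 = 1) (h₂ : legendreSym l p = -1)
    (hk : (p * l : ℚ) ≠ 0) :
    selmerPhi (p * l : ℤ) =
      Subgroup.closure {squareClass 2 two_ne_zero, squareClass (p * l : ℚ) hk} := by
  rw [selmerPhi, phiProduct_mul hp hl, selmerGroup_eq_map]
  apply le_antisymm
  · rintro _ ⟨u, hu, rfl⟩
    obtain ⟨d, v, hd, rfl⟩ := exists_eq_of_mem_everywhereSoluble hp hl h₂ hu
    have e : QuotientGroup.mk' _ (d * v ^ 2) = (QuotientGroup.mk d : SquareClass) := mk_mul_sq d v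
    rw [e]
    have m2 : squareClass 2 two_ne_zero ∈ Subgroup.closure
        {squareClass 2 two_ne_zero, squareClass (p * l : ℚ) hk} :=
      Subgroup.subset_closure (by simp)
    have mk : squareClass (p * l : ℚ) hk ∈ Subgroup.closure
        {squareClass 2 two_ne_zero, squareClass (p * l : ℚ) hk} :=
      Subgroup.subset_closure (by simp)
    rcases hd with h | h | h | h
    · rw [Units.val_eq_one.mp h]
      exact one_mem _
    · have : d = Units.mk0 2 two_ne_zero := Units.ext h
      rw [this]
      exact m2
    · have : d = Units.mk0 _ hk := Units.ext h
      rw [this]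
      exact mk
    · have : d = Units.mk0 2 two_ne_zero * Units.mk0 _ hk := Units.ext h
      rw [this]
      exact mul_mem m2 mk
  · rw [Subgroup.closure_le]
    rintro x (rfl | rfl)
    · exact ⟨_, two_mem_everywhereSoluble hp hl, rfl⟩
    · refine ⟨_, mul_mem_everywhereSoluble hp hl, ?_⟩
      exact congrArg QuotientGroup.mk (Units.ext rfl)

end

theorem selmerToSha_bijective {k : ℤ} (h : solvablePhi k = ⊥) :
    Function.Bijective (selmerToSha k) := by
  refine ⟨?_, QuotientGroup.mk'_surjective _⟩
  rw [← MonoidHom.ker_eq_bot_iff, selmerToSha, QuotientGroup.ker_mk', h]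
  simp

/-! ### The group law of `y ^ 2 = x ^ 3 - κ ^ 2 x` -/

open WeierstrassCurve.Affine (Point)

/-- The Weierstrass curve `V` is `y ^ 2 = x ^ 3 - κ ^ 2 x`, where `κ` is not zero. -/
structure IsCongruentCurve {L : Type*} [Field L] (V : WeierstrassCurve.Affine L) (κ : L) :
    Prop where
  a₁ : V.a₁ = 0
  a₂ : V.a₂ = 0
  a₃ : V.a₃ = 0
  a₄ : V.a₄ = -κ ^ 2
  a₆ : V.a₆ = 0
  ne_zero : κ ≠ 0

namespace IsCongruentCurve

section

variable {L : Type*} [Field L] {V : WeierstrassCurve.Affine L} {κ : L}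

theorem equation_iff (hV : IsCongruentCurve V κ) {x y : L} :
    V.Equation x y ↔ y ^ 2 = x ^ 3 - κ ^ 2 * x := by
  rw [WeierstrassCurve.Affine.equation_iff, hV.a₁, hV.a₂, hV.a₃, hV.a₄, hV.a₆]
  simp [sub_eq_add_neg]

theorem negY_eq (hV : IsCongruentCurve V κ) {x y : L} : V.negY x y = -y := by
  simp [WeierstrassCurve.Affine.negY, hV.a₁, hV.a₃]

theorem addX_eq (hV : IsCongruentCurve V κ) {x x' m : L} : V.addX x x' m = m ^ 2 - x - x' := by
  simp [WeierstrassCurve.Affine.addX, hV.a₁, hV.a₂]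

theorem addY_eq (hV : IsCongruentCurve V κ) {x x' y m : L} :
    V.addY x x' y m = -(m * (m ^ 2 - x - x' - x) + y) := by
  rw [WeierstrassCurve.Affine.addY, WeierstrassCurve.Affine.negAddY, hV.negY_eq, hV.addX_eq]

theorem eq_of_nonsingular (hV : IsCongruentCurve V κ) {x y : L} (h : V.Nonsingular x y) :
    y ^ 2 = x ^ 3 - κ ^ 2 * x := hV.equation_iff.mp h.1

theorem x_of_two_torsion {x : L} (h : (0 : L) ^ 2 = x ^ 3 - κ ^ 2 * x) :
    x = 0 ∨ x = κ ∨ x = -κ := by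
  have : x * ((x - κ) * (x + κ)) = 0 := by linear_combination -h
  rcases mul_eq_zero.mp this with h | h
  · exact .inl h
  rcases mul_eq_zero.mp h with h | h
  · exact .inr (.inl (sub_eq_zero.mp h))
  · exact .inr (.inr (eq_neg_of_add_eq_zero_left h))

variable [CharZero L]

theorem nonsingular (hV : IsCongruentCurve V κ) {x y : L} (h : y ^ 2 = x ^ 3 - κ ^ 2 * x) :
    V.Nonsingular x y := by
  rw [WeierstrassCurve.Affine.nonsingular_iff', hV.equation_iff, hV.a₁, hV.a₂, hV.a₃, hV.a₄]
  refine ⟨h, ?_⟩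
  by_cases hy : y = 0
  · left
    subst hy
    intro h'
    have hκ := hV.ne_zero
    have h0 : x * (x ^ 2 - κ ^ 2) = 0 := by linear_combination -h
    rcases mul_eq_zero.mp h0 with rfl | hx
    · apply pow_ne_zero 2 hκ; linear_combination h'
    · have : 2 * κ ^ 2 = 0 := by linear_combination -h' - 3 * hx
      exact mul_ne_zero two_ne_zero (pow_ne_zero 2 hκ) this
  · right
    simpa using hy

/-- The point with coordinates `x`, `y`. -/
def point (hV : IsCongruentCurve V κ) (x y : L) (h : y ^ 2 = x ^ 3 - κ ^ 2 * x) : V.Point :=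
  .some x y (hV.nonsingular h)

theorem eq_zero_or_eq_point (hV : IsCongruentCurve V κ) (P : V.Point) :
    P = 0 ∨ ∃ x y h, P = hV.point x y h := by
  rcases P with _ | ⟨x, y, h⟩
  · exact .inl rfl
  · exact .inr ⟨x, y, hV.eq_of_nonsingular h, rfl⟩

theorem point_ne_zero (hV : IsCongruentCurve V κ) {x y : L} (h : y ^ 2 = x ^ 3 - κ ^ 2 * x) :
    hV.point x y h ≠ 0 := Point.some_ne_zero _

theorem point_inj (hV : IsCongruentCurve V κ) {x y x' y' : L} {h : y ^ 2 = x ^ 3 - κ ^ 2 * x}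
    {h' : y' ^ 2 = x' ^ 3 - κ ^ 2 * x'} :
    hV.point x y h = hV.point x' y' h' ↔ x = x' ∧ y = y' := by
  simp [point]

/-- The point `(0, 0)`. -/
def origin (hV : IsCongruentCurve V κ) : V.Point := hV.point 0 0 (by ring)

variable [DecidableEq L]

/-- The slope and the coordinates of the sum are variables tied by polynomial equations, so that
each application can supply simplified expressions. That the sum satisfies the curve equation is
part of the output. -/
theorem point_add_point_eq (hV : IsCongruentCurve V κ) {x y x' y' m x'' y'' : L}
    {h : y ^ 2 = x ^ 3 - κ ^ 2 * x} {h' : y' ^ 2 = x' ^ 3 - κ ^ 2 * x'} (hx : x ≠ x')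
    (hm : m * (x - x') = y - y') (hx'' : x'' = m ^ 2 - x - x')
    (hy'' : y'' = -(m * (x'' - x) + y)) :
    ∃ h'', hV.point x y h + hV.point x' y' h' = hV.point x'' y'' h'' := by
  have hs : V.slope x x' y y' = m := by
    rw [WeierstrassCurve.Affine.slope_of_X_ne hx, div_eq_iff (sub_ne_zero.mpr hx), hm]
  have e : hV.point x y h + hV.point x' y' h' = .some _ _ _ := Point.add_of_X_ne hx
  rw [e]
  have e1 : V.addX x x' (V.slope x x' y y') = x'' := by rw [hs, hV.addX_eq, hx'']
  have e2 : V.addY x x' y (V.slope x x' y y') = y'' := by rw [hs, hV.addY_eq, hy'', hx'']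
  have h2 : V.Nonsingular x'' y'' := by
    rw [← e1, ← e2]
    exact WeierstrassCurve.Affine.nonsingular_add (hV.nonsingular h) (hV.nonsingular h')
      (fun hxy => hx hxy.1)
  refine ⟨hV.eq_of_nonsingular h2, ?_⟩
  rw [point, Point.some.injEq]
  exact ⟨e1, e2⟩

theorem point_add_self_eq (hV : IsCongruentCurve V κ) {x y m x'' y'' : L}
    {h : y ^ 2 = x ^ 3 - κ ^ 2 * x} (hy : y ≠ 0)
    (hm : m * (2 * y) = 3 * x ^ 2 - κ ^ 2) (hx'' : x'' = m ^ 2 - x - x)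
    (hy'' : y'' = -(m * (x'' - x) + y)) :
    ∃ h'', hV.point x y h + hV.point x y h = hV.point x'' y'' h'' := by
  have hy2 : y ≠ V.negY x y := by
    rw [hV.negY_eq]
    intro h
    exact hy (self_eq_neg.mp h)
  have hs : V.slope x x y y = m := by
    rw [WeierstrassCurve.Affine.slope_of_Y_ne rfl hy2, div_eq_iff (sub_ne_zero.mpr hy2), hV.negY_eq,
      hV.a₁, hV.a₂, hV.a₄]
    linear_combination -hm
  have e : hV.point x y h + hV.point x y h = .some _ _ _ := Point.add_self_of_Y_ne hy2
  rw [e]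
  have e1 : V.addX x x (V.slope x x y y) = x'' := by rw [hs, hV.addX_eq, hx'']
  have e2 : V.addY x x y (V.slope x x y y) = y'' := by rw [hs, hV.addY_eq, hy'', hx'']
  have h2 : V.Nonsingular x'' y'' := by
    rw [← e1, ← e2]
    exact WeierstrassCurve.Affine.nonsingular_add (hV.nonsingular h) (hV.nonsingular h)
      (fun hxy => hy2 hxy.2)
  refine ⟨hV.eq_of_nonsingular h2, ?_⟩
  rw [point, Point.some.injEq]
  exact ⟨e1, e2⟩

theorem point_add_self_of_eq_zero (hV : IsCongruentCurve V κ) {x y : L}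
    {h : y ^ 2 = x ^ 3 - κ ^ 2 * x} (hy : y = 0) : hV.point x y h + hV.point x y h = 0 :=
  Point.add_self_of_Y_eq (by rw [hV.negY_eq, hy, neg_zero])

theorem point_add_self_eq_zero_iff (hV : IsCongruentCurve V κ) {x y : L}
    {h : y ^ 2 = x ^ 3 - κ ^ 2 * x} : hV.point x y h + hV.point x y h = 0 ↔ y = 0 := by
  refine ⟨fun h0 => ?_, fun hy => hV.point_add_self_of_eq_zero hy⟩
  by_contra hy
  obtain ⟨h'', e⟩ := hV.point_add_self_eq (h := h) hy
    (m := (3 * x ^ 2 - κ ^ 2) / (2 * y)) (by field_simp) rfl rfl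
  rw [e] at h0
  exact hV.point_ne_zero _ h0

theorem eq_zero_or_of_add_self (hV : IsCongruentCurve V κ) {T : V.Point} (hT : T + T = 0) :
    T = 0 ∨ T = hV.origin ∨ ∃ e h, e ≠ 0 ∧ e ^ 2 = κ ^ 2 ∧ T = hV.point e 0 h := by
  obtain rfl | ⟨x, y, h, rfl⟩ := hV.eq_zero_or_eq_point T
  · exact .inl rfl
  obtain rfl := hV.point_add_self_eq_zero_iff.mp hT
  obtain rfl | rfl | rfl := x_of_two_torsion h
  · exact .inr (.inl rfl)
  · exact .inr (.inr ⟨_, h, hV.ne_zero, rfl, rfl⟩)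
  · exact .inr (.inr ⟨_, h, neg_ne_zero.mpr hV.ne_zero, neg_sq _, rfl⟩)

theorem origin_add_origin (hV : IsCongruentCurve V κ) : hV.origin + hV.origin = 0 :=
  hV.point_add_self_of_eq_zero rfl

theorem point_add_origin (hV : IsCongruentCurve V κ) {x y : L} {h : y ^ 2 = x ^ 3 - κ ^ 2 * x}
    (hx : x ≠ 0) : ∃ h', hV.point x y h + hV.origin = hV.point (-κ ^ 2 / x) (κ ^ 2 * y / x ^ 2) h' := by
  refine hV.point_add_point_eq hx (m := y / x) (by field_simp; ring) ?_ ?_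
  · field_simp
    linear_combination -h
  · field_simp
    ring

theorem point_add_two_torsion (hV : IsCongruentCurve V κ) {x y e : L}
    {h : y ^ 2 = x ^ 3 - κ ^ 2 * x} {he : (0 : L) ^ 2 = e ^ 3 - κ ^ 2 * e} (he2 : e ^ 2 = κ ^ 2)
    (hx : x ≠ e) : ∃ h', hV.point x y h + hV.point e 0 he =
      hV.point (e * (x + e) / (x - e)) (-2 * e ^ 2 * y / (x - e) ^ 2) h' := by
  have hx' := sub_ne_zero.mpr hx
  refine hV.point_add_point_eq hx (m := y / (x - e)) (by field_simp; ring) ?_ ?_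
  · field_simp
    linear_combination -h - x * he2
  · field_simp
    ring

/-- Points can be halved if the differences of `x` with the `x`-coordinates of the points of
order two are squares. -/
theorem exists_add_self_eq_point (hV : IsCongruentCurve V κ) {x y u₀ u₁ u₂ : L}
    {h : y ^ 2 = x ^ 3 - κ ^ 2 * x} (h₀ : u₀ ^ 2 = x) (h₁ : u₁ ^ 2 = x - κ)
    (h₂ : u₂ ^ 2 = x + κ) (hy : u₀ * u₁ * u₂ = y) : ∃ Q, Q + Q = hV.point x y h := by
  have hκ := hV.ne_zero
  have h01 : u₀ + u₁ ≠ 0 := fun h => hκ (by linear_combination h₁ - h₀ + (u₀ - u₁) * h)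
  have h02 : u₀ + u₂ ≠ 0 := fun h => hκ (by linear_combination h₀ - h₂ + (u₂ - u₀) * h)
  have h12 : u₁ + u₂ ≠ 0 := fun h =>
    mul_ne_zero two_ne_zero hκ (by linear_combination h₁ - h₂ + (u₂ - u₁) * h)
  -- The half has x-coordinate X = x + u₀u₁ + u₀u₂ + u₁u₂: then X, X - κ, X + κ are the products of
  -- two of the three sums uᵢ + uⱼ, the product of all three sums is a y-coordinate, and the tangent
  -- has slope u₀ + u₁ + u₂.
  have e0 : x + u₀ * u₁ + u₀ * u₂ + u₁ * u₂ = (u₀ + u₁) * (u₀ + u₂) := by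
    linear_combination -h₀
  have e1 : x + u₀ * u₁ + u₀ * u₂ + u₁ * u₂ - κ = (u₀ + u₁) * (u₁ + u₂) := by
    linear_combination -h₁
  have e2 : x + u₀ * u₁ + u₀ * u₂ + u₁ * u₂ + κ = (u₀ + u₂) * (u₁ + u₂) := by
    linear_combination -h₂
  set X := x + u₀ * u₁ + u₀ * u₂ + u₁ * u₂ with hX
  have hQ : ((u₀ + u₁) * (u₀ + u₂) * (u₁ + u₂)) ^ 2 = X ^ 3 - κ ^ 2 * X := by
    have : X ^ 3 - κ ^ 2 * X = X * (X - κ) * (X + κ) := by ring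
    rw [this, e1, e2, e0]; ring
  obtain ⟨h', e⟩ := hV.point_add_self_eq (h := hQ) (mul_ne_zero (mul_ne_zero h01 h02) h12)
    (m := u₀ + u₁ + u₂) (x'' := x) (y'' := y) (by
      have : 3 * X ^ 2 - κ ^ 2 = X * (X - κ) + X * (X + κ) + (X - κ) * (X + κ) := by ring
      rw [this, e1, e2, e0]; ring)
    (by rw [hX]; linear_combination -h₀ - h₁ - h₂) (by rw [hX, ← hy]; ring)
  exact ⟨_, e⟩

theorem exists_add_self_eq [IsAlgClosed L] (hV : IsCongruentCurve V κ) (P : V.Point) :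
    ∃ Q, Q + Q = P := by
  obtain rfl | ⟨x, y, h, rfl⟩ := hV.eq_zero_or_eq_point P
  · exact ⟨0, add_zero 0⟩
  obtain ⟨u₀, h₀⟩ := IsAlgClosed.exists_pow_nat_eq x (n := 2) (by norm_num)
  obtain ⟨u₁, h₁⟩ := IsAlgClosed.exists_pow_nat_eq (x - κ) (n := 2) (by norm_num)
  obtain ⟨u₂, h₂⟩ := IsAlgClosed.exists_pow_nat_eq (x + κ) (n := 2) (by norm_num)
  have hsq : (u₀ * u₁ * u₂) ^ 2 = y ^ 2 := by
    rw [mul_pow, mul_pow, h₀, h₁, h₂, h]; ring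
  rcases sq_eq_sq_iff_eq_or_eq_neg.mp hsq with hy | hy
  · exact hV.exists_add_self_eq_point h₀ h₁ h₂ hy
  · exact hV.exists_add_self_eq_point (u₀ := -u₀) (by rw [neg_sq, h₀]) h₁ h₂
      (by linear_combination -hy)

end

/-! ### Pairing with (0,0), and square roots attached to a doubled point -/

section

variable {L : Type*} [Field L] {V : WeierstrassCurve.Affine L}

open scoped Classical in
/-- The pairing of a point of order two with `(0, 0)`: it is `1` on the multiples of `(0, 0)` and
`-1` on the other points of order two. -/
noncomputable def pairing : V.Point → ℤ
  | .zero => 1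
  | .some x _ _ => if x = 0 then 1 else -1

theorem pairing_zero : pairing (0 : V.Point) = 1 := rfl

theorem pairing_mul_self (P : V.Point) : pairing P * pairing P = 1 := by
  rcases P with _ | ⟨x, y, h⟩
  · rfl
  · simp only [pairing]
    split_ifs <;> norm_num

variable {κ : L} [CharZero L]

theorem pairing_point (hV : IsCongruentCurve V κ) {x y : L} {h : y ^ 2 = x ^ 3 - κ ^ 2 * x}
    (hx : x ≠ 0) : pairing (hV.point x y h) = -1 := by
  simp [pairing, point, hx]

theorem pairing_origin (hV : IsCongruentCurve V κ) : pairing hV.origin = 1 := by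
  simp [pairing, origin, point]

/-- With x₂ the x-coordinate of the double, (x² + κ²)/(2y) is a square root of x₂ and (x² ∓ 2κx -
κ²)/(2y) are square roots of x₂ ∓ κ. The left-hand base is the product of the last two, so the
identity says (x₂ - κ)(x₂ + κ) = x₂² - κ². -/
theorem product_sq_eq {x y : L} (h : y ^ 2 = x ^ 3 - κ ^ 2 * x) (hy : y ≠ 0) :
    (((x ^ 2 - κ ^ 2) ^ 2 - 4 * κ ^ 2 * x ^ 2) / (4 * y ^ 2)) ^ 2 =
      ((x ^ 2 + κ ^ 2) / (2 * y)) ^ 4 - κ ^ 2 := by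
  field_simp
  linear_combination 256 * κ ^ 2 * (y ^ 2 + x ^ 3 - κ ^ 2 * x) * h

variable [DecidableEq L]

theorem eq_zero_or_origin_of_pairing (hV : IsCongruentCurve V κ) {T : V.Point}
    (hT : T + T = 0) (h1 : pairing T = 1) : T = 0 ∨ T = hV.origin := by
  obtain h | h | ⟨e, h, he, -, rfl⟩ := hV.eq_zero_or_of_add_self hT
  · exact .inl h
  · exact .inr h
  · rw [hV.pairing_point he] at h1
    norm_num at h1

theorem pairing_add_point (hV : IsCongruentCurve V κ) {T : V.Point} (hT : T + T = 0) {e : L}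
    {he : (0 : L) ^ 2 = e ^ 3 - κ ^ 2 * e} (he0 : e ≠ 0) (he2 : e ^ 2 = κ ^ 2) :
    pairing (T + hV.point e 0 he) = -pairing T := by
  obtain rfl | rfl | ⟨x, h, hx0, hx2, rfl⟩ := hV.eq_zero_or_of_add_self hT
  · rw [zero_add, hV.pairing_point he0, pairing_zero]
  · obtain ⟨h', h''⟩ := hV.point_add_two_torsion (x := 0) (y := 0) (h := by ring) (he := he) he2 he0.symm
    rw [origin, h'', hV.pairing_point (by simp [he0]), ← origin, hV.pairing_origin]
  · rw [hV.pairing_point hx0]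
    by_cases hxe : x = e
    · subst hxe
      rw [hT, pairing_zero]; norm_num
    · obtain ⟨h', h''⟩ := hV.point_add_two_torsion (h := h) (he := he) he2 hxe
      have : x = -e := (sq_eq_sq_iff_eq_or_eq_neg.mp (hx2.trans he2.symm)).resolve_left hxe
      rw [h'']
      simp [pairing, point, this]

theorem pairing_add_origin (hV : IsCongruentCurve V κ) {T : V.Point} (hT : T + T = 0) :
    pairing (T + hV.origin) = pairing T := by
  obtain rfl | rfl | ⟨x, h, hx0, hx2, rfl⟩ := hV.eq_zero_or_of_add_self hT
  · rw [zero_add, hV.pairing_origin, pairing_zero]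
  · rw [hV.origin_add_origin, hV.pairing_origin, pairing_zero]
  · obtain ⟨h', h''⟩ := hV.point_add_origin (h := h) hx0
    rw [h'', hV.pairing_point hx0, hV.pairing_point]
    exact div_ne_zero (neg_ne_zero.mpr (pow_ne_zero 2 hV.ne_zero)) hx0

theorem pairing_add (hV : IsCongruentCurve V κ) {T T' : V.Point} (hT : T + T = 0)
    (hT' : T' + T' = 0) : pairing (T + T') = pairing T * pairing T' := by
  obtain rfl | rfl | ⟨x, h, hx0, hx2, rfl⟩ := hV.eq_zero_or_of_add_self hT'
  · rw [add_zero, pairing_zero, mul_one]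
  · rw [hV.pairing_add_origin hT, hV.pairing_origin, mul_one]
  · rw [hV.pairing_add_point hT hx0 hx2, hV.pairing_point hx0]; ring

/-- For a point `(x, y)` which is not of order two, `(x ^ 2 + κ ^ 2) / (2 y)` is a square root of
the `x`-coordinate of the double of the point. Translations by points of order two change its sign
according to the pairing, and do the same to the product of the other two square roots. -/
theorem exists_point_add_eq (hV : IsCongruentCurve V κ) {x y : L}
    {h : y ^ 2 = x ^ 3 - κ ^ 2 * x} (hy : y ≠ 0) {T : V.Point} (hT : T + T = 0) :
    ∃ x' y' h', hV.point x y h + T = hV.point x' y' h' ∧ y' ≠ 0 ∧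
      (x' ^ 2 + κ ^ 2) / (2 * y') = pairing T * ((x ^ 2 + κ ^ 2) / (2 * y)) ∧
      ((x' ^ 2 - κ ^ 2) ^ 2 - 4 * κ ^ 2 * x' ^ 2) / (4 * y' ^ 2) =
        pairing T * (((x ^ 2 - κ ^ 2) ^ 2 - 4 * κ ^ 2 * x ^ 2) / (4 * y ^ 2)) := by
  have hκ := hV.ne_zero
  have hx : x ≠ 0 := by
    rintro rfl
    exact hy (by simpa using h)
  obtain rfl | rfl | ⟨e, he, he0, he2, rfl⟩ := hV.eq_zero_or_of_add_self hT
  · exact ⟨x, y, h, add_zero _, hy, by simp [pairing_zero], by simp [pairing_zero]⟩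
  · obtain ⟨h', h''⟩ := hV.point_add_origin (h := h) hx
    refine ⟨_, _, h', h'', by positivity, ?_, ?_⟩
    · rw [hV.pairing_origin]
      field_simp
      push_cast
      ring
    · rw [hV.pairing_origin]
      field_simp
      push_cast
      ring
  · have hxe : x ≠ e := by
      rintro rfl
      exact hy (by rw [← he] at h; simpa using h)
    have hxe' := sub_ne_zero.mpr hxe
    obtain ⟨h', h''⟩ := hV.point_add_two_torsion (h := h) (he := he) he2 hxe
    rw [hV.pairing_point he0]
    refine ⟨_, _, h', h'', div_ne_zero (mul_ne_zero (mul_ne_zero (by norm_num)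
      (pow_ne_zero 2 he0)) hy) (pow_ne_zero 2 hxe'), ?_, ?_⟩
    · rw [← he2]
      push_cast
      field_simp
      ring
    · rw [← he2]
      push_cast
      field_simp
      ring

theorem sq_eq_of_add_self (hV : IsCongruentCurve V κ) {x y x₂ y₂ : L}
    {h : y ^ 2 = x ^ 3 - κ ^ 2 * x} {h₂ : y₂ ^ 2 = x₂ ^ 3 - κ ^ 2 * x₂}
    (e : hV.point x y h + hV.point x y h = hV.point x₂ y₂ h₂) :
    y ≠ 0 ∧ ((x ^ 2 + κ ^ 2) / (2 * y)) ^ 2 = x₂ := by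
  have hy : y ≠ 0 := by
    intro hy
    rw [hV.point_add_self_of_eq_zero hy] at e
    exact hV.point_ne_zero _ e.symm
  refine ⟨hy, ?_⟩
  obtain ⟨h'', e'⟩ := hV.point_add_self_eq (h := h) hy
    (m := (3 * x ^ 2 - κ ^ 2) / (2 * y)) (by field_simp) rfl rfl
  rw [e', hV.point_inj] at e
  rw [← e.1]
  field_simp
  linear_combination 8 * x * h

end

end IsCongruentCurve

/-! ### Galois actions, quadratic characters and square roots -/

section Galois

variable {K : Type} [Field K]

theorem mem_range_algebraMap_of_fixed [CharZero K] {x : AlgebraicClosure K}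
    (h : ∀ σ : AbsGal K, σ x = x) : ∃ a : K, algebraMap K (AlgebraicClosure K) a = x :=
  (InfiniteGalois.mem_range_algebraMap_iff_fixed x).mpr h

/-- A locally constant quadratic character of the absolute Galois group belongs to the square root
of an element of the field. -/
theorem exists_sqrt_of_character [CharZero K] {f : AbsGal K → ℤ} (hf : IsLocallyConstant f)
    (hmul : ∀ σ τ, f (σ * τ) = f σ * f τ) (hsq : ∀ σ, f σ * f σ = 1) :
    ∃ (α : AlgebraicClosure K) (a : Kˣ), α ≠ 0 ∧
      α ^ 2 = algebraMap K (AlgebraicClosure K) a ∧ ∀ σ : AbsGal K, σ α = f σ * α := by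
  suffices h : ∃ α : AlgebraicClosure K, α ≠ 0 ∧ ∀ σ : AbsGal K, σ α = f σ * α by
    obtain ⟨α, hα, h⟩ := h
    obtain ⟨a, ha⟩ := mem_range_algebraMap_of_fixed (x := α ^ 2) (fun σ => by
      rw [map_pow, h, mul_pow, pow_two (f σ : AlgebraicClosure K)]
      rw [show ((f σ : AlgebraicClosure K) * f σ) = ((f σ * f σ : ℤ) : AlgebraicClosure K) by
        push_cast; ring, hsq]
      simp)
    have ha0 : a ≠ 0 := by
      rintro rfl
      rw [map_zero] at ha
      exact pow_ne_zero 2 hα ha.symm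
    exact ⟨α, Units.mk0 a ha0, hα, ha.symm, h⟩
  have h1 : f 1 = 1 := by
    have e1 := hmul 1 1
    rw [mul_one, hsq] at e1
    exact e1
  by_cases htriv : ∀ σ, f σ = 1
  · exact ⟨1, one_ne_zero, fun σ => by simp [htriv]⟩
  push Not at htriv
  obtain ⟨τ, hτ⟩ := htriv
  have hpm : ∀ σ, f σ = 1 ∨ f σ = -1 := fun σ => mul_self_eq_one_iff.mp (hsq σ)
  have hτ' : f τ = -1 := (hpm τ).resolve_left hτ
  -- The kernel of the character is closed, so by the Galois correspondence some x fixed by it is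
  -- moved by τ. Then x has only the conjugates x and τx, and their difference transforms by the
  -- character.
  let H : ClosedSubgroup (AbsGal K) :=
    { carrier := {σ | f σ = 1}
      mul_mem' := fun {a b} ha hb => by
        rw [Set.mem_ofPred_eq] at *
        rw [hmul, ha, hb, one_mul]
      one_mem' := h1
      inv_mem' := fun {a} ha => by
        rw [Set.mem_ofPred_eq] at *
        have := hmul a a⁻¹
        rw [mul_inv_cancel, h1, ha, one_mul] at this
        exact this.symm
      isClosed' := hf.isClosed_fiber 1 }
  have hH : ∀ σ, σ ∈ H.toSubgroup ↔ f σ = 1 := fun σ => Iff.rfl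
  have hfix := InfiniteGalois.fixingSubgroup_fixedField H
  have hτH : τ ∉ (IntermediateField.fixedField H.toSubgroup).fixingSubgroup := by
    rw [hfix, hH, hτ']
    norm_num
  rw [IntermediateField.mem_fixingSubgroup_iff] at hτH
  push Not at hτH
  obtain ⟨x, hx, hxτ⟩ := hτH
  rw [IntermediateField.mem_fixedField_iff] at hx
  have hfx : ∀ σ τ : AbsGal K, f σ = f τ → σ x = τ x := by
    intro σ τ h
    have : (τ⁻¹ * σ) x = x := hx _ (by
      rw [hH, hmul, h]
      have := hmul τ⁻¹ τ
      rw [inv_mul_cancel, h1] at this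
      exact this.symm)
    rw [AlgEquiv.mul_apply] at this
    have h2 := congrArg τ this
    rwa [← AlgEquiv.mul_apply, mul_inv_cancel, AlgEquiv.one_apply] at h2
  refine ⟨x - τ x, sub_ne_zero.mpr (Ne.symm hxτ), fun σ => ?_⟩
  rw [map_sub, ← AlgEquiv.mul_apply]
  rcases hpm σ with h | h
  · rw [hfx σ 1 (by rw [h, h1]), hfx (σ * τ) τ (by rw [hmul, h, one_mul]), h]
    simp
  · rw [hfx σ τ (by rw [h, hτ']), hfx (σ * τ) 1 (by rw [hmul, h, hτ', h1]; norm_num), h]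
    simp

variable {F : Type} [Field F] [Algebra K F]

/-- Automorphisms of `F̄` over `F` restrict to `K̄`. -/
theorem exists_restriction (ι : AlgebraicClosure K →ₐ[K] AlgebraicClosure F) (τ : AbsGal F) :
    ∃ σ : AbsGal K, ∀ x, ι (σ x) = τ (ι x) := by
  let : Algebra (AlgebraicClosure K) (AlgebraicClosure F) := ι.toRingHom.toAlgebra
  have : IsScalarTower K (AlgebraicClosure K) (AlgebraicClosure F) :=
    IsScalarTower.of_algebraMap_eq' ι.comp_algebraMap.symm
  let τ' : AlgebraicClosure F ≃ₐ[K] AlgebraicClosure F := τ.restrictScalars K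
  exact ⟨τ'.restrictNormal (AlgebraicClosure K), fun x => τ'.restrictNormal_commutes _ x⟩

theorem isLocallyConstant_of_forall_mul {G X : Type*} [Group G] [TopologicalSpace G]
    [IsTopologicalGroup G] {f : G → X} {U : Set G} (hU : IsOpen U) (h1 : (1 : G) ∈ U)
    (h : ∀ σ, ∀ τ ∈ U, f (σ * τ) = f σ) : IsLocallyConstant f := by
  rw [IsLocallyConstant.iff_exists_open]
  intro σ
  refine ⟨(fun x => σ⁻¹ * x) ⁻¹' U, hU.preimage (continuous_const_mul _), by simpa using h1, ?_⟩
  intro x hx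
  have := h σ _ hx
  rwa [mul_inv_cancel_left] at this

theorem isOpen_fixing (x : AlgebraicClosure K) : IsOpen {σ : AbsGal K | σ x = x} :=
  stabilizer_isOpen_of_isIntegral x

end Galois

/-! ### Galois actions on points -/

section Points

open IsCongruentCurve

variable {K : Type} [Field K] {W : WeierstrassCurve K} {κ : K}
  {F : Type} [Field F] [Algebra K F]

theorem IsCongruentCurve.baseChange (hW : IsCongruentCurve W.toAffine κ) (L : Type) [Field L]
    [Algebra K L] : IsCongruentCurve (W.toAffine.baseChange L) (algebraMap K L κ) where
  a₁ := (congrArg (algebraMap K L) hW.a₁).trans (map_zero _)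
  a₂ := (congrArg (algebraMap K L) hW.a₂).trans (map_zero _)
  a₃ := (congrArg (algebraMap K L) hW.a₃).trans (map_zero _)
  a₄ := (congrArg (algebraMap K L) hW.a₄).trans (by rw [map_neg, map_pow])
  a₆ := (congrArg (algebraMap K L) hW.a₆).trans (map_zero _)
  ne_zero := by
    rw [Ne, map_eq_zero]
    exact hW.ne_zero

/-- The base change of the curve to the algebraic closure of `F`. -/
theorem IsCongruentCurve.geom (hW : IsCongruentCurve W.toAffine κ) (F : Type) [Field F]
    [Algebra K F] : IsCongruentCurve (W.toAffine.baseChange (AlgebraicClosure F))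
      (algebraMap K (AlgebraicClosure F) κ) := hW.baseChange _

theorem galAct_mul (σ τ : AbsGal F) (P : GeomPoint W F) :
    galAct W (σ * τ) P = galAct W σ (galAct W τ P) := by
  rcases P with _ | ⟨x, y, h⟩ <;> rfl

theorem embPoint_galAct (ι : AlgebraicClosure K →ₐ[K] AlgebraicClosure F) {σ : AbsGal K}
    {τ : AbsGal F} (h : ∀ x, ι (σ x) = τ (ι x)) (P : GeomPoint W K) :
    embPoint W ι (galAct W σ P) = galAct W τ (embPoint W ι P) := by
  rcases P with _ | ⟨x, y, hP⟩
  · rfl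
  · exact (WeierstrassCurve.Affine.Point.some.injEq ..).mpr ⟨h x, h y⟩

theorem pairing_embPoint (ι : AlgebraicClosure K →ₐ[K] AlgebraicClosure F) (P : GeomPoint W K) :
    pairing (embPoint W ι P) = pairing P := by
  rcases P with _ | ⟨x, y, hP⟩
  · rfl
  · have : embPoint W ι (.some x y hP) = .some (ι x) (ι y)
        ((W.toAffine.baseChange_nonsingular ι.injective ..).mpr hP) := rfl
    rw [this]
    simp only [pairing, map_eq_zero]

theorem algEquiv_algebraMap (τ : AbsGal F) (a : K) :
    τ (algebraMap K (AlgebraicClosure F) a) = algebraMap K (AlgebraicClosure F) a := by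
  rw [IsScalarTower.algebraMap_apply K F (AlgebraicClosure F), AlgEquiv.commutes]

theorem isOpen_galAct_eq (P : GeomPoint W F) : ∃ U : Set (AbsGal F), IsOpen U ∧ 1 ∈ U ∧
    ∀ τ ∈ U, galAct W τ P = P := by
  rcases P with _ | ⟨x, y, h⟩
  · exact ⟨Set.univ, isOpen_univ, trivial, fun τ _ => rfl⟩
  · refine ⟨_, (isOpen_fixing x).inter (isOpen_fixing y), ⟨rfl, rfl⟩, fun τ hτ => ?_⟩
    exact (WeierstrassCurve.Affine.Point.some.injEq ..).mpr hτ

variable [CharZero F]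

theorem IsCongruentCurve.galAct_point (hW : IsCongruentCurve W.toAffine κ) (τ : AbsGal F)
    {x y : AlgebraicClosure F} (h) : ∃ h', galAct W τ ((hW.geom F).point x y h) =
      (hW.geom F).point (τ x) (τ y) h' :=
  ⟨(hW.geom F).eq_of_nonsingular
    ((W.toAffine.baseChange_nonsingular τ.toAlgHom.injective ..).mpr
      ((hW.geom F).nonsingular h)), rfl⟩

/-- All 2-torsion is rational: the x-coordinates are 0 and ±κ. Hence 2-torsion-valued cocycles are
homomorphisms. -/
theorem IsCongruentCurve.galAct_of_add_self (hW : IsCongruentCurve W.toAffine κ) (τ : AbsGal F)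
    {T : GeomPoint W F} (hT : T + T = 0) : galAct W τ T = T := by
  have key : ∀ e h, τ e = e → galAct W τ ((hW.geom F).point e 0 h) = (hW.geom F).point e 0 h := by
    intro e h he
    obtain ⟨h', e1⟩ := hW.galAct_point τ h
    rw [e1, (hW.geom F).point_inj]
    exact ⟨he, map_zero τ⟩
  obtain rfl | rfl | ⟨e, h, he0, he2, rfl⟩ := (hW.geom F).eq_zero_or_of_add_self hT
  · exact map_zero _
  · exact key _ _ (map_zero τ)
  · refine key _ _ ?_
    rcases sq_eq_sq_iff_eq_or_eq_neg.mp he2 with rfl | rfl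
    · exact algEquiv_algebraMap τ κ
    · rw [map_neg, algEquiv_algebraMap]

theorem IsCongruentCurve.galAct_origin (hW : IsCongruentCurve W.toAffine κ) (τ : AbsGal F) :
    galAct W τ (hW.geom F).origin = (hW.geom F).origin :=
  hW.galAct_of_add_self τ (hW.geom F).origin_add_origin

theorem IsCongruentCurve.embPoint_origin [CharZero K] (hW : IsCongruentCurve W.toAffine κ)
    (ι : AlgebraicClosure K →ₐ[K] AlgebraicClosure F) :
    embPoint W ι (hW.geom K).origin = (hW.geom F).origin :=
  (WeierstrassCurve.Affine.Point.some.injEq ..).mpr ⟨map_zero ι, map_zero ι⟩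

end Points

/-! ### Coboundaries of points -/

section Cochains

variable {K : Type} [Field K] {W : WeierstrassCurve K}

/-- The coboundary of a point. -/
noncomputable def coboundary (P : GeomPoint W K) : AbsGal K → GeomPoint W K :=
  fun σ => galAct W σ P - P

theorem coboundary_mem_coboundaries (P : GeomPoint W K) : coboundary P ∈ coboundaries W :=
  ⟨P, fun _ => rfl⟩

theorem coboundary_mem_cocycles [CharZero K] (P : GeomPoint W K) :
    coboundary P ∈ cocycles W := by
  refine ⟨?_, fun σ τ => ?_⟩
  · obtain ⟨U, hU, h1, h⟩ := isOpen_galAct_eq P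
    refine isLocallyConstant_of_forall_mul hU h1 fun σ τ hτ => ?_
    rw [coboundary, coboundary, galAct_mul, h τ hτ]
  · simp only [coboundary, galAct_mul, map_sub]
    abel

theorem coboundary_mem_locallyTrivial (F : Type) [Field F] [Algebra K F] (P : GeomPoint W K) :
    coboundary P ∈ locallyTrivial W F := by
  intro ι
  refine ⟨embPoint W ι P, fun τ σ h => ?_⟩
  rw [coboundary, map_sub, embPoint_galAct ι h]

end Cochains

open IsCongruentCurve

/-! ### Cocycles with values in the kernel of the isogeny -/

section

variable {K : Type} [Field K] {W : WeierstrassCurve K} {κ : K}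

theorem map_eq_or_eq_neg {F : Type} [Field F] {a : F} {γ : AlgebraicClosure F}
    (h : γ ^ 2 = algebraMap F (AlgebraicClosure F) a) (τ : AbsGal F) : τ γ = γ ∨ τ γ = -γ := by
  apply sq_eq_sq_iff_eq_or_eq_neg.mp
  rw [← map_pow, h, AlgEquiv.commutes]

theorem isSquare_of_fixed {F : Type} [Field F] [CharZero F] {a : F} {γ : AlgebraicClosure F}
    (h : γ ^ 2 = algebraMap F (AlgebraicClosure F) a) (hfix : ∀ τ : AbsGal F, τ γ = γ) :
    ∃ b, a = b ^ 2 := by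
  obtain ⟨b, rfl⟩ := mem_range_algebraMap_of_fixed hfix
  exact ⟨b, (algebraMap F (AlgebraicClosure F)).injective (by rw [← h, map_pow])⟩

theorem origin_ne_zero {L : Type*} [Field L] [CharZero L] {V : WeierstrassCurve.Affine L} {κ : L}
    (hV : IsCongruentCurve V κ) : hV.origin ≠ 0 := hV.point_ne_zero _

variable (hW : IsCongruentCurve W.toAffine κ) {F : Type} [Field F] [CharZero F] [Algebra K F]

open scoped Classical in
/-- If the quadratic character of `γ = √a` with values in `{O, (0, 0)}` is a coboundary over `F`,
then the torsor of `a` has a point over `F`. -/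
theorem torsorHasPoint_of_coboundary {a : F} (ha : a ≠ 0) {γ : AlgebraicClosure F}
    (hγ : γ ^ 2 = algebraMap F (AlgebraicClosure F) a) {P : GeomPoint W F}
    (h : ∀ τ : AbsGal F, galAct W τ P - P = if τ γ = γ then 0 else (hW.geom F).origin) :
    TorsorHasPoint a (4 * algebraMap K F κ ^ 2 / a) := by
  have hγ0 : γ ≠ 0 := by
    rintro rfl
    apply ha
    rw [zero_pow two_ne_zero, ← map_zero (algebraMap F (AlgebraicClosure F))] at hγ
    exact ((algebraMap F (AlgebraicClosure F)).injective hγ).symm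
  -- A rational P, in particular O or (0,0), makes the character trivial, and then a is a square.
  have hfix : (∀ τ : AbsGal F, galAct W τ P = P) → TorsorHasPoint a (4 * algebraMap K F κ ^ 2 / a) := by
    intro hP
    obtain ⟨b, hb⟩ := isSquare_of_fixed hγ fun τ => by
      by_contra hτ
      have := h τ
      rw [hP, sub_self, if_neg hτ] at this
      exact origin_ne_zero _ this.symm
    exact torsorHasPoint_of_eq_sq _ hb
  obtain rfl | ⟨x, y, hP, rfl⟩ := (hW.geom F).eq_zero_or_eq_point P
  · exact hfix fun τ => map_zero _
  by_cases hx : x = 0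
  · subst hx
    have hy : y = 0 := by simpa using hP
    subst hy
    exact hfix fun τ => hW.galAct_origin τ
  obtain ⟨h', e'⟩ := (hW.geom F).point_add_origin (h := hP) hx
  have hκ := (hW.geom F).ne_zero
  set κ' := algebraMap K (AlgebraicClosure F) κ with hκ'
  -- Translation by (0,0) changes the sign of y/x and of x + κ²/x, just as τ does with γ. The two
  -- quotients are therefore the coordinates M and N, by (x + κ²/x)² = (x - κ²/x)² + 4κ².
  have key : ∀ τ : AbsGal F, τ (y / x / γ) = y / x / γ ∧
      τ ((x + κ' ^ 2 / x) / γ) = (x + κ' ^ 2 / x) / γ := by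
    intro τ
    have hτκ : τ κ' = κ' := algEquiv_algebraMap τ κ
    obtain ⟨h1, e1⟩ := hW.galAct_point τ hP
    have hτ := h τ
    rw [sub_eq_iff_eq_add, e1] at hτ
    by_cases hg : τ γ = γ
    · rw [if_pos hg, zero_add, (hW.geom F).point_inj] at hτ
      simp only [map_div₀, map_add, map_pow, hg, hτ.1, hτ.2, hτκ, and_self]
    · have hg' := (map_eq_or_eq_neg hγ τ).resolve_left hg
      rw [if_neg hg, add_comm, e', (hW.geom F).point_inj, ← hκ'] at hτ
      simp only [map_div₀, map_add, map_pow, hg', hτ.1, hτ.2, hτκ]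
      constructor
      · field_simp
      · field_simp
        ring
  obtain ⟨s, hs⟩ := mem_range_algebraMap_of_fixed fun τ => (key τ).1
  obtain ⟨n, hn⟩ := mem_range_algebraMap_of_fixed fun τ => (key τ).2
  refine ⟨n, s, 1, by simp, ?_⟩
  apply (algebraMap F (AlgebraicClosure F)).injective
  have hκF : algebraMap F (AlgebraicClosure F) (algebraMap K F κ) = κ' :=
    (IsScalarTower.algebraMap_apply K F (AlgebraicClosure F) κ).symm
  simp only [map_pow, map_add, map_mul, map_div₀, map_one, map_ofNat, hκF, hs, hn, ← hγ]
  field_simp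
  have hγ4 : y ^ 4 = (x ^ 3 - κ' ^ 2 * x) ^ 2 := by rw [← hP]; ring
  rw [hγ4]
  ring

end

section

variable {K : Type} [Field K] [CharZero K] {W : WeierstrassCurve K} {κ : K}

open scoped Classical in
/-- The cocycle with values in `{O, (0, 0)}` which belongs to the square root `β`. -/
noncomputable def sqrtCocycle (hW : IsCongruentCurve W.toAffine κ) (β : AlgebraicClosure K) :
    AbsGal K → GeomPoint W K :=
  fun σ => if σ β = β then 0 else (hW.geom K).origin

variable (hW : IsCongruentCurve W.toAffine κ)

theorem sqrtCocycle_mem_cocycles {β : AlgebraicClosure K} {a : K} (hβ0 : β ≠ 0)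
    (hβ : β ^ 2 = algebraMap K (AlgebraicClosure K) a) : sqrtCocycle hW β ∈ cocycles W := by
  refine ⟨isLocallyConstant_of_forall_mul (isOpen_fixing β) rfl fun σ τ hτ => ?_, fun σ τ => ?_⟩
  · have : τ β = β := hτ
    simp [sqrtCocycle, AlgEquiv.mul_apply, this]
  · have hn : -β ≠ β := fun h => hβ0 (self_eq_neg.mp h.symm)
    have hn' : β ≠ -β := hn.symm
    rcases map_eq_or_eq_neg hβ σ with hσ | hσ <;> rcases map_eq_or_eq_neg hβ τ with hτ | hτ <;>
      simp [sqrtCocycle, AlgEquiv.mul_apply, hσ, hτ, hn, hW.galAct_origin,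
        (hW.geom K).origin_add_origin]

theorem sqrtCocycle_algebraMap_mul {β : AlgebraicClosure K} {t : K} (ht : t ≠ 0) :
    sqrtCocycle hW (algebraMap K (AlgebraicClosure K) t * β) = sqrtCocycle hW β := by
  funext σ
  have : algebraMap K (AlgebraicClosure K) t ≠ 0 := by simpa using ht
  simp [sqrtCocycle, this]

theorem sqrtCocycle_eq_of_sq_eq {β β' : AlgebraicClosure K} (h : β ^ 2 = β' ^ 2) :
    sqrtCocycle hW β = sqrtCocycle hW β' := by
  rcases sq_eq_sq_iff_eq_or_eq_neg.mp h with rfl | rfl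
  · rfl
  · funext σ
    simp [sqrtCocycle]

theorem sqrtCocycle_add_self (β : AlgebraicClosure K) :
    sqrtCocycle hW β + sqrtCocycle hW β = 0 := by
  funext σ
  by_cases h : σ β = β <;> simp [sqrtCocycle, h, (hW.geom K).origin_add_origin]

theorem sqrtCocycle_mul {β β' : AlgebraicClosure K} {a a' : K} (hβ0 : β ≠ 0) (hβ0' : β' ≠ 0)
    (hβ : β ^ 2 = algebraMap K (AlgebraicClosure K) a)
    (hβ' : β' ^ 2 = algebraMap K (AlgebraicClosure K) a') :
    sqrtCocycle hW (β * β') = sqrtCocycle hW β + sqrtCocycle hW β' := by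
  funext σ
  have hn : -β ≠ β := fun h => hβ0 (self_eq_neg.mp h.symm)
  have hn' : -β' ≠ β' := fun h => hβ0' (self_eq_neg.mp h.symm)
  have hn2 : -(β * β') ≠ β * β' := fun h => mul_ne_zero hβ0 hβ0' (self_eq_neg.mp h.symm)
  rcases map_eq_or_eq_neg hβ σ with h | h <;> rcases map_eq_or_eq_neg hβ' σ with h' | h' <;>
    simp [sqrtCocycle, h, h', hn, hn', hn2, (hW.geom K).origin_add_origin]

variable {F : Type} [Field F] [CharZero F] [Algebra K F]

theorem torsorHasPoint_of_mem_locallyTrivial {β : AlgebraicClosure K} {a : K} (ha : a ≠ 0)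
    (hβ : β ^ 2 = algebraMap K (AlgebraicClosure K) a)
    (h : sqrtCocycle hW β ∈ locallyTrivial W F) :
    TorsorHasPoint (algebraMap K F a) (algebraMap K F (4 * κ ^ 2) / algebraMap K F a) := by
  classical
  let ι : AlgebraicClosure K →ₐ[K] AlgebraicClosure F := IsAlgClosed.lift
  have hinj : Function.Injective ι := RingHom.injective ι.toRingHom
  obtain ⟨P, hP⟩ := h ι
  rw [map_mul, map_pow, map_ofNat]
  refine torsorHasPoint_of_coboundary hW (by simpa using ha) (γ := ι β) (P := P) ?_ fun τ => ?_
  · rw [← map_pow, hβ, AlgHom.commutes, IsScalarTower.algebraMap_apply K F (AlgebraicClosure F)]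
  · obtain ⟨σ, hσ⟩ := exists_restriction ι τ
    rw [← hP τ σ hσ, ← hσ, sqrtCocycle]
    by_cases hσβ : σ β = β
    · rw [if_pos hσβ, if_pos (by rw [hσβ]), map_zero]
    · rw [if_neg hσβ, if_neg (fun h => hσβ (hinj h)), hW.embPoint_origin]

theorem torsorHasPoint_of_mem_coboundaries {β : AlgebraicClosure K} {a : K} (ha : a ≠ 0)
    (hβ : β ^ 2 = algebraMap K (AlgebraicClosure K) a)
    (h : sqrtCocycle hW β ∈ coboundaries W) : TorsorHasPoint a (4 * κ ^ 2 / a) := by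
  classical
  obtain ⟨P, hP⟩ := h
  have := torsorHasPoint_of_coboundary (F := K) hW ha hβ (P := P) fun τ => (hP τ).symm
  simpa using this

/-- The construction of `torsorHasPoint_of_coboundary` is inverted: from M, N one recovers y/x and x
+ κ²/x as multiples of √a, hence a point P whose conjugates are P and P + (0,0). -/
theorem sqrtCocycle_mem_locallyTrivial {β : AlgebraicClosure K} {a : K} (ha : a ≠ 0)
    (hβ : β ^ 2 = algebraMap K (AlgebraicClosure K) a)
    (h : TorsorHasPoint (algebraMap K F a) (algebraMap K F (4 * κ ^ 2) / algebraMap K F a)) :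
    sqrtCocycle hW β ∈ locallyTrivial W F := by
  intro ι
  have hinj : Function.Injective ι := RingHom.injective ι.toRingHom
  obtain ⟨N, M, e, h0, h⟩ := h
  have haF : algebraMap K F a ≠ 0 := by simpa using ha
  have hγ : (ι β) ^ 2 = algebraMap F (AlgebraicClosure F) (algebraMap K F a) := by
    rw [← map_pow, hβ, AlgHom.commutes, IsScalarTower.algebraMap_apply K F (AlgebraicClosure F)]
  have haL : algebraMap F (AlgebraicClosure F) (algebraMap K F a) ≠ 0 := by simpa using ha
  have hγ0 : ι β ≠ 0 := fun h0 => haL (by rw [← hγ, h0]; simp)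
  -- A point with e = 0 makes a a square in F, so the restricted cocycle vanishes.
  by_cases he : e = 0
  · subst he
    have hM : M ≠ 0 := by
      rintro rfl
      exact h0 ⟨by simpa using h, rfl, rfl⟩
    have hsq : (ι β) ^ 2 = (algebraMap F (AlgebraicClosure F) (N / M ^ 2)) ^ 2 := by
      rw [hγ, ← map_pow, div_pow, h]
      congr 1
      field_simp
      ring
    have hfix : ∀ τ : AbsGal F, τ (ι β) = ι β := by
      intro τ
      rcases sq_eq_sq_iff_eq_or_eq_neg.mp hsq with h | h <;> rw [h]
      · exact τ.commutes _
      · rw [map_neg, τ.commutes]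
    refine ⟨0, fun τ σ hσ => ?_⟩
    have : σ β = β := hinj (by rw [hσ, hfix])
    rw [sqrtCocycle, if_pos this, map_zero, map_zero, sub_zero]
  obtain ⟨γ, hγdef⟩ : ∃ γ, γ = ι β := ⟨_, rfl⟩
  obtain ⟨s, hs⟩ : ∃ s, s = algebraMap F (AlgebraicClosure F) (M / e) := ⟨_, rfl⟩
  obtain ⟨n, hn⟩ : ∃ n, n = algebraMap F (AlgebraicClosure F) (N / e ^ 2) := ⟨_, rfl⟩
  rw [← hγdef] at hγ hγ0
  have hκ := (hW.geom F).ne_zero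
  obtain ⟨κ', hκ'⟩ : ∃ κ', κ' = algebraMap K (AlgebraicClosure F) κ := ⟨_, rfl⟩
  rw [← hκ'] at hκ
  have hrel : γ ^ 2 * n ^ 2 = (γ ^ 2 * s ^ 2) ^ 2 + 4 * κ' ^ 2 := by
    have hF : algebraMap K F a * (N / e ^ 2) ^ 2 = (algebraMap K F a * (M / e) ^ 2) ^ 2 +
        4 * algebraMap K F κ ^ 2 := by
      rw [map_mul, map_pow, map_ofNat] at h
      field_simp
      rw [h]
      field_simp
    have := congrArg (algebraMap F (AlgebraicClosure F)) hF
    rw [hγ, hn, hs, hκ', IsScalarTower.algebraMap_apply K F (AlgebraicClosure F) κ]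
    simpa only [map_pow, map_add, map_mul, map_ofNat] using this
  -- x and x' are the roots of X² - γ²s²X - κ'², exchanged by γ ↦ -γ. As xx' = -κ'², x' is the
  -- x-coordinate of the translate of P by (0,0).
  obtain ⟨x, hx⟩ : ∃ x, x = (γ ^ 2 * s ^ 2 + γ * n) / 2 := ⟨_, rfl⟩
  obtain ⟨x', hx'⟩ : ∃ x', x' = (γ ^ 2 * s ^ 2 - γ * n) / 2 := ⟨_, rfl⟩
  have hxx' : x * x' = -κ' ^ 2 := by
    rw [hx, hx']
    linear_combination -(1 / 4 : AlgebraicClosure F) * hrel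
  have hadd : x + x' = γ ^ 2 * s ^ 2 := by rw [hx, hx']; ring
  have hx0 : x ≠ 0 := by
    rintro h0
    rw [h0, zero_mul] at hxx'
    exact neg_ne_zero.mpr (pow_ne_zero 2 hκ) hxx'.symm
  have hP : (γ * s * x) ^ 2 = x ^ 3 - κ' ^ 2 * x := by
    linear_combination -x ^ 2 * hadd + x * hxx'
  rw [hκ'] at hP
  refine ⟨(hW.geom F).point x (γ * s * x) hP, fun τ σ hσ => ?_⟩
  have hτs : τ s = s := by rw [hs, τ.commutes]
  have hτn : τ n = n := by rw [hn, τ.commutes]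
  obtain ⟨h1, e1⟩ := hW.galAct_point τ hP
  have hσγ : τ γ = ι (σ β) := by rw [hσ, hγdef]
  rw [e1, sqrtCocycle]
  by_cases hσβ : σ β = β
  · rw [if_pos hσβ, map_zero, eq_comm, sub_eq_zero, (hW.geom F).point_inj]
    have hτγ : τ γ = γ := by rw [hσγ, hσβ, hγdef]
    have hτx : τ x = x := by
      rw [hx]
      simp only [map_div₀, map_add, map_mul, map_pow, hτγ, hτs, hτn, map_ofNat]
    exact ⟨hτx, by simp only [map_mul, hτγ, hτs, hτx]⟩
  · have hτγ : τ γ = -γ := by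
      rcases map_eq_or_eq_neg hβ σ with h | h
      · exact absurd h hσβ
      · rw [hσγ, h, map_neg, hγdef]
    have hτx : τ x = x' := by
      rw [hx, hx']
      simp only [map_div₀, map_add, map_mul, map_pow, hτγ, hτs, hτn, map_ofNat]
      ring
    obtain ⟨h2, e2⟩ := (hW.geom F).point_add_origin (h := hP) hx0
    rw [if_neg hσβ, hW.embPoint_origin, eq_comm, sub_eq_iff_eq_add, add_comm, e2,
      (hW.geom F).point_inj, hτx, map_mul, map_mul, hτγ, hτs, hτx, ← hκ']
    constructor
    · field_simp
      linear_combination hxx'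
    · field_simp
      linear_combination -s * hxx'

end

open IsCongruentCurve

/-! ### Cocycles with values in the points of order two -/

section

variable {K : Type} [Field K] [CharZero K] {W : WeierstrassCurve K} {κ : K}

/-- For the trivializing point P, the square root f of x(2P) and the product g of the square roots
of x(2P) ± κ are multiplied by the pairing under Galois, as √a is. So f/√a and g/√a lie in F, and g²
= f⁴ - κ² becomes the torsor equation. -/
theorem torsorHasPoint_dual_of_mem_locallyTrivial (hW : IsCongruentCurve W.toAffine κ)
    {F : Type} [Field F] [CharZero F] [Algebra K F]
    {c : AbsGal K → GeomPoint W K} (hc : ∀ σ, c σ + c σ = 0) {α : AlgebraicClosure K} {a : K}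
    (ha : a ≠ 0) (hα : α ^ 2 = algebraMap K (AlgebraicClosure K) a)
    (hσ : ∀ σ : AbsGal K, σ α = pairing (c σ) * α) (h : c ∈ locallyTrivial W F) :
    TorsorHasPoint (algebraMap K F a) (algebraMap K F (-κ ^ 2) / algebraMap K F a) := by
  let ι : AlgebraicClosure K →ₐ[K] AlgebraicClosure F := IsAlgClosed.lift
  obtain ⟨P, hP⟩ := h ι
  obtain ⟨γ, hγdef⟩ : ∃ γ, γ = ι α := ⟨_, rfl⟩
  have hγ : γ ^ 2 = algebraMap F (AlgebraicClosure F) (algebraMap K F a) := by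
    rw [hγdef, ← map_pow, hα, AlgHom.commutes, IsScalarTower.algebraMap_apply K F (AlgebraicClosure F)]
  have hγ0 : γ ≠ 0 := by
    intro h0
    rw [h0, zero_pow two_ne_zero] at hγ
    exact ha (by simpa using hγ.symm)
  have key : ∀ τ : AbsGal F, ∃ T : GeomPoint W F, T + T = 0 ∧ galAct W τ P = P + T ∧
      τ γ = pairing T * γ := by
    intro τ
    obtain ⟨σ, hστ⟩ := exists_restriction ι τ
    refine ⟨embPoint W ι (c σ), ?_, ?_, ?_⟩
    · rw [← map_add, hc, map_zero]
    · rw [hP τ σ hστ]; abel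
    · rw [hγdef, ← hστ, hσ, pairing_embPoint, map_mul, map_intCast]
  -- The functions f, g need y ≠ 0. When P is 2-torsion it is rational, so the character is trivial
  -- and a is a square in F.
  have htriv : P + P = 0 → TorsorHasPoint (algebraMap K F a)
      (algebraMap K F (-κ ^ 2) / algebraMap K F a) := by
    intro hPP
    obtain ⟨b, hb⟩ := isSquare_of_fixed hγ fun τ => by
      obtain ⟨T, -, h1, h2⟩ := key τ
      rw [hW.galAct_of_add_self τ hPP, left_eq_add] at h1
      rw [h2, h1, pairing_zero, Int.cast_one, one_mul]
    exact torsorHasPoint_of_eq_sq _ hb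
  obtain rfl | ⟨x, y, hxy, rfl⟩ := (hW.geom F).eq_zero_or_eq_point P
  · exact htriv (add_zero _)
  by_cases hy : y = 0
  · exact htriv ((hW.geom F).point_add_self_of_eq_zero hy)
  obtain ⟨κ', hκ'⟩ : ∃ κ', κ' = algebraMap K (AlgebraicClosure F) κ := ⟨_, rfl⟩
  obtain ⟨f, hf⟩ : ∃ f, f = (x ^ 2 + κ' ^ 2) / (2 * y) := ⟨_, rfl⟩
  obtain ⟨g, hg⟩ : ∃ g, g = ((x ^ 2 - κ' ^ 2) ^ 2 - 4 * κ' ^ 2 * x ^ 2) / (4 * y ^ 2) := ⟨_, rfl⟩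
  have hfix : ∀ τ : AbsGal F, τ (f / γ) = f / γ ∧ τ (g / γ) = g / γ := by
    intro τ
    have hτκ : τ κ' = κ' := by rw [hκ']; exact algEquiv_algebraMap τ κ
    obtain ⟨T, hT, h1, h2⟩ := key τ
    obtain ⟨h3, h4⟩ := hW.galAct_point τ hxy
    obtain ⟨x', y', h5, h6, -, h7, h8⟩ := (hW.geom F).exists_point_add_eq (h := hxy) hy hT
    rw [h4, h6, (hW.geom F).point_inj] at h1
    rw [← h1.1, ← h1.2, ← hκ'] at h7 h8
    rw [← hf] at h7
    rw [← hg] at h8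
    have hp0 : (pairing T : AlgebraicClosure F) ≠ 0 := by
      intro h0
      have := pairing_mul_self T
      rw [Int.cast_eq_zero.mp h0] at this
      norm_num at this
    have hτf : τ f = pairing T * f := by
      rw [← h7, hf]
      simp only [map_div₀, map_add, map_mul, map_pow, map_ofNat, hτκ]
    have hτg : τ g = pairing T * g := by
      rw [← h8, hg]
      simp only [map_div₀, map_sub, map_mul, map_pow, map_ofNat, hτκ]
    rw [map_div₀, map_div₀, hτf, hτg, h2]
    exact ⟨mul_div_mul_left _ _ hp0, mul_div_mul_left _ _ hp0⟩
  obtain ⟨m, hm⟩ := mem_range_algebraMap_of_fixed fun τ => (hfix τ).1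
  obtain ⟨n, hn⟩ := mem_range_algebraMap_of_fixed fun τ => (hfix τ).2
  refine ⟨n, m, 1, by simp, ?_⟩
  apply (algebraMap F (AlgebraicClosure F)).injective
  have hκF : algebraMap F (AlgebraicClosure F) (algebraMap K F κ) = κ' := by
    rw [hκ', ← IsScalarTower.algebraMap_apply K F (AlgebraicClosure F) κ]
  have hrel : g ^ 2 = f ^ 4 - κ' ^ 2 := by
    rw [hf, hg]
    rw [← hκ'] at hxy
    exact product_sq_eq hxy hy
  simp only [map_pow, map_add, map_mul, map_div₀, map_one, map_neg, hκF, hm, hn, ← hγ]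
  field_simp
  linear_combination hrel

/-- A point of order two with `x`-coordinate `e ≠ 0` is the double of a point whose coboundary has
the quadratic character of `√e`. -/
theorem exists_coboundary_character (hW : IsCongruentCurve W.toAffine κ)
    {e : K} (he : e ^ 2 = κ ^ 2) :
    ∃ (Q : GeomPoint W K) (ε : AlgebraicClosure K),
      ε ^ 2 = algebraMap K (AlgebraicClosure K) e ∧
      ∀ σ : AbsGal K, coboundary Q σ + coboundary Q σ = 0 ∧ σ ε = pairing (coboundary Q σ) * ε := by
  have hT : (0 : AlgebraicClosure K) ^ 2 = algebraMap K (AlgebraicClosure K) e ^ 3 -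
      algebraMap K (AlgebraicClosure K) κ ^ 2 * algebraMap K (AlgebraicClosure K) e := by
    rw [← map_pow, ← map_pow, ← he, ← map_mul, ← map_sub]
    simp [pow_succ]
  obtain ⟨Q, hQ⟩ := (hW.geom K).exists_add_self_eq ((hW.geom K).point _ 0 hT)
  have h2 : ∀ σ, coboundary Q σ + coboundary Q σ = 0 := by
    intro σ
    have := hW.galAct_of_add_self σ (T := Q + Q) (by
      rw [hQ]; exact (hW.geom K).point_add_self_of_eq_zero rfl)
    rw [map_add] at this
    rw [coboundary, sub_add_sub_comm, this, sub_self]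
  obtain rfl | ⟨x, y, hxy, rfl⟩ := (hW.geom K).eq_zero_or_eq_point Q
  · rw [add_zero] at hQ
    exact absurd hQ.symm ((hW.geom K).point_ne_zero _)
  obtain ⟨hy, hsq⟩ := (hW.geom K).sq_eq_of_add_self hQ
  refine ⟨_, _, hsq, fun σ => ⟨h2 σ, ?_⟩⟩
  obtain ⟨h3, h4⟩ := hW.galAct_point σ hxy
  obtain ⟨x', y', h5, h6, -, h7, -⟩ := (hW.geom K).exists_point_add_eq (h := hxy) hy (h2 σ)
  have h8 : (hW.geom K).point x y hxy + coboundary ((hW.geom K).point x y hxy) σ =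
      galAct W σ ((hW.geom K).point x y hxy) := by
    rw [coboundary]; abel
  rw [h8, h4, (hW.geom K).point_inj] at h6
  rw [← h7, ← h6.1, ← h6.2]
  simp only [map_div₀, map_add, map_mul, map_pow, map_ofNat, algEquiv_algebraMap]

/-- Halves of (κ,0) and (-κ,0) realize the classes of κ and -κ. Their sum realizes -κ², the class of
-1, which is why the square factor w² is allowed. -/
theorem exists_coboundary_character_of_eq (hW : IsCongruentCurve W.toAffine κ)
    {d : K} (hd : d = 1 ∨ d = -1 ∨ d = κ ∨ d = -κ) :
    ∃ (Q : GeomPoint W K) (ε : AlgebraicClosure K) (w : K), w ≠ 0 ∧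
      ε ^ 2 = algebraMap K (AlgebraicClosure K) (d * w ^ 2) ∧
      ∀ σ : AbsGal K, coboundary Q σ + coboundary Q σ = 0 ∧ σ ε = pairing (coboundary Q σ) * ε := by
  obtain ⟨Q₁, ε₁, h₁, H₁⟩ := exists_coboundary_character hW (e := κ) rfl
  obtain ⟨Q₂, ε₂, h₂, H₂⟩ := exists_coboundary_character hW (e := -κ) (neg_sq κ)
  rcases hd with rfl | rfl | rfl | rfl
  · have h0 : ∀ σ, coboundary (0 : GeomPoint W K) σ = 0 := fun σ => by
      rw [coboundary, map_zero, sub_zero]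
    refine ⟨0, 1, 1, one_ne_zero, by simp, fun σ => ?_⟩
    rw [h0, pairing_zero]
    simp
  · refine ⟨Q₁ + Q₂, ε₁ * ε₂, κ, hW.ne_zero, ?_, fun σ => ?_⟩
    · rw [mul_pow, h₁, h₂, ← map_mul]
      congr 1
      ring
    · have e : coboundary (Q₁ + Q₂) σ = coboundary Q₁ σ + coboundary Q₂ σ := by
        simp only [coboundary, map_add]; abel
      rw [e]
      constructor
      · rw [add_add_add_comm, (H₁ σ).1, (H₂ σ).1, add_zero]
      · rw [(hW.geom K).pairing_add (H₁ σ).1 (H₂ σ).1, map_mul, (H₁ σ).2, (H₂ σ).2]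
        push_cast; ring
  · exact ⟨Q₁, ε₁, 1, one_ne_zero, by simpa using h₁, H₁⟩
  · exact ⟨Q₂, ε₂, 1, one_ne_zero, by simpa using h₂, H₂⟩

/-- Two cochains with the same quadratic character differ by values in `{O, (0, 0)}`. -/
theorem sub_coboundary_eq_zero_or_origin (hW : IsCongruentCurve W.toAffine κ)
    {c : AbsGal K → GeomPoint W K}
    (hc : ∀ σ, c σ + c σ = 0) {α : AlgebraicClosure K} {d v : K}
    (hα : α ^ 2 = algebraMap K (AlgebraicClosure K) (d * v ^ 2)) (hd0 : d ≠ 0) (hv : v ≠ 0)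
    (hσ : ∀ σ : AbsGal K, σ α = pairing (c σ) * α)
    (hd : d = 1 ∨ d = -1 ∨ d = κ ∨ d = -κ) :
    ∃ Q : GeomPoint W K, ∀ σ, c σ - coboundary Q σ = 0 ∨
      c σ - coboundary Q σ = (hW.geom K).origin := by
  obtain ⟨Q, ε, w, hw, hε, H⟩ := exists_coboundary_character_of_eq hW hd
  refine ⟨Q, fun σ => ?_⟩
  obtain ⟨h2, h3⟩ := H σ
  have hε0 : ε ≠ 0 := by
    rintro rfl
    rw [zero_pow two_ne_zero] at hε
    have := (map_eq_zero _).mp hε.symm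
    exact mul_ne_zero hd0 (pow_ne_zero 2 hw) this
  have hsq : ε ^ 2 = (algebraMap K (AlgebraicClosure K) (w / v) * α) ^ 2 := by
    rw [mul_pow, hα, hε, ← map_pow, ← map_mul]
    congr 1
    field_simp
  have hσε : σ ε = pairing (c σ) * ε := by
    rcases sq_eq_sq_iff_eq_or_eq_neg.mp hsq with h | h
    · rw [h, map_mul, AlgEquiv.commutes, hσ]; ring
    · rw [h, map_neg, map_mul, AlgEquiv.commutes, hσ]; ring
  have hp : pairing (c σ) = pairing (coboundary Q σ) := by
    have := mul_right_cancel₀ hε0 (hσε.symm.trans h3)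
    exact_mod_cast this
  have hsub : c σ - coboundary Q σ = c σ + coboundary Q σ := by
    rw [sub_eq_add_neg, neg_eq_of_add_eq_zero_left h2]
  rw [hsub]
  refine (hW.geom K).eq_zero_or_origin_of_pairing ?_ ?_
  · rw [add_add_add_comm, hc, h2, add_zero]
  · rw [(hW.geom K).pairing_add (hc σ) h2, hp, pairing_mul_self]

theorem exists_eq_sqrtCocycle (hW : IsCongruentCurve W.toAffine κ)
    {c : AbsGal K → GeomPoint W K} (hc : c ∈ cocycles W)
    (h : ∀ σ, c σ = 0 ∨ c σ = (hW.geom K).origin) :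
    ∃ (β : AlgebraicClosure K) (a : Kˣ), β ≠ 0 ∧
      β ^ 2 = algebraMap K (AlgebraicClosure K) a ∧ c = sqrtCocycle hW β := by
  classical
  let φ : GeomPoint W K → ℤ := fun P => if P = 0 then 1 else -1
  have ho : φ (hW.geom K).origin = -1 := if_neg (origin_ne_zero _)
  have h0 : φ 0 = 1 := if_pos rfl
  obtain ⟨β, a, hβ0, hβ, H⟩ := exists_sqrt_of_character (f := fun σ => φ (c σ))
    (hc.1.comp φ) (fun σ τ => by
      rw [hc.2]
      rcases h σ with h1 | h1 <;> rcases h τ with h2 | h2 <;>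
        simp [h1, h2, hW.galAct_origin, (hW.geom K).origin_add_origin, ho, h0])
    (fun σ => by rcases h σ with h1 | h1 <;> simp [h1, ho, h0])
  refine ⟨β, a, hβ0, hβ, ?_⟩
  funext σ
  have hn : -β ≠ β := fun h => hβ0 (self_eq_neg.mp h.symm)
  rcases h σ with h1 | h1
  · have : σ β = β := by rw [H, h1, h0]; simp
    simp [sqrtCocycle, this, h1]
  · have : σ β = -β := by rw [H, h1, ho]; simp
    simp [sqrtCocycle, this, h1, hn]

theorem exists_sqrt_of_pairing (hW : IsCongruentCurve W.toAffine κ)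
    {c : AbsGal K → GeomPoint W K} (hc : c ∈ cocycles W)
    (h2 : ∀ σ, c σ + c σ = 0) : ∃ (α : AlgebraicClosure K) (a : Kˣ), α ≠ 0 ∧
      α ^ 2 = algebraMap K (AlgebraicClosure K) a ∧
      ∀ σ : AbsGal K, σ α = pairing (c σ) * α :=
  exists_sqrt_of_character (f := fun σ => pairing (c σ)) (hc.1.comp pairing)
    (fun σ τ => by
      rw [hc.2, hW.galAct_of_add_self σ (h2 τ), (hW.geom K).pairing_add (h2 σ) (h2 τ)])
    (fun σ => pairing_mul_self _)

end

/-! ### The classes of square roots in `H¹` -/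

section

variable {K : Type} [Field K] {W : WeierstrassCurve K} {κ : K}

theorem exists_sqrt (d : K) :
    ∃ β : AlgebraicClosure K, β ^ 2 = algebraMap K (AlgebraicClosure K) d :=
  IsAlgClosed.exists_pow_nat_eq _ two_pos

theorem ne_zero_of_sq_eq {β : AlgebraicClosure K} {d : Kˣ}
    (h : β ^ 2 = algebraMap K (AlgebraicClosure K) d) : β ≠ 0 := by
  rintro rfl
  rw [zero_pow two_ne_zero] at h
  exact d.ne_zero ((map_eq_zero _).mp h.symm)

variable [CharZero K]

/-- The cocycle `σ ↦ σ(√d) / √d` with values in the kernel `{O, (0, 0)}` of the isogeny. -/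
noncomputable def kummerCocycle (hW : IsCongruentCurve W.toAffine κ) (d : Kˣ) :
    AbsGal K → GeomPoint W K :=
  sqrtCocycle hW (exists_sqrt (d : K)).choose

variable (hW : IsCongruentCurve W.toAffine κ)

theorem kummerCocycle_eq {d v : Kˣ} {β : AlgebraicClosure K}
    (h : β ^ 2 = algebraMap K (AlgebraicClosure K) (d * v ^ 2 : Kˣ)) :
    kummerCocycle hW d = sqrtCocycle hW β := by
  rw [kummerCocycle, ← sqrtCocycle_algebraMap_mul hW v.ne_zero]
  apply sqrtCocycle_eq_of_sq_eq
  rw [mul_pow, (exists_sqrt (d : K)).choose_spec, h, ← map_pow, ← map_mul]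
  push_cast
  rw [mul_comm]

theorem kummerCocycle_mul_sq (d v : Kˣ) : kummerCocycle hW (d * v ^ 2) = kummerCocycle hW d :=
  (kummerCocycle_eq hW (exists_sqrt ((d * v ^ 2 : Kˣ) : K)).choose_spec).symm

theorem kummerCocycle_mem_cocycles (d : Kˣ) : kummerCocycle hW d ∈ cocycles W :=
  sqrtCocycle_mem_cocycles hW (ne_zero_of_sq_eq (exists_sqrt (d : K)).choose_spec)
    (exists_sqrt (d : K)).choose_spec

theorem kummerCocycle_add_self (d : Kˣ) : kummerCocycle hW d + kummerCocycle hW d = 0 :=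
  sqrtCocycle_add_self hW _

theorem kummerCocycle_mul (d d' : Kˣ) :
    kummerCocycle hW (d * d') = kummerCocycle hW d + kummerCocycle hW d' := by
  have h := (exists_sqrt (d : K)).choose_spec
  have h' := (exists_sqrt (d' : K)).choose_spec
  rw [kummerCocycle, kummerCocycle, kummerCocycle, ← sqrtCocycle_mul hW (ne_zero_of_sq_eq h)
    (ne_zero_of_sq_eq h') h h']
  apply sqrtCocycle_eq_of_sq_eq
  rw [(exists_sqrt ((d * d' : Kˣ) : K)).choose_spec, mul_pow, h, h', ← map_mul, Units.val_mul]

theorem torsorHasPoint_of_kummerCocycle_mem_coboundaries {d : Kˣ}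
    (h : kummerCocycle hW d ∈ coboundaries W) : TorsorHasPoint (d : K) (4 * κ ^ 2 / d) :=
  torsorHasPoint_of_mem_coboundaries hW d.ne_zero (exists_sqrt (d : K)).choose_spec h

theorem kummerCocycle_mem_locallyTrivial_iff {F : Type} [Field F] [CharZero F] [Algebra K F]
    {d : Kˣ} : kummerCocycle hW d ∈ locallyTrivial W F ↔
      TorsorHasPoint (algebraMap K F d) (algebraMap K F (4 * κ ^ 2) / algebraMap K F d) :=
  ⟨torsorHasPoint_of_mem_locallyTrivial hW d.ne_zero (exists_sqrt (d : K)).choose_spec,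
    sqrtCocycle_mem_locallyTrivial hW d.ne_zero (exists_sqrt (d : K)).choose_spec⟩

/-- The class in `H¹` of a cocycle `c` such that `c + c` is a coboundary has an image under the
isogeny, given by the square class of some `a`; when `a` is a class in the image of the
`2`-torsion of the curve, the class of `c` comes from the kernel of the isogeny. -/
theorem exists_image_class {c : AbsGal K → GeomPoint W K} (hc : c ∈ cocycles W)
    (h2 : c + c ∈ coboundaries W) :
    ∃ a : Kˣ, (∀ (F : Type) [Field F] [CharZero F] [Algebra K F], c ∈ locallyTrivial W F →
        TorsorHasPoint (algebraMap K F a) (algebraMap K F (-κ ^ 2) / algebraMap K F a)) ∧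
      ∀ d v : Kˣ, a = d * v ^ 2 → ((d : K) = 1 ∨ (d : K) = -1 ∨ (d : K) = κ ∨ (d : K) = -κ) →
        ∃ (Q : GeomPoint W K) (a' : Kˣ), c = kummerCocycle hW a' + coboundary Q := by
  obtain ⟨P, hP⟩ := h2
  -- With P = 2Q, subtracting the coboundary of Q from c leaves a cocycle with values in the
  -- 2-torsion.
  obtain ⟨Q, rfl⟩ := (hW.geom K).exists_add_self_eq P
  obtain ⟨c₁, hc₁⟩ : ∃ c₁, c₁ = c - coboundary Q := ⟨_, rfl⟩
  have hmem : c₁ ∈ cocycles W := hc₁ ▸ sub_mem hc (coboundary_mem_cocycles Q)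
  have htwo : ∀ σ, c₁ σ + c₁ σ = 0 := fun σ => by
    have h := hP σ
    rw [Pi.add_apply, map_add] at h
    rw [hc₁, Pi.sub_apply, sub_add_sub_comm, h, coboundary]
    abel
  obtain ⟨α, a, -, hα, hσ⟩ := exists_sqrt_of_pairing hW hmem htwo
  refine ⟨a, fun F _ _ _ hF => ?_, fun d v had hd => ?_⟩
  · exact torsorHasPoint_dual_of_mem_locallyTrivial hW htwo a.ne_zero hα hσ
      (hc₁ ▸ sub_mem hF (coboundary_mem_locallyTrivial F Q))
  · rw [had, Units.val_mul, Units.val_pow_eq_pow_val] at hα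
    obtain ⟨Q', hQ'⟩ := sub_coboundary_eq_zero_or_origin hW htwo hα d.ne_zero v.ne_zero hσ hd
    obtain ⟨β, a', -, hβ, h⟩ := exists_eq_sqrtCocycle hW
      (sub_mem hmem (coboundary_mem_cocycles Q')) hQ'
    refine ⟨Q + Q', a', ?_⟩
    rw [kummerCocycle_eq hW (v := 1) (β := β) (by rw [one_pow, mul_one]; exact hβ), ← h, hc₁]
    funext σ
    simp only [Pi.add_apply, Pi.sub_apply, coboundary, map_add]
    abel

end

/-! ### The 2-torsion of the Tate-Shafarevich group -/

section

variable {W : WeierstrassCurve ℚ}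

/-- The conditions on a cocycle that define the Tate-Shafarevich group. -/
theorem mem_locallyTrivial_iInf {c : AbsGal ℚ → GeomPoint W ℚ} :
    c ∈ (locallyTrivial W ℝ ⊓ ⨅ (q : ℕ) (_ : Fact q.Prime), locallyTrivial W ℚ_[q]) ↔
      c ∈ locallyTrivial W ℝ ∧ ∀ (q : ℕ) (_ : Fact q.Prime), c ∈ locallyTrivial W ℚ_[q] := by
  simp [AddSubgroup.mem_inf, AddSubgroup.mem_iInf]

theorem kummerCocycle_mem_iInf_iff {κ : ℚ} (hW : IsCongruentCurve W.toAffine κ) {d : ℚˣ} :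
    kummerCocycle hW d ∈
        (locallyTrivial W ℝ ⊓ ⨅ (q : ℕ) (_ : Fact q.Prime), locallyTrivial W ℚ_[q]) ↔
      d ∈ everywhereSoluble (4 * κ ^ 2) := by
  rw [mem_locallyTrivial_iInf, mem_everywhereSoluble]
  refine and_congr ?_ (forall_congr' fun q => forall_congr' fun _ => ?_)
  · rw [kummerCocycle_mem_locallyTrivial_iff, mem_solubleOver]
  · rw [kummerCocycle_mem_locallyTrivial_iff, mem_solubleOver]

theorem mk_eq_mk_iff {c c' : cocycles W} :
    (QuotientAddGroup.mk c : H1 W) = QuotientAddGroup.mk c' ↔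
      (c : AbsGal ℚ → GeomPoint W ℚ) - c' ∈ coboundaries W := by
  rw [QuotientAddGroup.eq_iff_sub_mem, AddSubgroup.mem_addSubgroupOf]
  rfl

theorem mem_shaTorsion_two {x : sha W} : x ∈ shaTorsion W 2 ↔ x + x = 0 :=
  (Submodule.mem_torsionBy_iff _ _).trans (by rw [two_zsmul])

/-- The class in `Ш[2]` of a cocycle given by a square root. -/
noncomputable def kummerClass {κ : ℚ} (hW : IsCongruentCurve W.toAffine κ)
    (d : everywhereSoluble (4 * κ ^ 2)) : shaTorsion W 2 :=
  ⟨⟨QuotientAddGroup.mk ⟨kummerCocycle hW d, kummerCocycle_mem_cocycles hW d⟩,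
    ⟨_, (kummerCocycle_mem_iInf_iff hW).mpr d.2, rfl⟩⟩, by
    rw [mem_shaTorsion_two]
    apply Subtype.ext
    exact congrArg (QuotientAddGroup.mk' _) (Subtype.ext (kummerCocycle_add_self hW d))⟩

theorem kummerClass_eq_iff {κ : ℚ} (hW : IsCongruentCurve W.toAffine κ)
    {d d' : everywhereSoluble (4 * κ ^ 2)} : kummerClass hW d = kummerClass hW d' ↔
      kummerCocycle hW ((d : ℚˣ) * d') ∈ coboundaries W := by
  rw [Subtype.ext_iff, Subtype.ext_iff, kummerCocycle_mul]
  refine (mk_eq_mk_iff (W := W)).trans ?_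
  rw [sub_eq_add_neg, neg_eq_of_add_eq_zero_left (kummerCocycle_add_self hW d')]

theorem exists_kummerClass_eq {κ : ℚ} (hW : IsCongruentCurve W.toAffine κ)
    (hdual : ∀ u : ℚˣ, (∀ (q : ℕ) (_ : Fact q.Prime), u ∈ solubleOver ℚ_[q] (-κ ^ 2)) →
      ∃ d v : ℚˣ, ((d : ℚ) = 1 ∨ (d : ℚ) = -1 ∨ (d : ℚ) = κ ∨ (d : ℚ) = -κ) ∧ u = d * v ^ 2)
    (x : shaTorsion W 2) : ∃ d, kummerClass hW d = x := by
  obtain ⟨⟨_, ⟨⟨c, hc⟩, hloc, rfl⟩⟩, hx⟩ := x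
  have h2 : c + c ∈ coboundaries W := by
    have h := congrArg Subtype.val (mem_shaTorsion_two.mp hx)
    have h := (QuotientAddGroup.eq_zero_iff _).mp h
    exact AddSubgroup.mem_addSubgroupOf.mp h
  obtain ⟨a, ha, hred⟩ := exists_image_class hW hc h2
  have hloc : c ∈ (locallyTrivial W ℝ ⊓ ⨅ (q : ℕ) (_ : Fact q.Prime), locallyTrivial W ℚ_[q]) :=
    hloc
  obtain ⟨d, v, hd, had⟩ := hdual a fun q _ => mem_solubleOver.mpr
    (ha _ ((mem_locallyTrivial_iInf.mp hloc).2 q _))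
  obtain ⟨Q, a', rfl⟩ := hred d v had hd
  have hmem : kummerCocycle hW a' ∈
      (locallyTrivial W ℝ ⊓ ⨅ (q : ℕ) (_ : Fact q.Prime), locallyTrivial W ℚ_[q]) := by
    refine (add_mem_cancel_right ?_).mp hloc
    exact mem_locallyTrivial_iInf.mpr ⟨coboundary_mem_locallyTrivial ℝ Q, fun q _ =>
      coboundary_mem_locallyTrivial ℚ_[q] Q⟩
  refine ⟨⟨a', (kummerCocycle_mem_iInf_iff hW).mp hmem⟩, ?_⟩
  apply Subtype.ext
  apply Subtype.ext
  refine (mk_eq_mk_iff (W := W)).mpr ?_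
  rw [← neg_sub, add_sub_cancel_left]
  exact neg_mem (coboundary_mem_coboundaries Q)

end

/-! ### Counting Ш[2] for k = pl -/

section

variable {p l : ℕ} [Fact p.Prime] [Fact l.Prime]

theorem isCongruentCurve_congruentCurve :
    IsCongruentCurve (congruentCurve (p * l : ℤ)).toAffine (p * l : ℚ) where
  a₁ := rfl
  a₂ := rfl
  a₃ := rfl
  a₄ := by
    change -((p * l : ℤ) : ℚ) ^ 2 = _
    push_cast
    rfl
  a₆ := rfl
  ne_zero := (primeUnit p * primeUnit l).ne_zero

/-- The representatives `1, 2, pl, 2pl` of the Selmer group. -/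
noncomputable def selmerRep (p l : ℕ) [Fact p.Prime] [Fact l.Prime] (i : Fin 2 × Fin 2) : ℚˣ :=
  primeUnit 2 ^ (i.1 : ℕ) * (primeUnit p * primeUnit l) ^ (i.2 : ℕ)

theorem selmerRep_mem (hp : p % 8 = 1) (hl : l % 8 = 1) (i : Fin 2 × Fin 2) :
    selmerRep p l i ∈ everywhereSoluble (4 * (p * l : ℚ) ^ 2) :=
  mul_mem (pow_mem (two_mem_everywhereSoluble hp hl) _)
    (pow_mem (mul_mem_everywhereSoluble hp hl) _)

/-- The parities of the valuations at 2 and at p recover the two exponents. -/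
theorem selmerRep_mul_eq_sq (hp : p % 8 = 1) (hl : l % 8 = 1) (hpl : p ≠ l)
    {i j : Fin 2 × Fin 2} {v : ℚˣ} (h : selmerRep p l i * selmerRep p l j = v ^ 2) : i = j := by
  have h2p : 2 ≠ p := by rintro rfl; omega
  have h2l : 2 ≠ l := by rintro rfl; omega
  have e2 := congrArg (fun u : ℚˣ => padicValRat 2 (u : ℚ)) h
  have ep := congrArg (fun u : ℚˣ => padicValRat p (u : ℚ)) h
  simp only [selmerRep, padicValRat_units_mul, padicValRat_units_pow, padicValRat_primeUnit_self,
    padicValRat_primeUnit_of_ne h2p, padicValRat_primeUnit_of_ne h2l] at e2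
  simp only [selmerRep, padicValRat_units_mul, padicValRat_units_pow, padicValRat_primeUnit_self,
    padicValRat_primeUnit_of_ne h2p.symm, padicValRat_primeUnit_of_ne hpl] at ep
  apply Prod.ext <;> apply Fin.ext
  · have := i.1.2; have := j.1.2; push_cast at e2; omega
  · have := i.2.2; have := j.2.2; push_cast at ep; omega

theorem exists_eq_selmerRep_mul_sq (hp : p % 8 = 1) (hl : l % 8 = 1) (h₂ : legendreSym l p = -1)
    {u : ℚˣ} (hu : u ∈ everywhereSoluble (4 * (p * l : ℚ) ^ 2)) :
    ∃ i v, u = selmerRep p l i * v ^ 2 := by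
  obtain ⟨d, v, hd, rfl⟩ := exists_eq_of_mem_everywhereSoluble hp hl h₂ hu
  rcases hd with h | h | h | h
  · exact ⟨(0, 0), v, by congr 1; ext; simp [selmerRep, h]⟩
  · exact ⟨(1, 0), v, by congr 1; ext; simp [selmerRep, h]⟩
  · exact ⟨(0, 1), v, by congr 1; ext; simp [selmerRep, h]⟩
  · exact ⟨(1, 1), v, by congr 1; ext; simp [selmerRep, h]⟩

/-- Two representatives with equal classes have a product whose torsor is soluble over ℚ, hence a
square since W is trivial; this gives injectivity. Surjectivity combines `exists_kummerClass_eq`,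
fed by the dual Selmer computation, with the list of representatives of S^(φ). -/
theorem card_shaTorsion_two (hp : p % 8 = 1) (hl : l % 8 = 1) (h₂ : legendreSym l p = -1)
    (h8 : octicSymbol (-4) p * octicSymbol (-4) l = -1) :
    Nat.card (shaTorsion (congruentCurve (p * l : ℤ)) 2) = 4 := by
  have hW := isCongruentCurve_congruentCurve (p := p) (l := l)
  have hpl : p ≠ l := by
    rintro rfl
    rw [(legendreSym.eq_zero_iff p p).mpr (by simp)] at h₂
    norm_num at h₂
  let f : Fin 2 × Fin 2 → shaTorsion (congruentCurve (p * l : ℤ)) 2 := fun i =>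
    kummerClass hW ⟨selmerRep p l i, selmerRep_mem hp hl i⟩
  have hf : Function.Bijective f := by
    refine ⟨fun i j hij => ?_, fun x => ?_⟩
    · have h := torsorHasPoint_of_kummerCocycle_mem_coboundaries hW
        ((kummerClass_eq_iff hW).mp hij)
      obtain ⟨v, hv⟩ := exists_eq_sq_of_mem_solubleOver_rat hp hl h₂ h8
        (u := selmerRep p l i * selmerRep p l j)
        (mem_solubleOver.mpr (by simpa only [Algebra.algebraMap_self, RingHom.id_apply] using h))
      exact selmerRep_mul_eq_sq hp hl hpl hv
    · obtain ⟨⟨d, hd⟩, rfl⟩ := exists_kummerClass_eq hW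
        (fun u hu => exists_eq_of_mem_solubleOver_dual hp hl h₂ hu) x
      obtain ⟨i, v, rfl⟩ := exists_eq_selmerRep_mul_sq hp hl h₂ hd
      refine ⟨i, (kummerClass_eq_iff hW).mpr ?_⟩
      rw [← mul_assoc, kummerCocycle_mul_sq, kummerCocycle_mul, kummerCocycle_add_self]
      exact zero_mem _
  rw [← Nat.card_eq_of_bijective f hf]
  simp

end

end CongruentDescent

theorem proposition8 (p l : ℕ) [Fact p.Prime] [Fact l.Prime]
    (hp : p % 8 = 1) (hl : l % 8 = 1) (hpl : legendreSym l (p : ℤ) = -1)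
    (h8 : CongruentDescent.octicSymbol (-4) p * CongruentDescent.octicSymbol (-4) l = -1) :
    (¬ CongruentDescent.PhiTorsorSolvable (p * l : ℤ) 2 ∧
      ¬ CongruentDescent.PhiTorsorSolvable (p * l : ℤ) (p * l : ℚ) ∧
      ¬ CongruentDescent.PhiTorsorSolvable (p * l : ℤ) (2 * (p * l) : ℚ)) ∧
    (CongruentDescent.selmerPhi (p * l : ℤ) =
        Subgroup.closure {CongruentDescent.squareClass 2 two_ne_zero,
          CongruentDescent.squareClass (p * l : ℚ)
            (mul_ne_zero (Nat.cast_ne_zero.mpr (Fact.out : p.Prime).ne_zero)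
              (Nat.cast_ne_zero.mpr (Fact.out : l.Prime).ne_zero))} ∧
      CongruentDescent.solvablePhi (p * l : ℤ) = ⊥ ∧
      Function.Bijective (CongruentDescent.selmerToSha (p * l : ℤ))) ∧
    Nat.card (CongruentDescent.shaTorsion
      (CongruentDescent.congruentCurve (p * l : ℤ)) 2) = 4 := by
  have hk : (p * l : ℚ) ≠ 0 := mul_ne_zero (Nat.cast_ne_zero.mpr (Fact.out : p.Prime).ne_zero)
    (Nat.cast_ne_zero.mpr (Fact.out : l.Prime).ne_zero)
  have hbot := CongruentDescent.solvablePhi_eq_bot hp hl hpl h8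
  exact ⟨CongruentDescent.not_phiTorsorSolvable hp hl hpl h8,
    ⟨CongruentDescent.selmerPhi_eq_closure hp hl hpl hk, hbot,
      CongruentDescent.selmerToSha_bijective hbot⟩,
    CongruentDescent.card_shaTorsion_two hp hl hpl h8⟩
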